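/- **Theorem (detection rate with dynamic thresholds).** Transactions arrive on $[0,\tau]$, $\tau>0$, at the points $t_1\le t_2\le\dots$ of a non-homogeneous Poisson process with continuous intensity $\lambda:[0,\tau]\to[0,\infty)$. Let $\Lambda(t)=\int_0^t\lambda(u)\,du$ and assume $\Lambda(\tau)>0$. The $i$-th transaction has features $X_i\in\mathbb{R}^d$ and a label $Y_i\in\{0,1\}$, where $Y_i=1$ means fraudulent. The pairs $(X_i,Y_i)$ are i.i.d. and independent of the arrival times, and $\beta=P(Y_i=1)>0$. Let $G:\mathbb{R}^d\to[0,1]$ be measurable and let $S_i=G(X_i)$ be the score of transaction $i$. Let $F_S$ be the distribution function of $S_i$, and $F_1$ that of $S_i$ given $Y_i=1$. Let $k\in[0,1]$ and $n_k=\lfloor k\Lambda(\tau)\rfloor$. *Selection rule.* Let $\phi(a)=\int_{(a,\infty)}(s-a)\,dF_S(s)$, and let $\alpha_1,\dots,\alpha_{n_k}$ (Albright's critical curves) solve on $[0,\tau]$ $$\alpha_j'(t)=-\lambda(t)\bigl(\phi(\alpha_j(t))-\phi(\alpha_{j-1}(t))\bigr),\qquad \alpha_j(\tau)=0,\qquad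 j=1,\dots,n_k,$$ with the convention $\phi(\alpha_0(t))=0$. The inspector starts with $n_k$ inspections. When $j\ge1$ inspections are left, a transaction arriving at time $t$ with score $S$ is selected if and only if $S>\alpha_j(t)$, and each selection uses up one inspection. When none is left, no transaction is selected. Let $M$ be the number of transactions selected in $[0,\tau]$. For $1\le j\le M$, let $T_j$ be the waiting time between the $(j-1)$-th and the $j$-th selection, where the $0$-th selection time is $0$; so the $j$-th selection takes place at time $T_1+\dots+T_j$. The detection rate $\Psi_{DT}(k)$ is the expected fraction of fraudulent transactions in $[0,\tau]$ that are selected, given that there is at least one: $$\Psi_{DT}(k)=E\left[\frac{\#\{i: i\text{ is selected},\,Y_i=1\}}{\#\{i: t_i\le\tau,\,Y_i=1\}}\;\middle|\;\#\{i:t_i\le\tau,\,Y_i=1\}\ge1\right].$$ Put $\rho(i)=n_k-i+1$ and $q_{\alpha_j}(t)=\dfrac{1-F_1(\alpha_j(t))}{1-F_S(\alpha_j(t))}$. Let $m_i(t)=\bigl(1-F_S(\alpha_{\rho(i)}(t))\bigr)\lambda(t)$ for $t\in[0,\tau]$, and $m_i(t)=0$ otherwise. Then: 1. For $i=1,\dots,n_k$,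 given that $M\ge i-1$ and given $T_1,\dots,T_{i-1}$, the waiting time $T_i$ has on $(0,\infty)$ the conditional density $$f_{T_i}(t)=m_i\Bigl(\sum_{l<i}T_l+t\Bigr)\exp\Bigl(-\int_0^t m_i\Bigl(\sum_{l<i}T_l+u\Bigr)du\Bigr).$$ Its total mass may be less than $1$; the missing mass is the conditional probability that there is no $i$-th selection in $[0,\tau]$. 2. For $j=1,\dots,n_k$, the expectation $E\bigl[q_{\alpha_{\rho(j)}}(T_1+\dots+T_j)\,\mathbf 1\{M\ge j\}\bigr]$ equals the iterated integral $E_{T_1}\cdots E_{T_j}\bigl[q_{\alpha_{\rho(j)}}(T_1+\dots+T_j)\bigr]$ formed with the densities $f_{T_1},\dots,f_{T_j}$. 3. The detection rate satisfies $$\Psi_{DT}(k)\ \ge\ \frac1{\Lambda(\tau)}\sum_{j=1}^{n_k}E\bigl[q_{\alpha_{\rho(j)}}(T_1+\dots+T_j)\,\mathbf 1\{M\ge j\}\bigr].$$ -/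

import Mathlib

open MeasureTheory ProbabilityTheory Set

namespace FraudDetection

noncomputable section

/-! ### Transactions arriving at the points of a non-homogeneous Poisson process -/

/-- Cumulative rate `Λ(t) = ∫₀ᵗ λ(u) du`. -/
def cumRate (rate : ℝ → ℝ) (t : ℝ) : ℝ := ∫ u in (0 : ℝ)..t, rate u

/-- Number of arrivals up to time `t`, for the sequence `a 0, a 1, …` of arrival times. -/
def numArrivals (a : ℕ → ℝ) (t : ℝ) : ℕ := {i | a i ≤ t}.ncard

/-- The random times `A 0 ≤ A 1 ≤ …` are the arrival times of a non-homogeneous Poisson process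
on `[0, τ]` with intensity `rate`: the counting process has independent increments over `[0, τ]`,
and the increment over `(s, t]` is Poisson with mean `Λ(t) - Λ(s)`. Entries of the sequence that
exceed `τ` play no role (a realization with `N` arrivals in `[0, τ]` has `A i > τ` for `i ≥ N`). -/
structure IsNHPP {Ω : Type*} [MeasurableSpace Ω] (P : Measure Ω) (rate : ℝ → ℝ) (τ : ℝ)
    (A : ℕ → Ω → ℝ) : Prop where
  measurable : ∀ i, Measurable (A i)
  pos : ∀ᵐ ω ∂P, ∀ i, 0 < A i ω
  monotone : ∀ᵐ ω ∂P, Monotone (fun i => A i ω)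
  finite : ∀ᵐ ω ∂P, {i | A i ω ≤ τ}.Finite
  hasLaw_increment : ∀ s t : ℝ, 0 ≤ s → s ≤ t → t ≤ τ →
    HasLaw (fun ω => numArrivals (fun i => A i ω) t - numArrivals (fun i => A i ω) s)
      (poissonMeasure (cumRate rate t - cumRate rate s).toNNReal) P
  indep_increments :
    HasIndepIncrements (fun (t : Icc (0 : ℝ) τ) ω => numArrivals (fun i => A i ω) t) P

/-- The pairs (features, label) of the successive transactions are i.i.d. with law `ν`, and are
independent of the arrival times. The label `true` means fraudulent. -/
structure IsIIDMarking {Ω : Type*} [MeasurableSpace Ω] (P : Measure Ω) {d : ℕ}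
    (ν : Measure ((Fin d → ℝ) × Bool)) (A : ℕ → Ω → ℝ)
    (X : ℕ → Ω → (Fin d → ℝ)) (Y : ℕ → Ω → Bool) : Prop where
  measurable_features : ∀ i, Measurable (X i)
  measurable_label : ∀ i, Measurable (Y i)
  hasLaw : ∀ i, HasLaw (fun ω => (X i ω, Y i ω)) ν P
  iIndep : iIndepFun (fun i ω => (X i ω, Y i ω)) P
  indep_arrivals : IndepFun (fun ω i => A i ω) (fun ω i => (X i ω, Y i ω)) P

/-! ### Class probability and score distributions -/

/-- `β = P(Y = 1)`. -/
def fraudProb {d : ℕ} (ν : Measure ((Fin d → ℝ) × Bool)) : ℝ := ν.real {z | z.2 = true}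

/-- Law of the score `S = G(X)` of a transaction. -/
def scoreLaw {d : ℕ} (ν : Measure ((Fin d → ℝ) × Bool)) (G : (Fin d → ℝ) → ℝ) : Measure ℝ :=
  ν.map (fun z => G z.1)

/-- Law of the score of a fraudulent transaction, i.e. of `G(X)` given `Y = 1`. -/
def fraudScoreLaw {d : ℕ} (ν : Measure ((Fin d → ℝ) × Bool)) (G : (Fin d → ℝ) → ℝ) :
    Measure ℝ :=
  (ProbabilityTheory.cond ν {z | z.2 = true}).map (fun z => G z.1)

/-! ### Critical curves -/

/-- `φ(a) = ∫_a^∞ (s - a) dF(s)`, where `F` is the distribution function of `μ`. -/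
def excess (μ : Measure ℝ) (a : ℝ) : ℝ := ∫ s in Ioi a, (s - a) ∂μ

/-- `α 1, …, α n` solve on `[0, τ]` the system
`α_j' = - λ (φ(α_j) - φ(α_{j-1}))`, `α_j(τ) = 0`, with the convention `φ(α_0) = 0`
(the value of `α 0` is irrelevant). -/
def IsCriticalCurves (μ : Measure ℝ) (rate : ℝ → ℝ) (τ : ℝ) (n : ℕ) (α : ℕ → ℝ → ℝ) : Prop :=
  ∀ j, 1 ≤ j → j ≤ n →
    α j τ = 0 ∧
    ∀ t ∈ Icc 0 τ, HasDerivWithinAt (α j)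
      (-(rate t * (excess μ (α j t) - if j = 1 then 0 else excess μ (α (j - 1) t))))
      (Icc 0 τ) t

/-! ### The selection rule, for a realization of arrival times `a` and scores `s` -/

open Classical in
/-- Inspections left just before the `i`-th transaction (indices start at `0`), with an initial
budget of `n`. With `b` inspections left, a transaction arriving at time `t ≤ τ` with score `s` is
selected if and only if `b > 0` and `s > α_b(t)`; each selection uses up one inspection. -/
def budget (n : ℕ) (α : ℕ → ℝ → ℝ) (τ : ℝ) (a s : ℕ → ℝ) : ℕ → ℕ
  | 0 => n
  | i + 1 =>
    if a i ≤ τ ∧ 0 < budget n α τ a s i ∧ α (budget n α τ a s i) (a i) < s i then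
      budget n α τ a s i - 1
    else budget n α τ a s i

/-- The `i`-th transaction is selected for inspection. -/
def Selected (n : ℕ) (α : ℕ → ℝ → ℝ) (τ : ℝ) (a s : ℕ → ℝ) (i : ℕ) : Prop :=
  a i ≤ τ ∧ 0 < budget n α τ a s i ∧ α (budget n α τ a s i) (a i) < s i

/-- Total number of inspections made in `[0, τ]`. -/
def numInspections (n : ℕ) (α : ℕ → ℝ → ℝ) (τ : ℝ) (a s : ℕ → ℝ) : ℕ :=
  {i | Selected n α τ a s i}.ncard

/-- Time of the `j`-th inspection (`j ≥ 1`), meaningful if at least `j` inspections are made;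
the `0`-th inspection time is `0`. -/
def inspectionTime (n : ℕ) (α : ℕ → ℝ → ℝ) (τ : ℝ) (a s : ℕ → ℝ) : ℕ → ℝ
  | 0 => 0
  | j + 1 => a (Nat.nth (Selected n α τ a s) j)

/-- Waiting time `T_j` between inspections `j - 1` and `j` (`j ≥ 1`), meaningful if at least `j`
inspections are made. -/
def waitingTime (n : ℕ) (α : ℕ → ℝ → ℝ) (τ : ℝ) (a s : ℕ → ℝ) (j : ℕ) : ℝ :=
  inspectionTime n α τ a s j - inspectionTime n α τ a s (j - 1)

/-- Number of fraudulent transactions in `[0, τ]`. -/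
def numFrauds (τ : ℝ) (a : ℕ → ℝ) (y : ℕ → Bool) : ℕ := {i | a i ≤ τ ∧ y i = true}.ncard

/-- Number of fraudulent transactions selected for inspection. -/
def numDetected (n : ℕ) (α : ℕ → ℝ → ℝ) (τ : ℝ) (a s : ℕ → ℝ) (y : ℕ → Bool) : ℕ :=
  {i | Selected n α τ a s i ∧ y i = true}.ncard

/-- Fraud detection rate of the dynamic-threshold rule: the expected fraction of the frauds in
`[0, τ]` that are selected. The fraction is defined when there is at least one fraud, and the
expectation is taken given that event. -/
def detectionRate {Ω : Type*} [MeasurableSpace Ω] (P : Measure Ω) (n : ℕ) (α : ℕ → ℝ → ℝ)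
    (τ : ℝ) (A S : ℕ → Ω → ℝ) (Y : ℕ → Ω → Bool) : ℝ :=
  ∫ ω, (numDetected n α τ (fun i => A i ω) (fun i => S i ω) (fun i => Y i ω) : ℝ) /
      (numFrauds τ (fun i => A i ω) (fun i => Y i ω) : ℝ)
    ∂(ProbabilityTheory.cond P {ω | 1 ≤ numFrauds τ (fun i => A i ω) (fun i => Y i ω)})

/-! ### The explicit densities and the lower bound -/

/-- `m_i(t) = (1 - F_S(α_{ρ(i)}(t))) λ(t)` with `ρ(i) = n - i + 1`, on `[0, τ]`; there are no
arrivals to consider outside `[0, τ]`, where it is `0`. -/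
def thinnedRate (μ : Measure ℝ) (rate : ℝ → ℝ) (τ : ℝ) (n : ℕ) (α : ℕ → ℝ → ℝ) (i : ℕ) :
    ℝ → ℝ :=
  (Icc 0 τ).indicator (fun t => (1 - cdf μ (α (n - i + 1) t)) * rate t)

/-- `m(γ + t) exp(- ∫₀ᵗ m(γ + u) du)`: the (possibly defective) density, on `t > 0`, of the waiting
time from `γ` to the first arrival of a Poisson process with intensity `m`. -/
def waitDensity (m : ℝ → ℝ) (γ t : ℝ) : ℝ :=
  m (γ + t) * Real.exp (-∫ u in (0 : ℝ)..t, m (γ + u))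

/-- Iterated expectation `E_{T_i} E_{T_{i+1}} ⋯ E_{T_{i+r-1}} [g(γ + T_i + ⋯ + T_{i+r-1})]`, over
the event that these waiting times are finite, where `T_l` has density
`waitDensity (m l) (γ + T_i + ⋯ + T_{l-1})` given its predecessors. -/
def iteratedExp (m : ℕ → ℝ → ℝ) (g : ℝ → ℝ) : (r i : ℕ) → (γ : ℝ) → ℝ
  | 0, _, γ => g γ
  | r + 1, i, γ => ∫ t in Ioi (0 : ℝ), waitDensity (m i) γ t * iteratedExp m g r (i + 1) (γ + t)

/-- `q_{α}(t) = (1 - F_1(α(t))) / (1 - F_S(α(t)))`. -/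
def tailRatio (μ₁ μ : Measure ℝ) (a : ℝ → ℝ) (t : ℝ) : ℝ :=
  (1 - cdf μ₁ (a t)) / (1 - cdf μ (a t))

end

end FraudDetection

open FraudDetection

/-!
Everything rests on the Mecke formula for a marked Poisson process (`IsMarkedPoisson.mecke`): the
expected sum, over the points of the process, of a functional of the point and of the configuration
is the integral, against the intensity and the law of the marks, of the same functional for the
configuration with one point added. It is proved first for arrival times rounded up to a grid, where
it is the identity `E[D F(D)] = c E[F(D + 1)]` for a Poisson variable `D` of mean `c` in each cell,
and then for the arrival times themselves by refining the grid.

*Waiting times.* Whether a transaction is inspected depends only on the transactions before it and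
on its own time and score. For the functional that picks out inspection `k + 1`, the Mecke formula
therefore says that `∫ 1{k inspections made by time t} m t dt` is the compensator of its time, where
`m` is the thinned rate (`IsMarkedPoisson.lintegral_inspectionTime_succ`). A time with such a
compensator has the density `m t * exp (-∫ m)` after inspection `k` (`lintegral_eq_hazardExp`). This
gives the conditional densities (`IsMarkedPoisson.measure_waitingTime`) and, by induction on the
number of waiting times, the iterated expectations (`IsMarkedPoisson.integral_eq_iteratedExp`).

*Detection rate.* Let `N` be the number of frauds and `D` the number of detected ones. The mark of
an inspected transaction has the law of a mark given that its score exceeds the threshold, so `E[D]`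
is `P(Y = 1)` times the sum in the lower bound (`IsMarkedPoisson.lintegral_numDetected`), while
`E[N] = P(Y = 1) Λ(τ)`. What is left to prove is `E[D / N | N ≥ 1] ≥ E[D] / E[N]`. This follows from
Chebyshev's sum inequality (`tsum_mul_tsum_le_of_poisson_recursion`) once `E[D | N = m] / m` is
known to decrease with `m`. By the Mecke formula, that is the statement that an additional fraud
does not help to detect the others (`IsMarkedPoisson.mul_lintegral_numDetected_le`). Indeed, it can
only lower the number of inspections left at any later time, since the two numbers move by at most
one and agree for ever after they have met (`budget_insAt_le`); and with fewer inspections left the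
threshold is higher (`IsCriticalCurves.anti`), as `φ` is decreasing and a difference
`α (j + 1) - α j` would be nondecreasing wherever it is positive, although it vanishes at `τ`.

The arrival times matter only up to `τ`, and the intensity and the curves only on `[0, τ]`. Cutting
them off outside makes all data measurable and bounded, and every realization a well-formed arrival
sequence (`IsArrivalSeq`), without changing the claims.
-/

namespace FraudDetection

/-! ### Inserting a point into a sequence -/

/-- The sequence `a` with the entry `x` inserted at index `p`. -/
def insAt {β : Type*} (p : ℕ) (x : β) (a : ℕ → β) (j : ℕ) : β :=
  if j < p then a j else if j = p then x else a (j - 1)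

/-- The index in `insAt p x a` of the `j`-th entry of `a`. -/
def skipAt (p j : ℕ) : ℕ := if j < p then j else j + 1

section insAt

variable {β : Type*} {p : ℕ} {x : β} {a : ℕ → β} {j : ℕ}

lemma insAt_of_lt (h : j < p) : insAt p x a j = a j := by simp [insAt, h]

lemma insAt_self : insAt p x a p = x := by simp [insAt]

lemma insAt_succ (h : p ≤ j) : insAt p x a (j + 1) = a j := by
  simp [insAt, show ¬ j + 1 < p by omega, show j + 1 ≠ p by omega]

lemma insAt_skipAt : insAt p x a (skipAt p j) = a j := by
  unfold skipAt
  split_ifs with h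
  · exact insAt_of_lt h
  · exact insAt_succ (not_lt.mp h)

lemma insAt_comp {γ : Type*} (f : β → γ) :
    (fun j => f (insAt p x a j)) = insAt p (f x) (fun j => f (a j)) := by
  ext j; unfold insAt; split_ifs <;> rfl

lemma skipAt_injective (p : ℕ) : Function.Injective (skipAt p) := by
  intro i j h; unfold skipAt at h; split_ifs at h <;> omega

lemma skipAt_ne (p j : ℕ) : skipAt p j ≠ p := by unfold skipAt; split_ifs <;> omega

lemma range_skipAt (p : ℕ) : range (skipAt p) = {p}ᶜ := by
  ext i
  simp only [mem_range, mem_compl_iff, mem_singleton_iff]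
  refine ⟨fun ⟨j, hj⟩ => hj ▸ skipAt_ne p j, fun h => ?_⟩
  rcases lt_or_gt_of_ne h with h | h
  · exact ⟨i, by simp [skipAt, h]⟩
  · exact ⟨i - 1, by simp [skipAt, show ¬ i - 1 < p by omega]; omega⟩

lemma tsum_skipAt (p : ℕ) (f : ℕ → ENNReal) :
    ∑' j, f j = f p + ∑' j, f (skipAt p j) := by
  have h := (ENNReal.summable (f := fun j : ({p} : Set ℕ) => f j)).tsum_add_tsum_compl
    (s := {p}) (f := f) ENNReal.summable
  rw [← h, ← range_skipAt p, tsum_range f (skipAt_injective p)]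
  simp

end insAt

/-! ### Arrival sequences -/

/-- `a` lists the arrival times in `(0, τ]` in increasing order (repetitions allowed), followed by
the constant `τ + 1`; such a sequence is determined by its counting function on `[0, τ]`. -/
structure IsArrivalSeq (τ : ℝ) (a : ℕ → ℝ) : Prop where
  pos : ∀ i, 0 < a i
  mono : Monotone a
  exists_gt : ∃ k, τ < a k
  trunc : ∀ i, a i ≤ τ ∨ a i = τ + 1

section arrivals

variable {τ : ℝ} {a : ℕ → ℝ}

lemma IsArrivalSeq.finite (h : IsArrivalSeq τ a) {t : ℝ} (ht : t ≤ τ) : {i | a i ≤ t}.Finite := by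
  obtain ⟨k, hk⟩ := h.exists_gt
  refine (finite_Iio k).subset fun i hi => ?_
  by_contra hki
  have := h.mono (not_lt.mp hki)
  simp only [mem_ofPred_eq] at hi
  linarith

lemma setOf_le_eq_Iio_numArrivals (hm : Monotone a) {t : ℝ} (hf : {i | a i ≤ t}.Finite) :
    {i | a i ≤ t} = Iio (numArrivals a t) := by
  have hl : IsLowerSet {i | a i ≤ t} := fun i j hij hi => (hm hij).trans hi
  obtain ⟨N, hN⟩ : ∃ N, {i | a i ≤ t} = Iio N := by
    classical
    have hex : ∃ N, ¬ a N ≤ t := by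
      by_contra hcon
      push Not at hcon
      exact infinite_univ (hf.subset fun i _ => hcon i)
    refine ⟨Nat.find hex, ?_⟩
    ext i
    refine ⟨fun hi => ?_, fun hi => ?_⟩
    · by_contra hc
      exact Nat.find_spec hex (hl (not_lt.mp hc) hi)
    · exact not_not.mp (Nat.find_min hex hi)
  have : numArrivals a t = N := by
    unfold numArrivals; rw [hN]; simp
  rw [this, hN]

lemma IsArrivalSeq.le_iff (h : IsArrivalSeq τ a) {t : ℝ} (ht : t ≤ τ) (i : ℕ) :
    a i ≤ t ↔ i < numArrivals a t := by
  have := setOf_le_eq_Iio_numArrivals h.mono (h.finite ht)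
  exact (Set.ext_iff.mp this i)

lemma IsArrivalSeq.numArrivals_mono (h : IsArrivalSeq τ a) {s t : ℝ} (hst : s ≤ t) (ht : t ≤ τ) :
    numArrivals a s ≤ numArrivals a t :=
  ncard_le_ncard (fun i (hi : a i ≤ s) => hi.trans hst) (h.finite ht)

lemma IsArrivalSeq.numArrivals_zero (h : IsArrivalSeq τ a) : numArrivals a 0 = 0 := by
  have : {i | a i ≤ 0} = ∅ := by
    ext i; simpa using h.pos i
  simp [numArrivals, this]

lemma IsArrivalSeq.insAt (h : IsArrivalSeq τ a) {t : ℝ} (h0 : 0 < t) (ht : t ≤ τ) :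
    IsArrivalSeq τ (insAt (numArrivals a t) t a) := by
  set p := numArrivals a t with hp
  have hlt : ∀ i, i < p → a i ≤ t := fun i hi => (h.le_iff ht i).mpr hi
  have hge : ∀ i, p ≤ i → t < a i := fun i hi => by
    by_contra hc; exact absurd ((h.le_iff ht i).mp (not_lt.mp hc)) (by omega)
  refine ⟨fun i => ?_, monotone_nat_of_le_succ fun i => ?_, ?_, fun i => ?_⟩
  · unfold FraudDetection.insAt; split_ifs
    · exact h.pos _
    · exact h0
    · exact h.pos _
  · rcases lt_trichotomy (i + 1) p with hi | hi | hi
    · rw [insAt_of_lt hi, insAt_of_lt (by omega)]; exact h.mono (by omega)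
    · rw [← hi, insAt_self, insAt_of_lt (by omega)]; exact hlt _ (by omega)
    · rw [insAt_succ (by omega)]
      rcases eq_or_lt_of_le (Nat.lt_succ_iff.mp hi) with h2 | h2
      · rw [← h2, insAt_self]; exact (hge _ le_rfl).le
      · obtain ⟨k, rfl⟩ : ∃ k, i = k + 1 := ⟨i - 1, by omega⟩
        rw [insAt_succ (by omega)]; exact h.mono (by omega)
  · obtain ⟨k, hk⟩ := h.exists_gt
    exact ⟨skipAt p k, by rwa [insAt_skipAt]⟩
  · unfold FraudDetection.insAt; split_ifs
    · exact h.trunc _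
    · exact Or.inl ht
    · exact h.trunc _

lemma IsArrivalSeq.numArrivals_insAt (h : IsArrivalSeq τ a) {s t : ℝ}
    (hs : s ≤ τ) :
    numArrivals (FraudDetection.insAt (numArrivals a t) t a) s =
      numArrivals a s + if t ≤ s then 1 else 0 := by
  set p := numArrivals a t with hp
  have hset : {i | FraudDetection.insAt p t a i ≤ s} =
      skipAt p '' {i | a i ≤ s} ∪ (if t ≤ s then {p} else ∅) := by
    ext i
    by_cases hi : i = p
    · subst hi
      have : p ∉ skipAt p '' {i | a i ≤ s} := by
        rintro ⟨j, -, hj⟩; exact skipAt_ne p j hj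
      by_cases hts : t ≤ s <;> simp [insAt_self, hts, this]
    · obtain ⟨j, rfl⟩ : i ∈ range (skipAt p) := by rw [range_skipAt]; exact hi
      simp only [mem_ofPred_eq, insAt_skipAt, mem_union, (skipAt_injective p).mem_set_image]
      split_ifs <;> simp [hi]
  have hfin := h.finite hs
  unfold numArrivals at hp ⊢
  rw [hset]
  split_ifs with hts
  · rw [ncard_union_eq _ (hfin.image _), ncard_image_of_injective _ (skipAt_injective p)]
    · simp
    · rw [disjoint_singleton_right]; rintro ⟨j, -, hj⟩; exact skipAt_ne p j hj
  · simp [ncard_image_of_injective _ (skipAt_injective p)]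

end arrivals

/-! ### The selection rule on a realization -/

section selection

variable {n : ℕ} {α : ℕ → ℝ → ℝ} {τ : ℝ} {a a' s s' : ℕ → ℝ}

open Classical in
/-- Number of selections among the transactions with index less than `i`. -/
noncomputable def selCount (n : ℕ) (α : ℕ → ℝ → ℝ) (τ : ℝ) (a s : ℕ → ℝ) (i : ℕ) : ℕ :=
  Nat.count (Selected n α τ a s) i

lemma budget_succ_of_selected {i : ℕ} (h : Selected n α τ a s i) :
    budget n α τ a s (i + 1) = budget n α τ a s i - 1 := by
  rw [budget]; exact if_pos h

lemma budget_succ_of_not_selected {i : ℕ} (h : ¬ Selected n α τ a s i) :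
    budget n α τ a s (i + 1) = budget n α τ a s i := by
  rw [budget]; exact if_neg h

lemma selCount_succ_of_selected {i : ℕ} (h : Selected n α τ a s i) :
    selCount n α τ a s (i + 1) = selCount n α τ a s i + 1 := by
  classical
  rw [selCount, Nat.count_succ, if_pos h, selCount]

lemma selCount_succ_of_not_selected {i : ℕ} (h : ¬ Selected n α τ a s i) :
    selCount n α τ a s (i + 1) = selCount n α τ a s i := by
  classical
  rw [selCount, Nat.count_succ, if_neg h, selCount, add_zero]

lemma budget_add_selCount (i : ℕ) : budget n α τ a s i + selCount n α τ a s i = n := by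
  induction i with
  | zero => simp [budget, selCount]
  | succ i ih =>
    by_cases h : Selected n α τ a s i
    · rw [budget_succ_of_selected h, selCount_succ_of_selected h]
      have := h.2.1
      omega
    · rw [budget_succ_of_not_selected h, selCount_succ_of_not_selected h, ih]

lemma budget_le (i : ℕ) : budget n α τ a s i ≤ n := by
  have := budget_add_selCount (n := n) (α := α) (τ := τ) (a := a) (s := s) i
  omega

lemma selected_iff (i : ℕ) : Selected n α τ a s i ↔
    a i ≤ τ ∧ 0 < budget n α τ a s i ∧ α (budget n α τ a s i) (a i) < s i := Iff.rfl

lemma budget_congr {i : ℕ} (h : ∀ l < i, a l = a' l ∧ s l = s' l) :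
    budget n α τ a s i = budget n α τ a' s' i := by
  induction i with
  | zero => rfl
  | succ i ih =>
    have h1 := ih fun l hl => h l (by omega)
    obtain ⟨h2, h3⟩ := h i (by omega)
    rw [budget, budget, h1, h2, h3]

lemma selected_congr {i : ℕ} (h : ∀ l ≤ i, a l = a' l ∧ s l = s' l) :
    Selected n α τ a s i ↔ Selected n α τ a' s' i := by
  obtain ⟨h2, h3⟩ := h i le_rfl
  rw [selected_iff, selected_iff, budget_congr fun l hl => h l hl.le, h2, h3]

lemma selCount_congr {i : ℕ} (h : ∀ l < i, a l = a' l ∧ s l = s' l) :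
    selCount n α τ a s i = selCount n α τ a' s' i := by
  have h1 := budget_add_selCount (n := n) (α := α) (τ := τ) (a := a) (s := s) i
  have h2 := budget_add_selCount (n := n) (α := α) (τ := τ) (a := a') (s := s') i
  rw [budget_congr h] at h1
  omega

lemma nth_selected {i : ℕ} (h : Selected n α τ a s i) :
    Nat.nth (Selected n α τ a s) (selCount n α τ a s i) = i := by
  classical
  exact Nat.nth_count h

lemma inspectionTime_of_selected {i : ℕ} (h : Selected n α τ a s i) :
    inspectionTime n α τ a s (selCount n α τ a s i + 1) = a i := by
  rw [inspectionTime, nth_selected h]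

lemma exists_selected_of_lt_selCount {i k : ℕ} (h : k < selCount n α τ a s i) :
    ∃ l < i, Selected n α τ a s l ∧ selCount n α τ a s l = k := by
  induction i with
  | zero => simp [selCount] at h
  | succ i ih =>
    by_cases hs : Selected n α τ a s i
    · rw [selCount_succ_of_selected hs] at h
      rcases Nat.lt_succ_iff_lt_or_eq.mp h with h | h
      · obtain ⟨l, hl, h2⟩ := ih h; exact ⟨l, by omega, h2⟩
      · exact ⟨i, by omega, hs, h.symm⟩
    · rw [selCount_succ_of_not_selected hs] at h
      obtain ⟨l, hl, h2⟩ := ih h; exact ⟨l, by omega, h2⟩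

lemma inspectionTime_congr {i k : ℕ} (h : ∀ l < i, a l = a' l ∧ s l = s' l)
    (hk : k ≤ selCount n α τ a s i) :
    inspectionTime n α τ a s k = inspectionTime n α τ a' s' k := by
  rcases k with _ | k
  · rfl
  · obtain ⟨l, hl, hs, rfl⟩ := exists_selected_of_lt_selCount hk
    have hs' := (selected_congr fun m hm => h m (by omega)).mp hs
    rw [inspectionTime_of_selected hs, selCount_congr fun m hm => h m (by omega),
      inspectionTime_of_selected hs', (h l hl).1]

lemma waitingTime_congr {i k : ℕ} (h : ∀ l < i, a l = a' l ∧ s l = s' l)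
    (hk : k ≤ selCount n α τ a s i) :
    waitingTime n α τ a s k = waitingTime n α τ a' s' k := by
  rw [waitingTime, waitingTime, inspectionTime_congr h hk, inspectionTime_congr h (by omega)]

lemma sum_waitingTime (j : ℕ) :
    ∑ l ∈ Finset.Icc 1 j, waitingTime n α τ a s l = inspectionTime n α τ a s j := by
  induction j with
  | zero => simp [inspectionTime]
  | succ j ih =>
    rw [Finset.sum_Icc_succ_top (by omega), ih, waitingTime]
    simp

lemma finite_selected (hf : {i | a i ≤ τ}.Finite) : {i | Selected n α τ a s i}.Finite :=
  hf.subset fun _ hi => hi.1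

lemma selCount_mono : Monotone (selCount n α τ a s) := by
  classical
  exact Nat.count_monotone _

lemma selCount_le_numInspections (hf : {i | a i ≤ τ}.Finite) (i : ℕ) :
    selCount n α τ a s i ≤ numInspections n α τ a s := by
  classical
  have := Nat.count_le_card (p := Selected n α τ a s) (finite_selected hf) i
  rw [numInspections, ncard_eq_toFinset_card _ (finite_selected hf)]
  exact this

lemma lt_numInspections_iff (hf : {i | a i ≤ τ}.Finite) (j : ℕ) :
    j < numInspections n α τ a s ↔ ∃ i, Selected n α τ a s i ∧ selCount n α τ a s i = j := by
  constructor
  · intro h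
    obtain ⟨N, hN⟩ := (finite_selected (n := n) (α := α) (s := s) hf).bddAbove
    have : selCount n α τ a s (N + 1) = numInspections n α τ a s := by
      classical
      rw [selCount, Nat.count_eq_card_filter_range, numInspections,
        ncard_eq_toFinset_card _ (finite_selected hf)]
      congr 1
      ext i
      simp only [Finset.mem_filter, Finset.mem_range, Finite.mem_toFinset, mem_ofPred_eq,
        and_iff_right_iff_imp]
      intro hi
      exact Nat.lt_succ_of_le (hN hi)
    obtain ⟨l, -, h2⟩ := exists_selected_of_lt_selCount (this ▸ h)
    exact ⟨l, h2⟩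
  · rintro ⟨i, hi, rfl⟩
    have := selCount_le_numInspections (n := n) (α := α) (s := s) hf (i + 1)
    rw [selCount_succ_of_selected hi] at this
    omega

lemma selected_unique {i l : ℕ} (hi : Selected n α τ a s i) (hl : Selected n α τ a s l)
    (h : selCount n α τ a s i = selCount n α τ a s l) : i = l := by
  rw [← nth_selected hi, ← nth_selected hl, h]

lemma numInspections_le (hf : {i | a i ≤ τ}.Finite) : numInspections n α τ a s ≤ n := by
  by_contra hc
  obtain ⟨i, hi, h2⟩ := (lt_numInspections_iff hf n).mp (not_le.mp hc)
  have := budget_add_selCount (n := n) (α := α) (τ := τ) (a := a) (s := s) i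
  have := hi.2.1
  omega

/-- Just after time `t` at least `k` inspections have been made if and only if the `k`-th
inspection takes place and does so no later than `t`. -/
lemma le_selCount_numArrivals_iff (h : IsArrivalSeq τ a) {t : ℝ} (h0 : 0 ≤ t) (ht : t ≤ τ)
    (k : ℕ) :
    k ≤ selCount n α τ a s (numArrivals a t) ↔
      k ≤ numInspections n α τ a s ∧ inspectionTime n α τ a s k ≤ t := by
  have hf := h.finite le_rfl
  rcases k with _ | k
  · simp [inspectionTime, h0]
  constructor
  · intro hk
    refine ⟨hk.trans (selCount_le_numInspections hf _), ?_⟩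
    obtain ⟨l, hl, hs, rfl⟩ := exists_selected_of_lt_selCount hk
    rw [inspectionTime_of_selected hs]
    exact (h.le_iff ht l).mpr hl
  · rintro ⟨h1, h2⟩
    obtain ⟨i, hi, rfl⟩ := (lt_numInspections_iff hf k).mp h1
    rw [inspectionTime_of_selected hi] at h2
    rw [← selCount_succ_of_selected hi]
    exact selCount_mono ((h.le_iff ht i).mp h2)

lemma selCount_numArrivals_eq_iff (h : IsArrivalSeq τ a) {t : ℝ} (h0 : 0 ≤ t) (ht : t ≤ τ)
    (k : ℕ) :
    selCount n α τ a s (numArrivals a t) = k ↔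
      (k ≤ numInspections n α τ a s ∧ inspectionTime n α τ a s k ≤ t) ∧
      (k + 1 ≤ numInspections n α τ a s → t < inspectionTime n α τ a s (k + 1)) := by
  have hk : selCount n α τ a s (numArrivals a t) = k ↔
      k ≤ selCount n α τ a s (numArrivals a t) ∧
        ¬ k + 1 ≤ selCount n α τ a s (numArrivals a t) := by
    omega
  rw [hk, le_selCount_numArrivals_iff h h0 ht, le_selCount_numArrivals_iff h h0 ht, not_and, not_le]

/-- Inserting an extra transaction can only lower the number of inspections left at a later
transaction: a transaction uses up at most one inspection, so the two numbers cannot cross without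
meeting, and from a meeting on the two rules act alike. -/
lemma budget_insAt_le (p : ℕ) (x y : ℝ) (j : ℕ) :
    budget n α τ (insAt p x a) (insAt p y s) (skipAt p j) ≤ budget n α τ a s j := by
  have hstep : ∀ j b, b ≤ budget n α τ a s j →
      (a j ≤ τ ∧ 0 < b ∧ α b (a j) < s j → b - 1 ≤ budget n α τ a s (j + 1)) ∧
      (¬ (a j ≤ τ ∧ 0 < b ∧ α b (a j) < s j) → b ≤ budget n α τ a s (j + 1)) := by
    intro j b hb
    by_cases hs : Selected n α τ a s j
    · rw [budget_succ_of_selected hs]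
      refine ⟨fun _ => by omega, fun h => ?_⟩
      by_contra hc
      have hb' : b = budget n α τ a s j := by omega
      exact h (hb' ▸ hs)
    · rw [budget_succ_of_not_selected hs]
      exact ⟨fun _ => by omega, fun _ => hb⟩
  have hlt : ∀ j ≤ p, budget n α τ (insAt p x a) (insAt p y s) j = budget n α τ a s j :=
    fun j hj => budget_congr fun l hl => ⟨insAt_of_lt (by omega), insAt_of_lt (by omega)⟩
  by_cases hj : j < p
  · rw [skipAt, if_pos hj, hlt j hj.le]
  · rw [skipAt, if_neg hj]
    obtain ⟨k, rfl⟩ : ∃ k, j = p + k := ⟨j - p, by omega⟩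
    clear hj
    induction k with
    | zero =>
      rw [add_zero, ← hlt p le_rfl]
      by_cases hs : Selected n α τ (insAt p x a) (insAt p y s) p
      · rw [budget_succ_of_selected hs]; omega
      · rw [budget_succ_of_not_selected hs]
    | succ k ih =>
      obtain ⟨h1, h2⟩ := hstep (p + k) _ ih
      by_cases hs : Selected n α τ (insAt p x a) (insAt p y s) (p + k + 1)
      · rw [← add_assoc, budget_succ_of_selected hs]
        rw [selected_iff, insAt_succ (by omega), insAt_succ (by omega)] at hs
        exact h1 hs
      · rw [← add_assoc, budget_succ_of_not_selected hs]
        rw [selected_iff, insAt_succ (by omega), insAt_succ (by omega)] at hs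
        exact h2 hs

/-- A transaction that is selected although an extra transaction has been inserted is selected
without it too: fewer inspections left mean a higher critical curve. -/
lemma selected_of_selected_insAt
    (hα : ∀ b b', 1 ≤ b' → b' ≤ b → b ≤ n → ∀ t ∈ Icc 0 τ, α b t ≤ α b' t)
    (ha : ∀ i, 0 < a i) (p : ℕ) (x y : ℝ) (j : ℕ)
    (h : Selected n α τ (insAt p x a) (insAt p y s) (skipAt p j)) : Selected n α τ a s j := by
  have hb := budget_insAt_le (n := n) (α := α) (τ := τ) (a := a) (s := s) p x y j
  rw [selected_iff, insAt_skipAt, insAt_skipAt] at h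
  exact ⟨h.1, h.2.1.trans_le hb,
    (hα _ _ h.2.1 hb (budget_le j) _ ⟨(ha j).le, h.1⟩).trans_lt h.2.2⟩

end selection

/-! ### Measurability of counting functions -/

lemma tsum_ite_eq_encard (p : ℕ → Prop) [DecidablePred p] :
    ∑' i, (if p i then 1 else 0 : ENNReal) = ({i | p i}.encard : ENNReal) := by
  rw [← ENNReal.tsum_set_one, tsum_subtype {i | p i} (fun _ => (1 : ENNReal))]
  refine tsum_congr fun i => ?_
  by_cases h : p i <;> simp [indicator, h]

lemma ncard_eq_toReal_tsum (p : ℕ → Prop) [DecidablePred p] :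
    ({i | p i}.ncard : ℝ) = (∑' i, (if p i then 1 else 0 : ENNReal)).toReal := by
  rw [tsum_ite_eq_encard, ncard]
  induction {i | p i}.encard using ENat.recTopCoe with
  | top => simp
  | coe m => simp

lemma natCast_ncard_eq_tsum {p : ℕ → Prop} [DecidablePred p] (h : {i | p i}.Finite) :
    ({i | p i}.ncard : ENNReal) = ∑' i, (if p i then 1 else 0 : ENNReal) := by
  rw [tsum_ite_eq_encard, ← h.cast_ncard_eq]; rfl

lemma measurable_ncard {𝓧 : Type*} [MeasurableSpace 𝓧] {p : ℕ → 𝓧 → Prop}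
    (hp : ∀ i, MeasurableSet {x | p i x}) : Measurable fun x => {i | p i x}.ncard := by
  classical
  have h : Measurable fun x => ({i | p i x}.ncard : ℝ) := by
    simp_rw [ncard_eq_toReal_tsum]
    exact (Measurable.tsum fun i => Measurable.ite (hp i) measurable_const
      measurable_const).ennreal_toReal
  refine measurable_to_countable' fun m => ?_
  have : (fun x => {i | p i x}.ncard) ⁻¹' {m} =
      (fun x => ({i | p i x}.ncard : ℝ)) ⁻¹' {(m : ℝ)} := by
    ext x; simp
  rw [this]
  exact h (measurableSet_singleton _)

lemma Measurable.comp_index {𝓧 β : Type*} [MeasurableSpace 𝓧] [MeasurableSpace β]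
    {a : 𝓧 → ℕ → β} (ha : Measurable a) {i : 𝓧 → ℕ} (hi : Measurable i) :
    Measurable fun x => a x (i x) := by
  have h : Measurable fun y : ℕ × (ℕ → β) => y.2 y.1 :=
    measurable_from_prod_countable_right fun i => measurable_pi_apply i
  exact h.comp (hi.prodMk ha)

lemma measurable_numArrivals {𝓧 : Type*} [MeasurableSpace 𝓧] {a : 𝓧 → ℕ → ℝ} (ha : Measurable a)
    {t : 𝓧 → ℝ} (ht : Measurable t) : Measurable fun x => numArrivals (a x) (t x) :=
  measurable_ncard fun i => measurableSet_le ((measurable_pi_apply i).comp ha) ht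

lemma Measurable.insAt {𝓧 β : Type*} [MeasurableSpace 𝓧] [MeasurableSpace β]
    {p : 𝓧 → ℕ} (hp : Measurable p) {x : 𝓧 → β} (hx : Measurable x) {a : 𝓧 → ℕ → β}
    (ha : Measurable a) : Measurable fun y => insAt (p y) (x y) (a y) := by
  refine measurable_pi_lambda _ fun j => ?_
  unfold FraudDetection.insAt
  refine Measurable.ite (measurableSet_lt measurable_const hp) ((measurable_pi_apply j).comp ha) ?_
  exact Measurable.ite (measurableSet_eq_fun measurable_const hp) hx
    ((measurable_pi_apply (j - 1)).comp ha)

/-! ### Independent Poisson variables -/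

lemma succ_mul_poissonMeasure_singleton (c : NNReal) (m : ℕ) :
    ((m + 1 : ℕ) : ENNReal) * poissonMeasure c {m + 1} = c * poissonMeasure c {m} := by
  rw [poissonMeasure_singleton, poissonMeasure_singleton, ← ENNReal.ofReal_natCast,
    ← ENNReal.ofReal_coe_nnreal, ← ENNReal.ofReal_mul (by positivity),
    ← ENNReal.ofReal_mul (by positivity)]
  congr 1
  rw [Nat.factorial_succ]
  push_cast
  field_simp
  ring

/-- For a vector `D` of independent Poisson variables with means `c j`,
`E[D l * F(D)] = c l * E[F(D + e l)]`. -/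
lemma lintegral_mul_poisson_vector {Ω : Type*} [MeasurableSpace Ω] {P : Measure Ω}
    [IsProbabilityMeasure P] {K : ℕ} {D : Fin K → Ω → ℕ} {c : Fin K → NNReal}
    (hD : ∀ j, HasLaw (D j) (poissonMeasure (c j)) P) (hi : iIndepFun D P)
    (F : (Fin K → ℕ) → ENNReal) (l : Fin K) :
    ∫⁻ ω, (D l ω : ENNReal) * F (fun j => D j ω) ∂P =
      c l * ∫⁻ ω, F (fun j => D j ω + (Pi.single l 1 : Fin K → ℕ) j) ∂P := by
  have hlaw := iIndepFun.hasLaw_pi hD hi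
  have key : ∀ H : (Fin K → ℕ) → ENNReal, ∫⁻ ω, H (fun j => D j ω) ∂P =
      ∑' x : Fin K → ℕ, H x * ∏ j, poissonMeasure (c j) {x j} := by
    intro H
    rw [hlaw.lintegral_comp (f := H) (by fun_prop), lintegral_countable']
    simp_rw [Measure.pi_singleton]
  rw [key (fun x => (x l : ENNReal) * F x),
    key (fun x => F (fun j => x j + (Pi.single l 1 : Fin K → ℕ) j)), ← ENNReal.tsum_mul_left]
  have hinj : Function.Injective fun x : Fin K → ℕ => x + Pi.single l 1 :=
    add_left_injective _
  rw [← hinj.tsum_eq]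
  · refine tsum_congr fun x => ?_
    have hprod : ((x l + 1 : ℕ) : ENNReal) *
        ∏ j, poissonMeasure (c j) {(x + Pi.single l 1 : Fin K → ℕ) j} =
        c l * ∏ j, poissonMeasure (c j) {x j} := by
      rw [← Finset.mul_prod_erase _ _ (Finset.mem_univ l),
        ← Finset.mul_prod_erase _ (fun j => poissonMeasure (c j) {x j}) (Finset.mem_univ l),
        ← mul_assoc, ← mul_assoc]
      congr 1
      · simpa using succ_mul_poissonMeasure_singleton (c l) (x l)
      · refine Finset.prod_congr rfl fun j hj => ?_
        rw [Pi.add_apply, Pi.single_eq_of_ne (Finset.ne_of_mem_erase hj), add_zero]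
    calc _ = F (x + Pi.single (M := fun _ => ℕ) l 1) * (((x l + 1 : ℕ) : ENNReal) *
          ∏ j, poissonMeasure (c j) {(x + Pi.single l 1 : Fin K → ℕ) j}) := by
          simp only [Pi.add_apply, Pi.single_eq_same]
          ring
      _ = _ := by rw [hprod]; simp only [← Pi.add_apply]; ring_nf
  · intro x hx
    have hxl : x l ≠ 0 := by
      intro h0; simp [h0] at hx
    refine ⟨x - Pi.single l 1, ?_⟩
    ext j
    by_cases hj : j = l
    · subst hj; simp; omega
    · simp [Pi.single_eq_of_ne hj]

/-! ### The Mecke formula for the arrival times -/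

/-- `A 0 ≤ A 1 ≤ …` are the points of a Poisson process on `(0, τ]` with finite intensity measure
`I`, every realization being an arrival sequence in the sense of `IsArrivalSeq`. -/
structure IsPoissonArrivals {Ω : Type*} [MeasurableSpace Ω] (P : Measure Ω) (I : Measure ℝ)
    (τ : ℝ) (A : Ω → ℕ → ℝ) : Prop where
  measurable : Measurable A
  isArrivalSeq : ∀ ω, IsArrivalSeq τ (A ω)
  hasLaw_increment : ∀ s t : ℝ, 0 ≤ s → s ≤ t → t ≤ τ →
    HasLaw (fun ω => numArrivals (A ω) t - numArrivals (A ω) s)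
      (poissonMeasure (I (Ioc s t)).toNNReal) P
  indep_increments : HasIndepIncrements (fun (t : Icc (0 : ℝ) τ) ω => numArrivals (A ω) t) P

section discretization

/-- The `j`-th point of the regular grid that cuts `[0, τ]` into `K` intervals. -/
noncomputable def gridPt (τ : ℝ) (K j : ℕ) : ℝ := τ * j / K

/-- Times in `[0, τ]` rounded up to the grid; later times become `τ + 1`. -/
noncomputable def roundUp (τ : ℝ) (K : ℕ) (t : ℝ) : ℝ :=
  if t ≤ τ then gridPt τ K ⌈t * K / τ⌉₊ else τ + 1

open Classical in
/-- The rounded arrival sequence that has `D l` arrivals in the `l`-th interval of the grid. -/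
noncomputable def seqOfIncrements (τ : ℝ) (K : ℕ) (D : Fin K → ℕ) (k : ℕ) : ℝ :=
  if h : ∃ j, j ≤ K ∧ k < ∑ l : Fin K, if (l : ℕ) < j then D l else 0 then
    gridPt τ K (Nat.find h) else τ + 1

variable {τ : ℝ} {K : ℕ} {a : ℕ → ℝ}

lemma gridPt_zero : gridPt τ K 0 = 0 := by simp [gridPt]

lemma gridPt_self (hK : 0 < K) : gridPt τ K K = τ := by
  have : (K : ℝ) ≠ 0 := by positivity
  simp [gridPt, this]

lemma gridPt_mono (hτ : 0 < τ) : Monotone (gridPt τ K) := by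
  intro i j h; unfold gridPt; gcongr

lemma gridPt_le (hτ : 0 < τ) (hK : 0 < K) {j : ℕ} (hj : j ≤ K) : gridPt τ K j ≤ τ :=
  (gridPt_mono hτ hj).trans_eq (gridPt_self hK)

lemma gridPt_nonneg (hτ : 0 < τ) (j : ℕ) : 0 ≤ gridPt τ K j := by unfold gridPt; positivity

lemma ceil_le_iff_le_gridPt (hτ : 0 < τ) (hK : 0 < K) (t : ℝ) (j : ℕ) :
    ⌈t * K / τ⌉₊ ≤ j ↔ t ≤ gridPt τ K j := by
  have : (0 : ℝ) < K := by positivity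
  rw [Nat.ceil_le, gridPt, div_le_iff₀ hτ, le_div_iff₀ this, mul_comm τ]

lemma roundUp_of_mem (hτ : 0 < τ) (hK : 0 < K) {j : ℕ} (hj : j < K) {t : ℝ}
    (ht : t ∈ Ioc (gridPt τ K j) (gridPt τ K (j + 1))) :
    roundUp τ K t = gridPt τ K (j + 1) := by
  rw [roundUp, if_pos (ht.2.trans (gridPt_le hτ hK hj))]
  congr 1
  apply le_antisymm
  · exact (ceil_le_iff_le_gridPt hτ hK t (j + 1)).mpr ht.2
  · by_contra hc
    exact absurd ((ceil_le_iff_le_gridPt hτ hK t j).mp (by omega)) (not_le.mpr ht.1)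

lemma measurable_roundUp : Measurable (roundUp τ K) := by
  unfold roundUp
  refine Measurable.ite measurableSet_Iic ?_ measurable_const
  have : Measurable fun m : ℕ => gridPt τ K m := measurable_from_top
  exact this.comp (Nat.measurable_ceil.comp (by fun_prop))

lemma tendsto_roundUp (hτ : 0 < τ) {t : ℝ} (h : 0 < t ∧ t ≤ τ ∨ t = τ + 1) :
    Filter.Tendsto (fun K : ℕ => roundUp τ (K + 1) t) Filter.atTop (nhds t) := by
  rcases h with ⟨h0, ht⟩ | rfl
  · have hlim : Filter.Tendsto (fun K : ℕ => t + τ * (1 / ((K : ℝ) + 1))) Filter.atTop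
        (nhds t) := by
      simpa using (tendsto_one_div_add_atTop_nhds_zero_nat.const_mul τ).const_add t
    refine tendsto_of_tendsto_of_tendsto_of_le_of_le tendsto_const_nhds hlim ?_ ?_
    · intro K
      change t ≤ roundUp τ (K + 1) t
      rw [roundUp, if_pos ht]
      exact (ceil_le_iff_le_gridPt hτ (by omega) t _).mp le_rfl
    · intro K
      change roundUp τ (K + 1) t ≤ _
      rw [roundUp, if_pos ht]
      have h1 := (Nat.ceil_lt_add_one (a := t * ((K + 1 : ℕ) : ℝ) / τ) (by positivity)).le
      have hK : (0 : ℝ) < ((K + 1 : ℕ) : ℝ) := by positivity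
      rw [gridPt, div_le_iff₀ hK]
      calc τ * (⌈t * ((K + 1 : ℕ) : ℝ) / τ⌉₊ : ℝ) ≤ τ * (t * ((K + 1 : ℕ) : ℝ) / τ + 1) := by
            gcongr
        _ = _ := by push_cast; field_simp
  · have : ∀ K, roundUp τ (K + 1) (τ + 1) = τ + 1 := fun K => by
      rw [roundUp, if_neg (by linarith)]
    simp [this]

lemma IsArrivalSeq.tendsto_roundUp (hτ : 0 < τ) (h : IsArrivalSeq τ a) :
    Filter.Tendsto (fun K : ℕ => fun i => roundUp τ (K + 1) (a i)) Filter.atTop (nhds a) :=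
  tendsto_pi_nhds.mpr fun i => FraudDetection.tendsto_roundUp hτ
    ((h.trunc i).imp (fun hi => ⟨h.pos i, hi⟩) id)

/-- Rounding loses all information on an arrival sequence except its increments over the grid. -/
lemma IsArrivalSeq.roundUp_eq (hτ : 0 < τ) (hK : 0 < K) (h : IsArrivalSeq τ a) {D : Fin K → ℕ}
    (hD : ∀ j ≤ K, numArrivals a (gridPt τ K j) = ∑ l : Fin K, if (l : ℕ) < j then D l else 0)
    (k : ℕ) : roundUp τ K (a k) = seqOfIncrements τ K D k := by
  classical
  have hiff : ∀ j, (j ≤ K ∧ k < ∑ l : Fin K, if (l : ℕ) < j then D l else 0) ↔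
      (j ≤ K ∧ ⌈a k * K / τ⌉₊ ≤ j) := by
    intro j
    refine and_congr_right fun hj => ?_
    rw [← hD j hj, ← h.le_iff (gridPt_le hτ hK hj), ceil_le_iff_le_gridPt hτ hK]
  unfold roundUp seqOfIncrements
  by_cases hk : a k ≤ τ
  · have hle : ⌈a k * K / τ⌉₊ ≤ K :=
      (ceil_le_iff_le_gridPt hτ hK _ _).mpr (by rwa [gridPt_self hK])
    have hex : ∃ j, j ≤ K ∧ k < ∑ l : Fin K, if (l : ℕ) < j then D l else 0 :=
      ⟨_, (hiff _).mpr ⟨hle, le_rfl⟩⟩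
    rw [if_pos hk, dif_pos hex]
    congr 1
    apply le_antisymm
    · exact ((hiff _).mp (Nat.find_spec hex)).2
    · exact Nat.find_min' hex ((hiff _).mpr ⟨hle, le_rfl⟩)
  · rw [if_neg hk, dif_neg]
    rintro ⟨j, hj⟩
    obtain ⟨h1, h2⟩ := (hiff j).mp hj
    exact hk (((ceil_le_iff_le_gridPt hτ hK _ _).mp h2).trans (gridPt_le hτ hK h1))

/-- Increments of the counting function over the grid. -/
noncomputable def gridIncrement (τ : ℝ) (K : ℕ) (a : ℕ → ℝ) (l : Fin K) : ℕ :=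
  numArrivals a (gridPt τ K (l + 1)) - numArrivals a (gridPt τ K l)

lemma IsArrivalSeq.numArrivals_gridPt (hτ : 0 < τ) (hK : 0 < K) (h : IsArrivalSeq τ a) :
    ∀ j ≤ K, numArrivals a (gridPt τ K j) =
      ∑ l : Fin K, if (l : ℕ) < j then gridIncrement τ K a l else 0 := by
  intro j hj
  induction j with
  | zero => simp [gridPt_zero, h.numArrivals_zero]
  | succ j ih =>
    have hsplit : ∀ l : Fin K, (if (l : ℕ) < j + 1 then gridIncrement τ K a l else 0) =
        (if (l : ℕ) < j then gridIncrement τ K a l else 0) +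
          if l = ⟨j, hj⟩ then gridIncrement τ K a l else 0 := by
      intro l
      have : l = ⟨j, hj⟩ ↔ (l : ℕ) = j := by rw [Fin.ext_iff]
      simp only [this]
      split_ifs <;> omega
    simp_rw [hsplit]
    rw [Finset.sum_add_distrib, ← ih (by omega)]
    simp only [Finset.sum_ite_eq', Finset.mem_univ, if_true, gridIncrement]
    have := h.numArrivals_mono (gridPt_mono (K := K) hτ (Nat.le_succ j)) (gridPt_le hτ hK hj)
    simp only [Nat.succ_eq_add_one] at this ⊢
    omega

lemma IsArrivalSeq.roundUp_eq_seqOfIncrements (hτ : 0 < τ) (hK : 0 < K) (h : IsArrivalSeq τ a) :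
    (fun k => roundUp τ K (a k)) = seqOfIncrements τ K (gridIncrement τ K a) :=
  funext fun k => h.roundUp_eq hτ hK (h.numArrivals_gridPt hτ hK) k

lemma IsArrivalSeq.gridIncrement_insAt (hτ : 0 < τ) (hK : 0 < K) (h : IsArrivalSeq τ a)
    {l : Fin K} {t : ℝ} (ht : t ∈ Ioc (gridPt τ K l) (gridPt τ K (l + 1))) :
    gridIncrement τ K (FraudDetection.insAt (numArrivals a t) t a) =
      fun j => gridIncrement τ K a j + (Pi.single l 1 : Fin K → ℕ) j := by
  ext j
  have h1 := gridPt_le hτ hK j.2.le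
  have h2 := gridPt_le hτ hK (show (j : ℕ) + 1 ≤ K from j.2)
  have hm := h.numArrivals_mono (gridPt_mono (K := K) hτ (Nat.le_succ j)) h2
  simp only [Nat.succ_eq_add_one] at hm
  rw [gridIncrement, gridIncrement, h.numArrivals_insAt h1, h.numArrivals_insAt h2]
  rcases lt_trichotomy j l with hjl | rfl | hjl
  · have h3 : gridPt τ K (j + 1) < t :=
      (gridPt_mono hτ (show (j : ℕ) + 1 ≤ l from hjl)).trans_lt ht.1
    have h4 : gridPt τ K j < t := (gridPt_mono hτ (show (j : ℕ) ≤ l from hjl.le)).trans_lt ht.1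
    simp [hjl.ne, not_le.mpr h3, not_le.mpr h4]
  · simp [not_le.mpr ht.1, ht.2]; omega
  · have h3 : t ≤ gridPt τ K j := ht.2.trans (gridPt_mono hτ (show (l : ℕ) + 1 ≤ j from hjl))
    have h4 : t ≤ gridPt τ K (j + 1) := h3.trans (gridPt_mono hτ (Nat.le_succ _))
    simp [hjl.ne', h3, h4]

lemma IsArrivalSeq.tsum_roundUp (hτ : 0 < τ) (hK : 0 < K) (h : IsArrivalSeq τ a)
    (f : ℝ → ENNReal) :
    ∑' i, (if a i ≤ τ then f (roundUp τ K (a i)) else 0) =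
      ∑ l : Fin K, (gridIncrement τ K a l : ENNReal) * f (gridPt τ K (l + 1)) := by
  have hgen : ∀ m ≤ K, ∑ i ∈ Finset.range (numArrivals a (gridPt τ K m)),
      f (roundUp τ K (a i)) = ∑ l ∈ Finset.range m,
        ((numArrivals a (gridPt τ K (l + 1)) - numArrivals a (gridPt τ K l) : ℕ) : ENNReal) *
          f (gridPt τ K (l + 1)) := by
    intro m hm
    induction m with
    | zero => simp [gridPt_zero, h.numArrivals_zero]
    | succ m ih =>
      have hle := h.numArrivals_mono (gridPt_mono (K := K) hτ (Nat.le_succ m)) (gridPt_le hτ hK hm)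
      rw [Finset.sum_range_succ, ← ih (by omega), ← Finset.sum_range_add_sum_Ico _ hle]
      congr 1
      rw [Finset.sum_congr rfl (g := fun _ => f (gridPt τ K (m + 1)))]
      · simp
      · intro i hi
        rw [Finset.mem_Ico] at hi
        rw [roundUp_of_mem hτ hK (show m < K by omega)]
        refine ⟨?_, (h.le_iff (gridPt_le hτ hK hm) i).mpr hi.2⟩
        by_contra hc
        have := (h.le_iff (gridPt_le hτ hK (by omega)) i).mp (not_lt.mp hc)
        omega
  simp only [gridIncrement]
  rw [Fin.sum_univ_eq_sum_range (fun l =>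
    ((numArrivals a (gridPt τ K (l + 1)) - numArrivals a (gridPt τ K l) : ℕ) : ENNReal) *
          f (gridPt τ K (l + 1))) K, ← hgen K le_rfl, gridPt_self hK,
    tsum_eq_sum (s := Finset.range (numArrivals a τ))]
  · refine Finset.sum_congr rfl fun i hi => ?_
    rw [if_pos ((h.le_iff le_rfl i).mpr (Finset.mem_range.mp hi))]
  · intro i hi
    rw [if_neg fun hc => hi (Finset.mem_range.mpr ((h.le_iff le_rfl i).mp hc))]

end discretization

lemma measurableSet_isArrivalSeq {τ : ℝ} : MeasurableSet {a : ℕ → ℝ | IsArrivalSeq τ a} := by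
  have : {a : ℕ → ℝ | IsArrivalSeq τ a} = {a | ∀ i, 0 < a i} ∩ {a | ∀ i, a i ≤ a (i + 1)} ∩
      {a | ∃ k, τ < a k} ∩ {a | ∀ i, a i ≤ τ ∨ a i = τ + 1} := by
    ext a
    exact ⟨fun h => ⟨⟨⟨h.pos, fun i => h.mono (Nat.le_succ i)⟩, h.exists_gt⟩, h.trunc⟩,
      fun h => ⟨h.1.1.1, monotone_nat_of_le_succ h.1.1.2, h.1.2, h.2⟩⟩
  have hm : ∀ i, Measurable fun a : ℕ → ℝ => a i := measurable_pi_apply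
  rw [this]
  simp only [ofPred_forall, ofPred_exists, ofPred_or]
  refine (((MeasurableSet.iInter fun i => ?_).inter (.iInter fun i => ?_)).inter
    (.iUnion fun i => ?_)).inter (.iInter fun i => .union ?_ ?_)
  · exact measurableSet_lt measurable_const (hm i)
  · exact measurableSet_le (hm i) (hm (i + 1))
  · exact measurableSet_lt measurable_const (hm i)
  · exact measurableSet_le (hm i) measurable_const
  · exact measurableSet_eq_fun (hm i) measurable_const

lemma lintegral_gridPt {I : Measure ℝ} {τ : ℝ} (hτ : 0 < τ) {K : ℕ} (hK : 0 < K)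
    (hI : I (Ioc 0 τ)ᶜ = 0) (f : ℝ → ENNReal) :
    ∫⁻ t, f t ∂I = ∑ l : Fin K, ∫⁻ t in Ioc (gridPt τ K l) (gridPt τ K (l + 1)), f t ∂I := by
  have hgen : ∀ m, ∫⁻ t in Ioc 0 (gridPt τ K m), f t ∂I =
      ∑ l ∈ Finset.range m, ∫⁻ t in Ioc (gridPt τ K l) (gridPt τ K (l + 1)), f t ∂I := by
    intro m
    induction m with
    | zero => simp [gridPt_zero]
    | succ m ih =>
      rw [Finset.sum_range_succ, ← ih,
        ← Ioc_union_Ioc_eq_Ioc (gridPt_nonneg hτ m) (gridPt_mono hτ (Nat.le_succ m)),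
        lintegral_union measurableSet_Ioc]
      rw [disjoint_left]; intro x hx hx'; exact absurd hx'.1 (not_lt.mpr hx.2)
  rw [Fin.sum_univ_eq_sum_range (fun l => ∫⁻ t in Ioc (gridPt τ K l) (gridPt τ K (l + 1)), f t ∂I),
    ← hgen K, gridPt_self hK, Measure.restrict_eq_self_of_ae_mem]
  rwa [ae_iff]

section mecke

variable {Ω : Type*} [MeasurableSpace Ω] {P : Measure Ω} [IsProbabilityMeasure P]
  {I : Measure ℝ} [IsFiniteMeasure I] {τ : ℝ} {A : Ω → ℕ → ℝ}

/-- The Mecke formula for functions of the rounded arrival times; this is the corresponding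
identity for the independent Poisson increments over a grid. -/
lemma IsPoissonArrivals.mecke_roundUp (hτ : 0 < τ) (hA : IsPoissonArrivals P I τ A)
    (hI : I (Ioc 0 τ)ᶜ = 0) {K : ℕ} (hK : 0 < K) (H : ℝ → (ℕ → ℝ) → ENNReal) :
    ∫⁻ ω, ∑' i, (if A ω i ≤ τ then H (roundUp τ K (A ω i)) (fun k => roundUp τ K (A ω k)) else 0)
        ∂P =
      ∫⁻ t, ∫⁻ ω, H (roundUp τ K t)
        (fun k => roundUp τ K (insAt (numArrivals (A ω) t) t (A ω) k)) ∂P ∂I := by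
  have hlaw : ∀ l : Fin K, HasLaw (fun ω => gridIncrement τ K (A ω) l)
      (poissonMeasure (I (Ioc (gridPt τ K l) (gridPt τ K (l + 1)))).toNNReal) P := fun l =>
    hA.hasLaw_increment _ _ (gridPt_nonneg hτ _) (gridPt_mono hτ (Nat.le_succ _))
      (gridPt_le hτ hK l.2)
  have hindep : iIndepFun (fun (l : Fin K) ω => gridIncrement τ K (A ω) l) P := by
    refine hA.indep_increments K (fun j => ⟨gridPt τ K j, gridPt_nonneg hτ _,
      gridPt_le hτ hK (Nat.lt_succ_iff.mp j.2)⟩) fun i j hij => ?_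
    exact gridPt_mono hτ hij
  have hLHS : ∀ ω, ∑' i, (if A ω i ≤ τ then
      H (roundUp τ K (A ω i)) (fun k => roundUp τ K (A ω k)) else 0) =
      ∑ l : Fin K, (gridIncrement τ K (A ω) l : ENNReal) *
        H (gridPt τ K (l + 1)) (seqOfIncrements τ K (gridIncrement τ K (A ω))) := by
    intro ω
    rw [← (hA.isArrivalSeq ω).roundUp_eq_seqOfIncrements hτ hK]
    exact (hA.isArrivalSeq ω).tsum_roundUp hτ hK fun t => H t fun k => roundUp τ K (A ω k)
  have hmeas : ∀ l : Fin K, Measurable fun ω => gridIncrement τ K (A ω) l := fun l =>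
    (measurable_numArrivals hA.measurable measurable_const).sub
      (measurable_numArrivals hA.measurable measurable_const)
  have hmeasv : Measurable fun ω => gridIncrement τ K (A ω) := measurable_pi_lambda _ hmeas
  simp_rw [hLHS]
  rw [lintegral_finsetSum _ fun l _ => ?_, lintegral_gridPt hτ hK hI]
  · refine Finset.sum_congr rfl fun l _ => ?_
    rw [lintegral_mul_poisson_vector hlaw hindep
      (fun D => H (gridPt τ K (l + 1)) (seqOfIncrements τ K D)) l,
      ENNReal.coe_toNNReal (measure_ne_top I _), mul_comm, ← setLIntegral_const]
    refine setLIntegral_congr_fun measurableSet_Ioc fun t ht => ?_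
    refine lintegral_congr fun ω => ?_
    rw [roundUp_of_mem hτ hK l.2 ht]
    have hω := (hA.isArrivalSeq ω).insAt
      ((gridPt_nonneg hτ _).trans_lt ht.1) (ht.2.trans (gridPt_le hτ hK l.2))
    rw [hω.roundUp_eq_seqOfIncrements hτ hK, (hA.isArrivalSeq ω).gridIncrement_insAt hτ hK ht]
  · have h1 : Measurable fun D : Fin K → ℕ => (D l : ENNReal) *
        H (gridPt τ K (l + 1)) (seqOfIncrements τ K D) := measurable_of_countable _
    exact h1.comp hmeasv

/-- The Mecke formula for the arrival times: removing a point of a Poisson process, chosen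
according to the intensity, leaves a Poisson process. -/
lemma IsPoissonArrivals.mecke (hτ : 0 < τ) (hA : IsPoissonArrivals P I τ A)
    (hI : I (Ioc 0 τ)ᶜ = 0) {H : ℝ → (ℕ → ℝ) → ENNReal}
    (hH : Measurable (Function.uncurry H)) :
    ∫⁻ ω, ∑' i, (if A ω i ≤ τ then H (A ω i) (A ω) else 0) ∂P =
      ∫⁻ t, ∫⁻ ω, H t (insAt (numArrivals (A ω) t) t (A ω)) ∂P ∂I := by
  have hAi : ∀ i, Measurable fun ω => A ω i := fun i => (measurable_pi_apply i).comp hA.measurable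
  have hset : ∀ i, MeasurableSet {ω | A ω i ≤ τ} := fun i =>
    measurableSet_le (hAi i) measurable_const
  have hf1 : ∀ i, Measurable fun ω => (A ω i, A ω) := fun i => (hAi i).prodMk hA.measurable
  have hf2 : Measurable fun x : ℝ × Ω =>
      (x.1, insAt (numArrivals (A x.2) x.1) x.1 (A x.2)) :=
    measurable_fst.prodMk ((measurable_numArrivals (hA.measurable.comp measurable_snd)
      measurable_fst).insAt measurable_fst (hA.measurable.comp measurable_snd))
  -- both sides are integrals of `H` against finite measures, which agree on functions of the
  -- rounded data and hence, as the grid is refined, on bounded continuous functions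
  set μ₁ : Measure (ℝ × (ℕ → ℝ)) :=
    Measure.sum fun i => (P.restrict {ω | A ω i ≤ τ}).map fun ω => (A ω i, A ω) with hμ₁
  set μ₂ : Measure (ℝ × (ℕ → ℝ)) := (I.prod P).map fun x : ℝ × Ω =>
    (x.1, insAt (numArrivals (A x.2) x.1) x.1 (A x.2)) with hμ₂
  have h1 : ∀ F : ℝ × (ℕ → ℝ) → ENNReal, Measurable F →
      ∫⁻ x, F x ∂μ₁ = ∫⁻ ω, ∑' i, (if A ω i ≤ τ then F (A ω i, A ω) else 0) ∂P := by
    intro F hF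
    rw [hμ₁, lintegral_sum_measure, lintegral_tsum fun i => (Measurable.ite
      (f := fun ω => F (A ω i, A ω)) (hset i) (hF.comp (hf1 i)) measurable_const).aemeasurable]
    refine tsum_congr fun i => ?_
    rw [lintegral_map hF (hf1 i), ← lintegral_indicator (hset i)]
    rfl
  have h2 : ∀ F : ℝ × (ℕ → ℝ) → ENNReal, Measurable F →
      ∫⁻ x, F x ∂μ₂ = ∫⁻ t, ∫⁻ ω, F (t, insAt (numArrivals (A ω) t) t (A ω)) ∂P ∂I := by
    intro F hF
    rw [hμ₂, lintegral_map hF hf2]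
    exact lintegral_prod _ (hF.comp hf2).aemeasurable
  have : IsFiniteMeasure μ₂ := by rw [hμ₂]; infer_instance
  have hround : ∀ K : ℕ, Measurable fun x : ℝ × (ℕ → ℝ) =>
      (roundUp τ (K + 1) x.1, fun k => roundUp τ (K + 1) (x.2 k)) := fun K =>
    (measurable_roundUp.comp measurable_fst).prodMk (measurable_pi_lambda _ fun k =>
      measurable_roundUp.comp ((measurable_pi_apply k).comp measurable_snd))
  have hK : ∀ K : ℕ, ∀ F : ℝ × (ℕ → ℝ) → ENNReal, Measurable F →
      ∫⁻ x, F (roundUp τ (K + 1) x.1, fun k => roundUp τ (K + 1) (x.2 k)) ∂μ₁ =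
      ∫⁻ x, F (roundUp τ (K + 1) x.1, fun k => roundUp τ (K + 1) (x.2 k)) ∂μ₂ := by
    intro K F hF
    refine (h1 _ (hF.comp (hround K))).trans (Eq.trans ?_ (h2 _ (hF.comp (hround K))).symm)
    exact hA.mecke_roundUp hτ hI (Nat.succ_pos K) fun t a => F (t, a)
  have : IsFiniteMeasure μ₁ := by
    have := hK 0 (fun _ => 1) measurable_const
    simp only [lintegral_const, one_mul] at this
    exact ⟨this ▸ measure_lt_top μ₂ univ⟩
  have hae : ∀ {μ : Measure (ℝ × (ℕ → ℝ))}, (∀ᵐ x ∂μ, (0 < x.1 ∧ x.1 ≤ τ) ∧ IsArrivalSeq τ x.2) →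
      ∀ᵐ x ∂μ, Filter.Tendsto (fun K : ℕ =>
        (roundUp τ (K + 1) x.1, fun k => roundUp τ (K + 1) (x.2 k))) Filter.atTop (nhds x) := by
    intro μ hμ
    filter_upwards [hμ] with x hx
    exact (tendsto_roundUp hτ (Or.inl hx.1)).prodMk_nhds (hx.2.tendsto_roundUp hτ)
  have hmeasSeq : MeasurableSet {x : ℝ × (ℕ → ℝ) | (0 < x.1 ∧ x.1 ≤ τ) ∧ IsArrivalSeq τ x.2} :=
    ((measurableSet_lt measurable_const measurable_fst).inter
      (measurableSet_le measurable_fst measurable_const)).inter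
      (measurable_snd measurableSet_isArrivalSeq)
  have hae1 : ∀ᵐ x ∂μ₁, (0 < x.1 ∧ x.1 ≤ τ) ∧ IsArrivalSeq τ x.2 := by
    rw [hμ₁, Measure.ae_sum_iff' hmeasSeq]
    intro i
    rw [ae_map_iff (hf1 i).aemeasurable hmeasSeq, ae_restrict_iff' (hset i)]
    exact Filter.Eventually.of_forall fun ω hω =>
      ⟨⟨(hA.isArrivalSeq ω).pos i, hω⟩, hA.isArrivalSeq ω⟩
  have hae2 : ∀ᵐ x ∂μ₂, (0 < x.1 ∧ x.1 ≤ τ) ∧ IsArrivalSeq τ x.2 := by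
    rw [hμ₂, ae_map_iff hf2.aemeasurable hmeasSeq]
    have hI' : ∀ᵐ t ∂I, t ∈ Ioc 0 τ := by rwa [ae_iff]
    have : ∀ᵐ x ∂(I.prod P), x.1 ∈ Ioc 0 τ := Measure.quasiMeasurePreserving_fst.ae hI'
    filter_upwards [this] with x hx
    exact ⟨hx, (hA.isArrivalSeq x.2).insAt hx.1 hx.2⟩
  have heq : μ₁ = μ₂ := by
    refine ext_of_forall_lintegral_eq_of_IsFiniteMeasure fun f => ?_
    have hlim : ∀ {μ : Measure (ℝ × (ℕ → ℝ))} [IsFiniteMeasure μ],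
        (∀ᵐ x ∂μ, (0 < x.1 ∧ x.1 ≤ τ) ∧ IsArrivalSeq τ x.2) →
        Filter.Tendsto (fun K : ℕ => ∫⁻ x, (f (roundUp τ (K + 1) x.1,
          fun k => roundUp τ (K + 1) (x.2 k)) : ENNReal) ∂μ) Filter.atTop
          (nhds (∫⁻ x, f x ∂μ)) := by
      intro μ _ hμ
      refine tendsto_lintegral_of_dominated_convergence (fun _ => (nndist f 0 : ENNReal))
        (fun K => ((f.continuous.measurable.comp (hround K)).coe_nnreal_ennreal))
        (fun K => Filter.Eventually.of_forall fun x => ?_) ?_ ?_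
      · exact ENNReal.coe_le_coe.mpr (BoundedContinuousFunction.NNReal.upper_bound f _)
      · rw [lintegral_const]; exact ENNReal.mul_ne_top ENNReal.coe_ne_top (measure_ne_top _ _)
      · filter_upwards [hae hμ] with x hx
        exact (ENNReal.continuous_coe.tendsto _).comp ((f.continuous.tendsto x).comp hx)
    have hs : ∀ K : ℕ, _ := fun K => hK K (fun x => (f x : ENNReal))
      f.continuous.measurable.coe_nnreal_ennreal
    refine tendsto_nhds_unique (hlim hae1) ?_
    simp_rw [hs]
    exact hlim hae2
  exact (h1 _ hH).symm.trans (heq ▸ h2 _ hH)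

end mecke

/-! ### The Mecke formula for the marked process -/

section markedMecke

variable {Ω E : Type*} [MeasurableSpace Ω] [MeasurableSpace E] {P : Measure Ω}
  {I : Measure ℝ} {τ : ℝ} {A : Ω → ℕ → ℝ} {ν : Measure E} [IsProbabilityMeasure ν]
  {W : Ω → ℕ → E}

/-- The arrival times `A` form a Poisson process with intensity `I`, and the marks `W` are i.i.d.
with law `ν` and independent of them. -/
structure IsMarkedPoisson (P : Measure Ω) (I : Measure ℝ) (τ : ℝ) (ν : Measure E)
    [IsProbabilityMeasure ν] (A : Ω → ℕ → ℝ) (W : Ω → ℕ → E) : Prop where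
  arrivals : IsPoissonArrivals P I τ A
  measurable_marks : Measurable W
  hasLaw_marks : HasLaw W (Measure.infinitePi fun _ : ℕ => ν) P
  indepFun : IndepFun A W P

lemma IsMarkedPoisson.lintegral_eq [IsFiniteMeasure P] (h : IsMarkedPoisson P I τ ν A W)
    {Φ : (ℕ → ℝ) → (ℕ → E) → ENNReal} (hΦ : Measurable (Function.uncurry Φ)) :
    ∫⁻ ω, Φ (A ω) (W ω) ∂P = ∫⁻ ω, ∫⁻ w, Φ (A ω) w ∂(Measure.infinitePi fun _ : ℕ => ν) ∂P := by
  have hAm := h.arrivals.measurable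
  have hprod := (indepFun_iff_map_prod_eq_prod_map_map hAm.aemeasurable
    h.measurable_marks.aemeasurable).mp h.indepFun
  rw [h.hasLaw_marks.map_eq] at hprod
  calc ∫⁻ ω, Φ (A ω) (W ω) ∂P
      = ∫⁻ x, Function.uncurry Φ x ∂(P.map fun ω => (A ω, W ω)) :=
        (lintegral_map hΦ (hAm.prodMk h.measurable_marks)).symm
    _ = ∫⁻ a, ∫⁻ w, Φ a w ∂(Measure.infinitePi fun _ : ℕ => ν) ∂(P.map A) := by
        rw [hprod]; exact lintegral_prod _ hΦ.aemeasurable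
    _ = _ := lintegral_map hΦ.lintegral_prod_right hAm

variable [IsProbabilityMeasure P] [IsFiniteMeasure I] [NullSingletonClass I]

/-- The arrival times in `[0, τ]` are almost surely distinct. -/
lemma IsPoissonArrivals.ae_simple (hτ : 0 < τ) (hA : IsPoissonArrivals P I τ A)
    (hI : I (Ioc 0 τ)ᶜ = 0) : ∀ᵐ ω ∂P, ∀ i j, i ≠ j → A ω i ≤ τ → A ω j ≠ A ω i := by
  classical
  have hm : ∀ i, Measurable fun a : ℕ → ℝ => a i := measurable_pi_apply
  have hAi : ∀ i, Measurable fun ω => A ω i := fun i => (hm i).comp hA.measurable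
  set tie : Set (ℝ × (ℕ → ℝ)) := {x | ∃ i j, i ≠ j ∧ x.2 i = x.1 ∧ x.2 j = x.1} with htie
  have htiem : MeasurableSet tie := by
    have : tie = ⋃ i, ⋃ j, ⋃ _ : i ≠ j, {x | x.2 i = x.1} ∩ {x | x.2 j = x.1} := by
      ext x; simp only [htie, mem_iUnion, exists_prop]; rfl
    rw [this]
    exact .iUnion fun i => .iUnion fun j => .iUnion fun _ =>
      (measurableSet_eq_fun ((hm i).comp measurable_snd) measurable_fst).inter
      (measurableSet_eq_fun ((hm j).comp measurable_snd) measurable_fst)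
  have key := hA.mecke hτ hI (H := fun t a => tie.indicator (fun _ => 1) (t, a))
    (measurable_const.indicator htiem)
  have hzero : ∫⁻ t, ∫⁻ ω, tie.indicator (fun _ => (1 : ENNReal))
      (t, insAt (numArrivals (A ω) t) t (A ω)) ∂P ∂I = 0 := by
    -- an added point produces a tie only if it falls on one of the other points
    have hle : ∀ t ω, tie.indicator (fun _ => (1 : ENNReal))
        (t, insAt (numArrivals (A ω) t) t (A ω)) ≤
        ∑' i, ({t} : Set ℝ).indicator (fun _ => 1) (A ω i) := by
      intro t ω
      by_cases h : (t, insAt (numArrivals (A ω) t) t (A ω)) ∈ tie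
      · rw [indicator_of_mem h]
        have hex : ∃ k, A ω k = t := by
          obtain ⟨i, j, hij, h1, h2⟩ := h
          have : ∃ l, l ≠ numArrivals (A ω) t ∧
              insAt (numArrivals (A ω) t) t (A ω) l = t := by
            by_cases hi : i = numArrivals (A ω) t
            · exact ⟨j, fun hj => hij (hi.trans hj.symm), h2⟩
            · exact ⟨i, hi, h1⟩
          obtain ⟨l, hl, h3⟩ := this
          obtain ⟨k, rfl⟩ : l ∈ range (skipAt (numArrivals (A ω) t)) := by
            rw [range_skipAt]; exact hl
          exact ⟨k, by rwa [insAt_skipAt] at h3⟩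
        obtain ⟨k, hk⟩ := hex
        refine le_trans ?_ (ENNReal.le_tsum k)
        simp [hk]
      · simp [h]
    rw [← nonpos_iff_eq_zero]
    refine (lintegral_mono fun t => lintegral_mono fun ω => hle t ω).trans ?_
    have hjoint : Measurable fun x : ℝ × Ω =>
        ∑' i, ({x.1} : Set ℝ).indicator (fun _ => (1 : ENNReal)) (A x.2 i) := by
      refine Measurable.tsum fun i => ?_
      exact Measurable.ite (measurableSet_eq_fun ((hAi i).comp measurable_snd) measurable_fst)
        measurable_const measurable_const
    rw [lintegral_lintegral_swap hjoint.aemeasurable]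
    have hω : ∀ ω, ∫⁻ t, ∑' i, ({t} : Set ℝ).indicator (fun _ => (1 : ENNReal)) (A ω i) ∂I = 0 := by
      intro ω
      have : ∀ t i, ({t} : Set ℝ).indicator (fun _ => (1 : ENNReal)) (A ω i) =
          ({A ω i} : Set ℝ).indicator (fun _ => 1) t := by
        intro t i
        simp only [indicator, mem_singleton_iff, eq_comm]
      simp_rw [this]
      rw [lintegral_tsum fun i =>
        (measurable_const.indicator (measurableSet_singleton _)).aemeasurable]
      simp only [ENNReal.tsum_eq_zero]
      intro i
      rw [lintegral_indicator_const (measurableSet_singleton _), measure_singleton, mul_zero]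
    simp only [hω, lintegral_zero, le_refl]
  rw [hzero, lintegral_eq_zero_iff] at key
  · filter_upwards [key] with ω hω i j hij hi hji
    have := (ENNReal.tsum_eq_zero.mp hω) i
    rw [if_pos hi] at this
    have hmem : (A ω i, A ω) ∈ tie := ⟨i, j, hij, rfl, hji⟩
    simp [hmem] at this
  · refine Measurable.tsum fun i => Measurable.ite (measurableSet_le (hAi i) measurable_const)
      ?_ measurable_const
    exact (measurable_const.indicator htiem).comp ((hAi i).prodMk hA.measurable)

/-- The Mecke formula for functions of the arrival times and of the index of the chosen point. -/
lemma IsPoissonArrivals.mecke_index (hτ : 0 < τ) (hA : IsPoissonArrivals P I τ A)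
    (hI : I (Ioc 0 τ)ᶜ = 0) {g : ℕ → (ℕ → ℝ) → ENNReal} (hg : ∀ i, Measurable (g i)) :
    ∫⁻ ω, ∑' i, (if A ω i ≤ τ then g i (A ω) else 0) ∂P =
      ∫⁻ t, ∫⁻ ω, g (numArrivals (A ω) t) (insAt (numArrivals (A ω) t) t (A ω)) ∂P ∂I := by
  -- as the arrival times are distinct, a point's index can be recovered from its time
  have hH : Measurable (Function.uncurry fun (t : ℝ) (a : ℕ → ℝ) => g (numArrivals a t - 1) a) := by
    have h1 : Measurable fun x : ℕ × (ℕ → ℝ) => g x.1 x.2 :=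
      measurable_from_prod_countable_right hg
    have h2 : Measurable fun x : ℝ × (ℕ → ℝ) => (numArrivals x.2 x.1 - 1, x.2) :=
      ((measurable_numArrivals measurable_snd measurable_fst).sub measurable_const).prodMk
        measurable_snd
    exact h1.comp h2
  have key := hA.mecke hτ hI hH
  have hI' : ∀ᵐ t ∂I, t ∈ Ioc 0 τ := by rwa [ae_iff]
  calc _ = ∫⁻ ω, ∑' i, (if A ω i ≤ τ then g (numArrivals (A ω) (A ω i) - 1) (A ω) else 0) ∂P := by
        refine lintegral_congr_ae ?_
        filter_upwards [hA.ae_simple hτ hI] with ω hω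
        refine tsum_congr fun i => ?_
        split_ifs with hi
        · have hs := hA.isArrivalSeq ω
          have h1 : i < numArrivals (A ω) (A ω i) := (hs.le_iff hi i).mp le_rfl
          have h2 : ¬ i + 1 < numArrivals (A ω) (A ω i) := by
            rw [← hs.le_iff hi, not_le]
            exact lt_of_le_of_ne (hs.mono (Nat.le_succ i)) (hω i (i + 1) (by omega) hi).symm
          rw [show numArrivals (A ω) (A ω i) - 1 = i by omega]
        · rfl
    _ = _ := key
    _ = _ := by
        refine lintegral_congr_ae ?_
        filter_upwards [hI'] with t ht
        refine lintegral_congr fun ω => ?_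
        rw [(hA.isArrivalSeq ω).numArrivals_insAt ht.2]
        simp

/-- An i.i.d. sequence remains so when an independent entry with the same law is inserted. -/
lemma map_insAt_infinitePi (ν : Measure E) [IsProbabilityMeasure ν] (p : ℕ) :
    (ν.prod (Measure.infinitePi fun _ : ℕ => ν)).map (fun x => insAt p x.1 x.2) =
      Measure.infinitePi fun _ : ℕ => ν := by
  classical
  have hmeas : Measurable fun x : E × (ℕ → E) => insAt p x.1 x.2 :=
    (measurable_const (a := p)).insAt measurable_fst measurable_snd
  refine Measure.eq_infinitePi _ fun s t ht => ?_
  rw [Measure.map_apply hmeas (.pi s.countable_toSet fun i _ => ht i)]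
  set t' : ℕ → Set E := fun i => if i ∈ s then t i else univ with ht'
  have ht'm : ∀ i, MeasurableSet (t' i) := fun i => by
    rw [ht']; dsimp only; split_ifs
    · exact ht i
    · exact .univ
  obtain ⟨N, hN⟩ : ∃ N, s ⊆ Finset.range (N + 1) ∧ p < N + 1 :=
    ⟨s.sup id + p, fun i hi => by
      have := Finset.le_sup (f := id) hi
      simp only [id] at this
      rw [Finset.mem_range]; omega, by omega⟩
  have hprod : ∏ i ∈ s, ν (t i) = ∏ i ∈ Finset.range (N + 1), ν (t' i) := by
    rw [← Finset.prod_subset hN.1]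
    · exact Finset.prod_congr rfl fun i hi => by simp [ht', hi]
    · intro i _ hi; simp [ht', hi]
  have hpre : (fun x : E × (ℕ → E) => insAt p x.1 x.2) ⁻¹' (s : Set ℕ).pi t =
      t' p ×ˢ ((Finset.range N : Finset ℕ) : Set ℕ).pi fun j => t' (skipAt p j) := by
    ext ⟨z, w⟩
    have h1 : insAt p z w ∈ (s : Set ℕ).pi t ↔ ∀ i, insAt p z w i ∈ t' i := by
      refine ⟨fun h i => ?_, fun h i hi => ?_⟩
      · by_cases hi : i ∈ s
        · simpa [ht', hi] using h i hi
        · simp [ht', hi]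
      · have := h i
        simpa [ht', show i ∈ s from hi] using this
    rw [mem_preimage, h1, mem_prod]
    constructor
    · intro h
      refine ⟨by simpa [insAt_self] using h p, fun j _ => ?_⟩
      simpa [insAt_skipAt] using h (skipAt p j)
    · rintro ⟨h2, h3⟩ i
      by_cases hi : i = p
      · subst hi; rwa [insAt_self]
      · obtain ⟨j, rfl⟩ : i ∈ range (skipAt p) := by rw [range_skipAt]; exact hi
        rw [insAt_skipAt]
        by_cases hj : j < N
        · exact h3 j (by simpa using hj)
        · have : skipAt p j ∉ s := fun hs => by
            have := Finset.mem_range.mp (hN.1 hs)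
            unfold skipAt at this; split_ifs at this <;> omega
          simp [ht', this]
  rw [hpre, Measure.prod_prod, Measure.infinitePi_pi _ fun j _ => ht'm _, hprod]
  have himg : Finset.range (N + 1) = insert p ((Finset.range N).image (skipAt p)) := by
    ext i
    simp only [Finset.mem_range, Finset.mem_insert, Finset.mem_image]
    constructor
    · intro hi
      by_cases hip : i = p
      · exact Or.inl hip
      · obtain ⟨j, rfl⟩ : i ∈ range (skipAt p) := by rw [range_skipAt]; exact hip
        refine Or.inr ⟨j, ?_, rfl⟩
        unfold skipAt at hi; split_ifs at hi <;> omega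
    · rintro (rfl | ⟨j, hj, rfl⟩)
      · exact hN.2
      · unfold skipAt; split_ifs <;> omega
  rw [himg, Finset.prod_insert, Finset.prod_image fun _ _ _ _ h => skipAt_injective p h]
  simp only [Finset.mem_image, not_exists, not_and]
  exact fun j _ => skipAt_ne p j

/-- The Mecke formula for the marked Poisson process: the expected sum over the points of a
functional of the point and of the whole configuration is obtained by adding to the configuration
one point with distribution `I`, carrying a mark with law `ν`. -/
theorem IsMarkedPoisson.mecke (hτ : 0 < τ) (h : IsMarkedPoisson P I τ ν A W)
    (hI : I (Ioc 0 τ)ᶜ = 0) {g : ℕ → (ℕ → ℝ) → (ℕ → E) → ENNReal}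
    (hg : ∀ i, Measurable (Function.uncurry (g i))) :
    ∫⁻ ω, ∑' i, (if A ω i ≤ τ then g i (A ω) (W ω) else 0) ∂P =
      ∫⁻ t, ∫⁻ z, ∫⁻ ω, g (numArrivals (A ω) t) (insAt (numArrivals (A ω) t) t (A ω))
        (insAt (numArrivals (A ω) t) z (W ω)) ∂P ∂ν ∂I := by
  set Q := Measure.infinitePi fun _ : ℕ => ν with hQ
  have hm : ∀ i, Measurable fun a : ℕ → ℝ => a i := measurable_pi_apply
  have hΦ : Measurable (Function.uncurry fun (a : ℕ → ℝ) (w : ℕ → E) =>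
      ∑' i, if a i ≤ τ then g i a w else 0) := by
    refine Measurable.tsum fun i => Measurable.ite
      (measurableSet_le ((hm i).comp measurable_fst) measurable_const) (hg i) measurable_const
  have hgQ : ∀ i, Measurable fun a => ∫⁻ w, g i a w ∂Q := fun i => (hg i).lintegral_prod_right
  rw [h.lintegral_eq hΦ]
  have h1 : ∀ ω, ∫⁻ w, ∑' i, (if A ω i ≤ τ then g i (A ω) w else 0) ∂Q =
      ∑' i, if A ω i ≤ τ then ∫⁻ w, g i (A ω) w ∂Q else 0 := by
    intro ω
    rw [lintegral_tsum fun i => ?_]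
    · refine tsum_congr fun i => ?_
      split_ifs <;> simp
    · split_ifs
      · exact ((hg i).comp measurable_prodMk_left).aemeasurable
      · exact aemeasurable_const
  simp_rw [← hQ, h1]
  rw [h.arrivals.mecke_index hτ hI hgQ]
  refine lintegral_congr fun t => ?_
  have hpair : Measurable fun x : ℕ × (ℕ → ℝ) × (ℕ → E) => g x.1 x.2.1 x.2.2 :=
    measurable_from_prod_countable_right hg
  have hN : Measurable fun a : ℕ → ℝ => numArrivals a t :=
    measurable_numArrivals measurable_id measurable_const
  have hN' : Measurable fun x : E × (ℕ → ℝ) × (ℕ → E) => numArrivals x.2.1 t :=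
    hN.comp (measurable_fst.comp measurable_snd)
  have hΨ : Measurable fun x : E × (ℕ → ℝ) × (ℕ → E) => g (numArrivals x.2.1 t)
      (insAt (numArrivals x.2.1 t) t x.2.1) (insAt (numArrivals x.2.1 t) x.1 x.2.2) :=
    hpair.comp (hN'.prodMk ((hN'.insAt measurable_const
      (measurable_fst.comp measurable_snd)).prodMk
        (hN'.insAt measurable_fst (measurable_snd.comp measurable_snd))))
  have h2 : ∀ z, ∫⁻ ω, g (numArrivals (A ω) t) (insAt (numArrivals (A ω) t) t (A ω))
        (insAt (numArrivals (A ω) t) z (W ω)) ∂P =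
      ∫⁻ ω, ∫⁻ w, g (numArrivals (A ω) t) (insAt (numArrivals (A ω) t) t (A ω))
        (insAt (numArrivals (A ω) t) z w) ∂Q ∂P := fun z =>
    h.lintegral_eq (Φ := fun a w => g (numArrivals a t) (insAt (numArrivals a t) t a)
      (insAt (numArrivals a t) z w)) (hΨ.comp measurable_prodMk_left)
  simp_rw [h2]
  refine Eq.trans ?_ (lintegral_lintegral_swap (μ := P) (ν := ν)
    (f := fun ω z => ∫⁻ w, g (numArrivals (A ω) t) (insAt (numArrivals (A ω) t) t (A ω))
      (insAt (numArrivals (A ω) t) z w) ∂Q) ?_)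
  · refine lintegral_congr fun ω => ?_
    set p := numArrivals (A ω) t with hp
    have hmeas : Measurable fun x : E × (ℕ → E) => insAt p x.1 x.2 :=
      (measurable_const (a := p)).insAt measurable_fst measurable_snd
    have hgp : Measurable (g p (insAt p t (A ω))) := (hg p).comp measurable_prodMk_left
    conv_lhs => rw [hQ, ← map_insAt_infinitePi ν p]
    rw [lintegral_map hgp hmeas]
    exact lintegral_prod _ (hgp.comp hmeas).aemeasurable
  · have h3 : Measurable fun y : (Ω × E) × (ℕ → E) => ((y.1.2, A y.1.1, y.2) :
        E × (ℕ → ℝ) × (ℕ → E)) :=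
      (measurable_snd.comp measurable_fst).prodMk
        ((h.arrivals.measurable.comp (measurable_fst.comp measurable_fst)).prodMk measurable_snd)
    exact ((hΨ.comp h3).lintegral_prod_right').aemeasurable

end markedMecke

/-! ### Measurability of the selection rule -/

section measurability

variable {𝓧 : Type*} [MeasurableSpace 𝓧] {n : ℕ} {α : ℕ → ℝ → ℝ} {τ : ℝ} {a s : 𝓧 → ℕ → ℝ}

lemma measurableSet_selected_of_budget (hα : ∀ b, Measurable (α b)) (ha : Measurable a)
    (hs : Measurable s) {i : ℕ} (hb : Measurable fun x => budget n α τ (a x) (s x) i) :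
    MeasurableSet {x | Selected n α τ (a x) (s x) i} := by
  have hai : Measurable fun x => a x i := (measurable_pi_apply i).comp ha
  have h1 : Measurable fun x : ℕ × ℝ => α x.1 x.2 := measurable_from_prod_countable_right hα
  exact (measurableSet_le hai measurable_const).inter
    ((measurableSet_lt measurable_const hb).inter
      (measurableSet_lt (h1.comp (hb.prodMk hai)) ((measurable_pi_apply i).comp hs)))

lemma measurable_budget (hα : ∀ b, Measurable (α b)) (ha : Measurable a) (hs : Measurable s)
    (i : ℕ) : Measurable fun x => budget n α τ (a x) (s x) i := by
  induction i with
  | zero => exact measurable_const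
  | succ i ih =>
    simp only [budget]
    exact Measurable.ite (measurableSet_selected_of_budget hα ha hs ih)
      (ih.sub measurable_const) ih

lemma measurableSet_selected (hα : ∀ b, Measurable (α b)) (ha : Measurable a) (hs : Measurable s)
    (i : ℕ) : MeasurableSet {x | Selected n α τ (a x) (s x) i} :=
  measurableSet_selected_of_budget hα ha hs (measurable_budget hα ha hs i)

lemma measurable_selCount (hα : ∀ b, Measurable (α b)) (ha : Measurable a) (hs : Measurable s)
    (i : ℕ) : Measurable fun x => selCount n α τ (a x) (s x) i := by
  have : (fun x => selCount n α τ (a x) (s x) i) =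
      fun x => n - budget n α τ (a x) (s x) i := by
    ext x
    have := budget_add_selCount (n := n) (α := α) (τ := τ) (a := a x) (s := s x) i
    omega
  rw [this]
  exact measurable_const.sub (measurable_budget hα ha hs i)

lemma measurable_numInspections (hα : ∀ b, Measurable (α b)) (ha : Measurable a)
    (hs : Measurable s) : Measurable fun x => numInspections n α τ (a x) (s x) :=
  measurable_ncard fun i => measurableSet_selected hα ha hs i

/-- The last alternative is the value `0` that `Nat.nth` takes when there are at most `j`
selections. -/
lemma nth_selected_eq_iff {a s : ℕ → ℝ} (j m : ℕ) :
    Nat.nth (Selected n α τ a s) j = m ↔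
      (Selected n α τ a s m ∧ selCount n α τ a s m = j) ∨
      (m = 0 ∧ ∀ i, ¬ (Selected n α τ a s i ∧ selCount n α τ a s i = j)) := by
  classical
  by_cases hex : ∃ i, Selected n α τ a s i ∧ selCount n α τ a s i = j
  · obtain ⟨i, hi, rfl⟩ := hex
    rw [nth_selected hi]
    constructor
    · rintro rfl; exact Or.inl ⟨hi, rfl⟩
    · rintro (⟨hm, h⟩ | ⟨-, h⟩)
      · exact selected_unique hi hm h.symm
      · exact absurd ⟨hi, rfl⟩ (h i)
  · push Not at hex
    have h0 : Nat.nth (Selected n α τ a s) j = 0 := by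
      by_contra hne
      refine hex _ (Nat.nth_mem_of_ne_zero hne) ?_
      exact Nat.count_nth fun hf => Nat.lt_card_toFinset_of_nth_ne_zero hne hf
    rw [h0]
    constructor
    · rintro rfl; exact Or.inr ⟨rfl, fun i hi => hex i hi.1 hi.2⟩
    · rintro (⟨hm, h⟩ | ⟨h, -⟩)
      · exact absurd h (hex m hm)
      · exact h.symm

lemma measurable_inspectionTime (hα : ∀ b, Measurable (α b)) (ha : Measurable a)
    (hs : Measurable s) (j : ℕ) : Measurable fun x => inspectionTime n α τ (a x) (s x) j := by
  rcases j with _ | j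
  · exact measurable_const
  · refine Measurable.comp_index ha (measurable_to_countable' fun m => ?_)
    have hQ : ∀ m, MeasurableSet {x | Selected n α τ (a x) (s x) m ∧
        selCount n α τ (a x) (s x) m = j} := fun m =>
      (measurableSet_selected hα ha hs m).inter
        (measurable_selCount hα ha hs m (measurableSet_singleton j))
    have : (fun x => Nat.nth (Selected n α τ (a x) (s x)) j) ⁻¹' {m} =
        {x | Selected n α τ (a x) (s x) m ∧ selCount n α τ (a x) (s x) m = j} ∪
        ({_x | m = 0} ∩ ⋂ i, {x | Selected n α τ (a x) (s x) i ∧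
          selCount n α τ (a x) (s x) i = j}ᶜ) := by
      ext x
      simp only [mem_preimage, mem_singleton_iff, nth_selected_eq_iff, mem_union, mem_inter_iff,
        mem_iInter, mem_compl_iff, mem_ofPred_eq]
    rw [this]
    exact (hQ m).union ((MeasurableSet.const _).inter (.iInter fun i => (hQ i).compl))

lemma measurable_waitingTime (hα : ∀ b, Measurable (α b)) (ha : Measurable a)
    (hs : Measurable s) (j : ℕ) : Measurable fun x => waitingTime n α τ (a x) (s x) j :=
  (measurable_inspectionTime hα ha hs j).sub (measurable_inspectionTime hα ha hs (j - 1))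

end measurability

/-! ### The compensator of the inspection process -/

section compensator

variable {Ω E : Type*} [MeasurableSpace Ω] [MeasurableSpace E] {P : Measure Ω}
  [IsProbabilityMeasure P] {I : Measure ℝ} [IsFiniteMeasure I] [NullSingletonClass I] {τ : ℝ}
  {A : Ω → ℕ → ℝ} {ν : Measure E} [IsProbabilityMeasure ν] {W : Ω → ℕ → E}
  {n : ℕ} {α : ℕ → ℝ → ℝ} {sc : E → ℝ}

open Classical in
/-- The `(k + 1)`-th inspection happens at time `t` and to a transaction with mark `z` with
intensity `1{α (n - k) t < sc z} I(dt) ν(dz)`, as long as exactly `k` inspections have been made.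
The functional `u` of the inspection may involve the time of the previous one, and `B` restricts
the previous waiting times. -/
theorem IsMarkedPoisson.lintegral_tsum_selected (hτ : 0 < τ) (h : IsMarkedPoisson P I τ ν A W)
    (hI : I (Ioc 0 τ)ᶜ = 0) (hα : ∀ b, Measurable (α b)) (hsc : Measurable sc) {k : ℕ}
    (hk : k < n) {B : Set (Fin k → ℝ)} (hB : MeasurableSet B) {u : ℝ → ℝ → E → ENNReal}
    (hu : Measurable fun x : ℝ × ℝ × E => u x.1 x.2.1 x.2.2) :
    ∫⁻ ω, ∑' i, (if Selected n α τ (A ω) (fun i => sc (W ω i)) i ∧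
        selCount n α τ (A ω) (fun i => sc (W ω i)) i = k ∧
        (fun l : Fin k => waitingTime n α τ (A ω) (fun i => sc (W ω i)) (l + 1)) ∈ B then
        u (inspectionTime n α τ (A ω) (fun i => sc (W ω i)) k) (A ω i) (W ω i) else 0) ∂P =
      ∫⁻ t, ∫⁻ z, ∫⁻ ω, (if selCount n α τ (A ω) (fun i => sc (W ω i)) (numArrivals (A ω) t) = k ∧
        (fun l : Fin k => waitingTime n α τ (A ω) (fun i => sc (W ω i)) (l + 1)) ∈ B ∧
        α (n - k) t < sc z then
        u (inspectionTime n α τ (A ω) (fun i => sc (W ω i)) k) t z else 0) ∂P ∂ν ∂I := by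
  set g : ℕ → (ℕ → ℝ) → (ℕ → E) → ENNReal := fun i a w =>
    if Selected n α τ a (fun i => sc (w i)) i ∧
        selCount n α τ a (fun i => sc (w i)) i = k ∧
        (fun l : Fin k => waitingTime n α τ a (fun i => sc (w i)) (l + 1)) ∈ B then
        u (inspectionTime n α τ a (fun i => sc (w i)) k) (a i) (w i) else 0 with hg
  have hs : Measurable fun x : (ℕ → ℝ) × (ℕ → E) => fun i => sc (x.2 i) :=
    measurable_pi_lambda _ fun i => hsc.comp ((measurable_pi_apply i).comp measurable_snd)
  have hgm : ∀ i, Measurable (Function.uncurry (g i)) := by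
    intro i
    refine Measurable.ite ?_ ?_ measurable_const
    · exact (measurableSet_selected hα measurable_fst hs i).inter
        ((measurable_selCount hα measurable_fst hs i (measurableSet_singleton k)).inter
          (measurable_pi_lambda _ (fun l => measurable_waitingTime hα measurable_fst hs _) hB))
    · exact hu.comp ((measurable_inspectionTime hα measurable_fst hs k).prodMk
        (((measurable_pi_apply i).comp measurable_fst).prodMk
          ((measurable_pi_apply i).comp measurable_snd)))
  have key := h.mecke hτ hI hgm
  have hL : ∀ ω i, (if A ω i ≤ τ then g i (A ω) (W ω) else 0) = g i (A ω) (W ω) := by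
    intro ω i
    by_cases hi : A ω i ≤ τ
    · rw [if_pos hi]
    · rw [if_neg hi, hg]
      exact (if_neg fun hc => hi hc.1.1).symm
  simp_rw [hL] at key
  refine key.trans ?_
  have hI' : ∀ᵐ t ∂I, t ∈ Ioc 0 τ := by rwa [ae_iff]
  refine lintegral_congr_ae ?_
  filter_upwards [hI'] with t ht
  refine lintegral_congr fun z => lintegral_congr fun ω => ?_
  set p := numArrivals (A ω) t
  have hcongr : ∀ l < p, insAt p t (A ω) l = A ω l ∧
      (fun i => sc (insAt p z (W ω) i)) l = (fun i => sc (W ω i)) l := fun l hl =>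
    ⟨insAt_of_lt hl, by simp [insAt_of_lt hl]⟩
  have hcount : selCount n α τ (insAt p t (A ω)) (fun i => sc (insAt p z (W ω) i)) p =
      selCount n α τ (A ω) (fun i => sc (W ω i)) p := selCount_congr hcongr
  have hbud := budget_add_selCount (n := n) (α := α) (τ := τ) (a := insAt p t (A ω))
    (s := fun i => sc (insAt p z (W ω) i)) p
  simp only [hg]
  by_cases hc : selCount n α τ (A ω) (fun i => sc (W ω i)) p = k
  · have hw : (fun l : Fin k => waitingTime n α τ (insAt p t (A ω))
        (fun i => sc (insAt p z (W ω) i)) (l + 1)) =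
        fun l : Fin k => waitingTime n α τ (A ω) (fun i => sc (W ω i)) (l + 1) := by
      ext l
      exact waitingTime_congr hcongr (by omega)
    have hsel : Selected n α τ (insAt p t (A ω)) (fun i => sc (insAt p z (W ω) i)) p ↔
        α (n - k) t < sc z := by
      have hb : budget n α τ (insAt p t (A ω)) (fun i => sc (insAt p z (W ω) i)) p = n - k := by
        omega
      rw [selected_iff, hb, insAt_self, insAt_self]
      exact ⟨fun hx => hx.2.2, fun hx => ⟨ht.2, by omega, hx⟩⟩
    have hins := inspectionTime_congr (n := n) (α := α) (τ := τ) (k := k) hcongr (by omega)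
    rw [hw, hcount, hsel, hins, insAt_self, insAt_self]
    refine if_congr ?_ rfl rfl
    tauto
  · rw [if_neg fun hx => hc (hcount ▸ hx.2.1), if_neg fun hx => hc hx.1]

end compensator

/-! ### From a compensator to a conditional density -/

section hazard

variable {m : ℝ → ℝ} {C : ℝ}

lemma intervalIntegrable_of_bounded (hm : Measurable m) (h0 : ∀ t, 0 ≤ m t) (hC : ∀ t, m t ≤ C)
    (a b : ℝ) : IntervalIntegrable m volume a b := by
  refine (intervalIntegrable_const (c := C)).mono_fun hm.aestronglyMeasurable ?_
  refine Filter.Eventually.of_forall fun t => ?_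
  simp only [Real.norm_eq_abs]
  rw [abs_of_nonneg (h0 t)]
  exact (hC t).trans (le_abs_self C)

lemma cumRate_sub (hm : Measurable m) (h0 : ∀ t, 0 ≤ m t) (hC : ∀ t, m t ≤ C) (a b : ℝ) :
    cumRate m b - cumRate m a = ∫ u in a..b, m u :=
  intervalIntegral.integral_interval_sub_left (intervalIntegrable_of_bounded hm h0 hC _ _)
    (intervalIntegrable_of_bounded hm h0 hC _ _)

lemma cumRate_mono (hm : Measurable m) (h0 : ∀ t, 0 ≤ m t) (hC : ∀ t, m t ≤ C) :
    Monotone (cumRate m) := by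
  intro a b hab
  rw [← sub_nonneg, cumRate_sub hm h0 hC]
  exact intervalIntegral.integral_nonneg hab fun u _ => h0 u

lemma cumRate_sub_le (hm : Measurable m) (h0 : ∀ t, 0 ≤ m t) (hC : ∀ t, m t ≤ C) {a b : ℝ}
    (hab : a ≤ b) : cumRate m b - cumRate m a ≤ C * (b - a) := by
  rw [cumRate_sub hm h0 hC]
  refine (intervalIntegral.integral_mono_on hab (intervalIntegrable_of_bounded hm h0 hC _ _)
    (intervalIntegrable_const (c := C)) fun u _ => hC u).trans ?_
  rw [intervalIntegral.integral_const, smul_eq_mul, mul_comm]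

lemma continuous_cumRate (hm : Measurable m) (h0 : ∀ t, 0 ≤ m t) (hC : ∀ t, m t ≤ C) :
    Continuous (cumRate m) :=
  intervalIntegral.continuous_primitive (intervalIntegrable_of_bounded hm h0 hC) 0

/-- As `m` is only measurable, this is the fundamental theorem of calculus for an absolutely
continuous function. -/
lemma integral_mul_exp_cumRate (hm : Measurable m) (h0 : ∀ t, 0 ≤ m t) (hC : ∀ t, m t ≤ C)
    {a b : ℝ} (hab : a ≤ b) :
    ∫ t in a..b, m t * Real.exp (cumRate m t) =
      Real.exp (cumRate m b) - Real.exp (cumRate m a) := by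
  have hC0 : 0 ≤ C := (h0 0).trans (hC 0)
  have hmono := cumRate_mono hm h0 hC
  have hac : AbsolutelyContinuousOnInterval (fun t => Real.exp (cumRate m t)) a b := by
    refine LipschitzOnWith.absolutelyContinuousOnInterval
      (K := (Real.exp (cumRate m b) * C).toNNReal) (LipschitzOnWith.of_le_add_mul _ ?_)
    intro x hx y hy
    rw [uIcc_of_le hab] at hx hy
    rw [Real.coe_toNNReal _ (by positivity)]
    rcases le_total x y with hxy | hxy
    · have := Real.exp_le_exp.mpr (hmono hxy)
      have : 0 ≤ Real.exp (cumRate m b) * C * dist x y := by positivity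
      linarith
    · have h1 : Real.exp (cumRate m x) * (1 + (cumRate m y - cumRate m x)) ≤
          Real.exp (cumRate m y) := by
        have := Real.add_one_le_exp (cumRate m y - cumRate m x)
        calc _ ≤ Real.exp (cumRate m x) * Real.exp (cumRate m y - cumRate m x) := by
              gcongr; linarith
          _ = _ := by rw [← Real.exp_add]; ring_nf
      have h2 := cumRate_sub_le hm h0 hC hxy
      have h3 := Real.exp_le_exp.mpr (hmono hx.2)
      have h4 : Real.exp (cumRate m x) * (cumRate m x - cumRate m y) ≤
          Real.exp (cumRate m b) * (C * (x - y)) :=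
        mul_le_mul h3 h2 (sub_nonneg.mpr (hmono hxy)) (Real.exp_pos _).le
      rw [Real.dist_eq, abs_of_nonneg (sub_nonneg.mpr hxy)]
      nlinarith
  rw [← hac.integral_deriv_eq_sub]
  refine intervalIntegral.integral_congr_ae ?_
  filter_upwards [(intervalIntegrable_of_bounded hm h0 hC a b).ae_hasDerivAt_integral]
    with t ht hta
  have hd := ht (uIoc_subset_uIcc hta) a left_mem_uIcc
  have hF : HasDerivAt (cumRate m) (m t) t := by
    have : cumRate m = fun x => cumRate m a + ∫ u in a..x, m u := by
      ext x; rw [← cumRate_sub hm h0 hC]; ring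
    rw [this]
    exact hd.const_add _
  rw [hF.exp.deriv, mul_comm]

lemma lintegral_Ico_mul_exp (hm : Measurable m) (h0 : ∀ t, 0 ≤ m t) (hC : ∀ t, m t ≤ C)
    {a b : ℝ} (hab : a ≤ b) (c : ℝ) :
    ∫⁻ t in Ico a b, ENNReal.ofReal (m t * Real.exp (cumRate m t - c)) =
      ENNReal.ofReal (Real.exp (cumRate m b - c) - Real.exp (cumRate m a - c)) := by
  have hcont := continuous_cumRate hm h0 hC
  have hint : IntervalIntegrable (fun t => m t * Real.exp (cumRate m t - c)) volume a b :=
    (intervalIntegrable_of_bounded hm h0 hC a b).mul_continuousOn (by fun_prop)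
  rw [setLIntegral_congr Ico_ae_eq_Ioc, ← ofReal_integral_eq_lintegral_ofReal
    ((intervalIntegrable_iff_integrableOn_Ioc_of_le hab).mp hint)
    (Filter.Eventually.of_forall fun t => mul_nonneg (h0 t) (Real.exp_pos _).le),
    ← intervalIntegral.integral_of_le hab]
  congr 1
  simp_rw [Real.exp_sub, mul_div_assoc']
  rw [intervalIntegral.integral_div, integral_mul_exp_cumRate hm h0 hC hab, sub_div]

/-- The expected value of `g γ T`, when the waiting time for `T` starts at `x` and `T` has hazard
rate `m`. -/
noncomputable def hazardExp (m : ℝ → ℝ) (g : ℝ → ℝ → ENNReal) (γ x : ℝ) : ENNReal :=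
  ∫⁻ t in Ioi x, ENNReal.ofReal (m t * Real.exp (cumRate m x - cumRate m t)) * g γ t

lemma measurable_hazardExp (hm : Measurable m) (h0 : ∀ t, 0 ≤ m t) (hC : ∀ t, m t ≤ C)
    {g : ℝ → ℝ → ENNReal} (hg : Measurable (Function.uncurry g)) :
    Measurable (Function.uncurry (hazardExp m g)) := by
  have hcont := (continuous_cumRate hm h0 hC).measurable
  have : Function.uncurry (hazardExp m g) = fun y : ℝ × ℝ => ∫⁻ t, {q : (ℝ × ℝ) × ℝ |
      q.1.2 < q.2}.indicator (fun q => ENNReal.ofReal (m q.2 *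
        Real.exp (cumRate m q.1.2 - cumRate m q.2)) * g q.1.1 q.2) (y, t) := by
    ext ⟨γ, x⟩
    simp only [Function.uncurry, hazardExp]
    rw [← lintegral_indicator measurableSet_Ioi]
    rfl
  rw [this]
  refine Measurable.lintegral_prod_right' ?_
  refine Measurable.indicator ?_ (measurableSet_lt (by fun_prop) (by fun_prop))
  refine Measurable.mul ?_ (hg.comp (f := fun q : (ℝ × ℝ) × ℝ => (q.1.1, q.2)) (by fun_prop))
  fun_prop

/-- The function `x ↦ hazardExp m g γ x` solves `h' = m (h - g)`; this is the integrated form. -/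
lemma hazardExp_add_lintegral (hm : Measurable m) (h0 : ∀ t, 0 ≤ m t) (hC : ∀ t, m t ≤ C)
    {g : ℝ → ℝ → ENNReal} (hg : Measurable (Function.uncurry g)) {γ σ : ℝ} (hγσ : γ ≤ σ) :
    hazardExp m g γ γ + ∫⁻ t in Ico γ σ, hazardExp m g γ t * ENNReal.ofReal (m t) =
      (∫⁻ t in Ico γ σ, g γ t * ENNReal.ofReal (m t)) + hazardExp m g γ σ := by
  have hcont := (continuous_cumRate hm h0 hC).measurable
  have hmono := cumRate_mono hm h0 hC
  have hgγ : Measurable (g γ) := hg.comp measurable_prodMk_left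
  have hform : ∀ x, hazardExp m g γ x = ∫⁻ t, g γ t * ENNReal.ofReal (m t) *
      (Ioi x).indicator (fun t => ENNReal.ofReal (Real.exp (cumRate m x - cumRate m t))) t := by
    intro x
    rw [hazardExp, ← lintegral_indicator measurableSet_Ioi]
    refine lintegral_congr fun t => ?_
    by_cases ht : t ∈ Ioi x
    · rw [indicator_of_mem ht, indicator_of_mem ht, ENNReal.ofReal_mul (h0 t)]; ring
    · rw [indicator_of_notMem ht, indicator_of_notMem ht, mul_zero]
  have hmeasInd : ∀ x, Measurable fun t => g γ t * ENNReal.ofReal (m t) *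
      (Ioi x).indicator (fun t => ENNReal.ofReal (Real.exp (cumRate m x - cumRate m t))) t :=
    fun x => (hgγ.mul hm.ennreal_ofReal).mul (Measurable.indicator (by fun_prop) measurableSet_Ioi)
  have hb : ∫⁻ t in Ico γ σ, hazardExp m g γ t * ENNReal.ofReal (m t) =
      ∫⁻ s, g γ s * ENNReal.ofReal (m s) * (Ioi γ).indicator (fun s => ENNReal.ofReal
        (Real.exp (cumRate m (min σ s) - cumRate m s) - Real.exp (cumRate m γ - cumRate m s))) s
        := by
    have h1 : ∀ t, hazardExp m g γ t * ENNReal.ofReal (m t) = ∫⁻ s, g γ s * ENNReal.ofReal (m s) *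
      (Iio s).indicator
        (fun t => ENNReal.ofReal (m t * Real.exp (cumRate m t - cumRate m s))) t := by
      intro t
      rw [hform, ← lintegral_mul_const _ (hmeasInd t)]
      refine lintegral_congr fun s => ?_
      by_cases hts : t < s
      · rw [indicator_of_mem (mem_Ioi.mpr hts), indicator_of_mem (mem_Iio.mpr hts),
          ENNReal.ofReal_mul (h0 t)]; ring
      · rw [indicator_of_notMem (by simpa using hts), indicator_of_notMem (by simpa using hts)]
        simp
    simp_rw [h1]
    rw [lintegral_lintegral_swap]
    · refine lintegral_congr fun s => ?_
      rw [lintegral_const_mul _ (Measurable.indicator (by fun_prop) measurableSet_Iio)]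
      congr 1
      rw [lintegral_indicator measurableSet_Iio, Measure.restrict_restrict measurableSet_Iio,
        inter_comm, Ico_inter_Iio]
      by_cases hs : γ < s
      · rw [indicator_of_mem (mem_Ioi.mpr hs),
          lintegral_Ico_mul_exp hm h0 hC (le_min hγσ hs.le)]
      · rw [indicator_of_notMem (by simpa using hs), Ico_eq_empty]
        · simp
        · exact not_lt.mpr ((min_le_right _ _).trans (not_lt.mp hs))
    · refine Measurable.aemeasurable (Measurable.mul ?_ ?_)
      · exact (hgγ.mul hm.ennreal_ofReal).comp measurable_snd
      · have : (fun a : ℝ × ℝ => (Iio a.2).indicator (fun t => ENNReal.ofReal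
            (m t * Real.exp (cumRate m t - cumRate m a.2))) a.1) =
            {a : ℝ × ℝ | a.1 < a.2}.indicator (fun a => ENNReal.ofReal
            (m a.1 * Real.exp (cumRate m a.1 - cumRate m a.2))) := rfl
        exact this ▸ Measurable.indicator (by fun_prop)
          (measurableSet_lt (by fun_prop) (by fun_prop))
  have hc : ∫⁻ t in Ico γ σ, g γ t * ENNReal.ofReal (m t) =
      ∫⁻ t, g γ t * ENNReal.ofReal (m t) * (Ico γ σ).indicator (fun _ => 1) t := by
    rw [← lintegral_indicator measurableSet_Ico]
    refine lintegral_congr fun t => ?_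
    by_cases ht : t ∈ Ico γ σ <;> simp [ht]
  rw [hb, hc, hform γ, hform σ, ← lintegral_add_left (hmeasInd γ),
    ← lintegral_add_right _ (hmeasInd σ)]
  have hne : ∀ c : ℝ, ∀ᵐ s : ℝ, s ≠ c := fun c => by
    rw [ae_iff]; simp
  refine lintegral_congr_ae ?_
  filter_upwards [hne γ, hne σ] with s hsγ hsσ
  rw [← mul_add, ← mul_add]
  congr 1
  rcases lt_or_gt_of_ne hsγ with h1 | h1
  · have h2 : s < σ := h1.trans_le hγσ
    simp [indicator, not_lt.mpr h1.le, not_le.mpr h1, not_lt.mpr h2.le]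
  · have hnn : 0 ≤ Real.exp (cumRate m (min σ s) - cumRate m s) -
        Real.exp (cumRate m γ - cumRate m s) :=
      sub_nonneg.mpr (Real.exp_le_exp.mpr (by
        have := hmono (le_min hγσ h1.le); linarith))
    rw [indicator_of_mem (mem_Ioi.mpr h1), indicator_of_mem (mem_Ioi.mpr h1),
      ← ENNReal.ofReal_add (Real.exp_pos _).le hnn, add_sub_cancel]
    rcases lt_or_gt_of_ne hsσ with h2 | h2
    · rw [min_eq_right h2.le, indicator_of_mem (show s ∈ Ico γ σ from ⟨h1.le, h2⟩),
        indicator_of_notMem (by simpa using h2.le)]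
      simp
    · rw [min_eq_left h2.le, indicator_of_notMem (fun h => absurd h.2 (not_lt.mpr h2.le)),
        indicator_of_mem (mem_Ioi.mpr h2), zero_add]

lemma hazardExp_le (hm : Measurable m) (h0 : ∀ t, 0 ≤ m t) (hC : ∀ t, m t ≤ C)
    {g : ℝ → ℝ → ENNReal} {b : NNReal} (hgb : ∀ x t, g x t ≤ b) (x y : ℝ) :
    hazardExp m g x y ≤ b * ∫⁻ t, ENNReal.ofReal (m t) := by
  have hmono := cumRate_mono hm h0 hC
  rw [hazardExp, ← lintegral_const_mul _ hm.ennreal_ofReal,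
    ← lintegral_indicator measurableSet_Ioi]
  refine lintegral_mono fun t => ?_
  by_cases ht : t ∈ Ioi y
  · rw [indicator_of_mem ht, mul_comm]
    refine mul_le_mul' (hgb _ _) (ENNReal.ofReal_le_ofReal ?_)
    have : Real.exp (cumRate m y - cumRate m t) ≤ 1 :=
      Real.exp_le_one_iff.mpr (by have := hmono (le_of_lt ht); linarith)
    exact mul_le_of_le_one_right (h0 t) this
  · rw [indicator_of_notMem ht]; exact zero_le

/-- Suppose that a random time `σ ≥ γ` is hit, before the horizon `τ`, with hazard rate `m`, in the
sense of the compensator formula `H`. Then, given `γ`, it has the density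
`m t * exp (-∫ u in γ..t, m u)`. The compensator formula is applied to `g` and to
`hazardExp m g`; no differential equation for the survival function is needed. -/
lemma lintegral_eq_hazardExp {Ω : Type*} [MeasurableSpace Ω] {Q : Measure Ω} [IsFiniteMeasure Q]
    {D : Set Ω} (hD : MeasurableSet D) {γ σ : Ω → ℝ} (hγ : Measurable γ)
    (hσm : Measurable σ)
    (hγσ : ∀ᵐ ω ∂Q, γ ω ≤ σ ω) {τ : ℝ} (hσ : ∀ᵐ ω ∂Q, ω ∉ D → σ ω = τ)
    (hm : Measurable m) (h0 : ∀ t, 0 ≤ m t) (hC : ∀ t, m t ≤ C) (hmτ : ∀ t, τ < t → m t = 0)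
    (hfin : ∫⁻ t, ENNReal.ofReal (m t) ≠ ⊤)
    (H : ∀ u : ℝ → ℝ → ENNReal, Measurable (Function.uncurry u) →
      ∫⁻ ω in D, u (γ ω) (σ ω) ∂Q =
        ∫⁻ ω, (∫⁻ t in Ico (γ ω) (σ ω), u (γ ω) t * ENNReal.ofReal (m t)) ∂Q)
    {g : ℝ → ℝ → ENNReal} (hg : Measurable (Function.uncurry g)) {b : NNReal}
    (hgb : ∀ x t, g x t ≤ b) :
    ∫⁻ ω in D, g (γ ω) (σ ω) ∂Q = ∫⁻ ω, hazardExp m g (γ ω) (γ ω) ∂Q := by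
  have hR := measurable_hazardExp hm h0 hC hg
  have hRle := hazardExp_le hm h0 hC hgb
  have hRτ : ∀ x, hazardExp m g x τ = 0 := by
    intro x
    rw [hazardExp, setLIntegral_congr_fun (g := fun _ => 0) measurableSet_Ioi fun t ht => ?_]
    · simp
    · simp [hmτ t ht]
  have hRσ : ∫⁻ ω in D, hazardExp m g (γ ω) (σ ω) ∂Q = ∫⁻ ω, hazardExp m g (γ ω) (σ ω) ∂Q := by
    rw [← lintegral_indicator hD]
    refine lintegral_congr_ae ?_
    filter_upwards [hσ] with ω hω
    by_cases hmem : ω ∈ D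
    · rw [indicator_of_mem hmem]
    · rw [indicator_of_notMem hmem, hω hmem, hRτ]
  have hRγ : Measurable fun ω => hazardExp m g (γ ω) (γ ω) := hR.comp (hγ.prodMk hγ)
  have hRσm : Measurable fun ω => hazardExp m g (γ ω) (σ ω) := hR.comp (hγ.prodMk hσm)
  have hB : ∫⁻ ω in D, hazardExp m g (γ ω) (σ ω) ∂Q ≠ ⊤ := by
    refine ne_top_of_le_ne_top ?_ (lintegral_mono fun ω => hRle _ _)
    rw [lintegral_const]
    exact ENNReal.mul_ne_top (ENNReal.mul_ne_top ENNReal.coe_ne_top hfin) (measure_ne_top _ _)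
  -- the compensator of `hazardExp m g` supplies the terms that turn `g` into `hazardExp m g`
  refine (ENNReal.add_left_inj hB).mp ?_
  calc ∫⁻ ω in D, g (γ ω) (σ ω) ∂Q + ∫⁻ ω in D, hazardExp m g (γ ω) (σ ω) ∂Q
      = ∫⁻ ω, ((∫⁻ t in Ico (γ ω) (σ ω), g (γ ω) t * ENNReal.ofReal (m t)) +
          hazardExp m g (γ ω) (σ ω)) ∂Q := by
        rw [lintegral_add_right _ hRσm, H g hg, hRσ]
    _ = ∫⁻ ω, (hazardExp m g (γ ω) (γ ω) +
          ∫⁻ t in Ico (γ ω) (σ ω), hazardExp m g (γ ω) t * ENNReal.ofReal (m t)) ∂Q := by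
        refine lintegral_congr_ae ?_
        filter_upwards [hγσ] with ω hω
        exact (hazardExp_add_lintegral hm h0 hC hg hω).symm
    _ = _ := by rw [lintegral_add_left hRγ, ← H _ hR]

end hazard

/-! ### The waiting time until the next inspection -/

section nextInspection

/-- The intensity measure `rate t dt` of the arrivals on `(0, τ]`. -/
noncomputable def arrivalIntensity (rate : ℝ → ℝ) (τ : ℝ) : Measure ℝ :=
  (volume.restrict (Ioc 0 τ)).withDensity fun t => ENNReal.ofReal (rate t)

instance (rate : ℝ → ℝ) (τ : ℝ) : NullSingletonClass (arrivalIntensity rate τ) := by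
  unfold arrivalIntensity; infer_instance

lemma arrivalIntensity_compl (rate : ℝ → ℝ) (τ : ℝ) :
    arrivalIntensity rate τ (Ioc 0 τ)ᶜ = 0 := by
  refine withDensity_absolutelyContinuous _ _ ?_
  rw [Measure.restrict_apply measurableSet_Ioc.compl, compl_inter_self, measure_empty]

lemma isFiniteMeasure_arrivalIntensity {rate : ℝ → ℝ} {C : ℝ} (hC : ∀ t, rate t ≤ C) (τ : ℝ) :
    IsFiniteMeasure (arrivalIntensity rate τ) := by
  refine isFiniteMeasure_withDensity (ne_top_of_le_ne_top ?_
    (lintegral_mono fun t => ENNReal.ofReal_le_ofReal (hC t)))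
  rw [lintegral_const]
  exact ENNReal.mul_ne_top ENNReal.ofReal_ne_top (measure_ne_top _ _)

lemma measure_Ioi_eq_cdf (μ : Measure ℝ) [IsProbabilityMeasure μ] (x : ℝ) :
    μ (Ioi x) = ENNReal.ofReal (1 - cdf μ x) := by
  rw [← compl_Iic, prob_compl_eq_one_sub measurableSet_Iic, ← ofReal_cdf,
    ENNReal.ofReal_sub _ (cdf_nonneg μ x), ENNReal.ofReal_one]

variable {Ω E : Type*} [MeasurableSpace Ω] [MeasurableSpace E] {P : Measure Ω}
  [IsProbabilityMeasure P] {τ : ℝ} {rate : ℝ → ℝ} {C : ℝ}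
  {A : Ω → ℕ → ℝ} {ν : Measure E} [IsProbabilityMeasure ν] {W : Ω → ℕ → E}
  {n : ℕ} {α : ℕ → ℝ → ℝ} {sc : E → ℝ}

lemma indicator_setOf_eq_ite {𝓧 : Type*} {p : 𝓧 → Prop} {x : 𝓧} [Decidable (p x)]
    (f : 𝓧 → ENNReal) : {x | p x}.indicator f x = if p x then f x else 0 := by
  by_cases h : p x
  · rw [indicator_of_mem (show x ∈ {x | p x} from h), if_pos h]
  · rw [indicator_of_notMem (show x ∉ {x | p x} from h), if_neg h]

open Classical in
lemma tsum_ite_selected {a s : ℕ → ℝ} (hf : {i | a i ≤ τ}.Finite) (k : ℕ) (Q : Prop)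
    (f : ℝ → ENNReal) :
    ∑' i, (if Selected n α τ a s i ∧ selCount n α τ a s i = k ∧ Q then f (a i) else 0) =
      if k + 1 ≤ numInspections n α τ a s ∧ Q then f (inspectionTime n α τ a s (k + 1)) else 0 := by
  split_ifs with h
  · obtain ⟨i, hi, rfl⟩ := (lt_numInspections_iff hf k).mp h.1
    rw [inspectionTime_of_selected hi, tsum_eq_single i, if_pos ⟨hi, rfl, h.2⟩]
    intro j hj
    rw [if_neg]
    rintro ⟨h1, h2, -⟩
    exact hj (selected_unique h1 hi h2)
  · rw [ENNReal.tsum_eq_zero]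
    intro i
    rw [if_neg]
    rintro ⟨h1, h2, h3⟩
    exact h ⟨(lt_numInspections_iff hf k).mpr ⟨i, h1, h2⟩, h3⟩

/-- Expected sum of `v` over the `(k + 1)`-th inspection; the integral against `ν` shows what its
mark looks like. -/
lemma IsMarkedPoisson.lintegral_selected_mark {I : Measure ℝ} [IsFiniteMeasure I]
    [NullSingletonClass I] (hτ : 0 < τ) (h : IsMarkedPoisson P I τ ν A W)
    (hI : I (Ioc 0 τ)ᶜ = 0) (hα : ∀ b, Measurable (α b)) (hsc : Measurable sc) {k : ℕ}
    (hk : k < n) {v : ℝ → E → ENNReal} (hv : Measurable (Function.uncurry v)) :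
    ∫⁻ ω, ∑' i, (open Classical in if Selected n α τ (A ω) (fun i => sc (W ω i)) i ∧
        selCount n α τ (A ω) (fun i => sc (W ω i)) i = k then v (A ω i) (W ω i) else 0) ∂P =
      ∫⁻ t, (∫⁻ z in {z | α (n - k) t < sc z}, v t z ∂ν) *
        P {ω | selCount n α τ (A ω) (fun i => sc (W ω i)) (numArrivals (A ω) t) = k} ∂I := by
  classical
  have key := h.lintegral_tsum_selected hτ hI hα hsc hk (B := univ) .univ
    (u := fun _ t z => v t z) (hv.comp measurable_snd)
  simp only [mem_univ, and_true, true_and] at key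
  rw [key]
  have hW : Measurable fun ω => fun i => sc (W ω i) :=
    measurable_pi_lambda _ fun i => hsc.comp ((measurable_pi_apply i).comp h.measurable_marks)
  have hcm : ∀ t, MeasurableSet {ω |
      selCount n α τ (A ω) (fun i => sc (W ω i)) (numArrivals (A ω) t) = k} := by
    intro t
    have h1 : Measurable fun x : ℕ × Ω => selCount n α τ (A x.2) (fun i => sc (W x.2 i)) x.1 :=
      measurable_from_prod_countable_right fun i =>
        measurable_selCount hα h.arrivals.measurable hW i
    exact (h1.comp ((measurable_numArrivals h.arrivals.measurable
      measurable_const).prodMk measurable_id)) (measurableSet_singleton k)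
  refine lintegral_congr fun t => ?_
  have hset : MeasurableSet {z | α (n - k) t < sc z} := measurableSet_lt measurable_const hsc
  have hvt : Measurable (v t) := hv.comp measurable_prodMk_left
  rw [← lintegral_indicator hset, ← lintegral_mul_const _ (hvt.indicator hset)]
  refine lintegral_congr fun z => ?_
  by_cases hz : α (n - k) t < sc z
  · rw [indicator_of_mem (show z ∈ {z | α (n - k) t < sc z} from hz),
      ← lintegral_indicator_const (hcm t)]
    refine lintegral_congr fun ω => ?_
    simp only [hz, and_true]
    rw [indicator_setOf_eq_ite]
  · rw [indicator_of_notMem (show z ∉ {z | α (n - k) t < sc z} from hz)]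
    simp [hz]

lemma thinnedRate_le {μ : Measure ℝ} (h0 : ∀ t, 0 ≤ rate t) (hC : ∀ t, rate t ≤ C) (i : ℕ)
    (t : ℝ) : thinnedRate μ rate τ n α i t ≤ C := by
  unfold thinnedRate
  refine (indicator_le_self' (fun t _ => ?_) t).trans ?_
  · exact mul_nonneg (sub_nonneg.mpr (cdf_le_one μ _)) (h0 t)
  · have := mul_le_of_le_one_left (h0 t) (sub_le_self 1 (cdf_nonneg μ (α (n - i + 1) t)))
    exact this.trans (hC t)

lemma thinnedRate_nonneg {μ : Measure ℝ} (h0 : ∀ t, 0 ≤ rate t) (i : ℕ)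
    (t : ℝ) : 0 ≤ thinnedRate μ rate τ n α i t :=
  indicator_nonneg (fun t _ => mul_nonneg (sub_nonneg.mpr (cdf_le_one μ _)) (h0 t)) t

lemma measurable_thinnedRate {μ : Measure ℝ} (hr : Measurable rate) (hα : ∀ b, Measurable (α b))
    (i : ℕ) : Measurable (thinnedRate μ rate τ n α i) :=
  Measurable.indicator ((measurable_const.sub
    ((monotone_cdf μ).measurable.comp (hα _))).mul hr) measurableSet_Icc

lemma lintegral_thinnedRate_ne_top {μ : Measure ℝ} (h0 : ∀ t, 0 ≤ rate t)
    (hC : ∀ t, rate t ≤ C) (i : ℕ) :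
    ∫⁻ t, ENNReal.ofReal (thinnedRate μ rate τ n α i t) ≠ ⊤ := by
  have hle : ∀ t, ENNReal.ofReal (thinnedRate μ rate τ n α i t) ≤
      (Icc 0 τ).indicator (fun _ => ENNReal.ofReal C) t := by
    intro t
    by_cases ht : t ∈ Icc 0 τ
    · rw [indicator_of_mem ht]; exact ENNReal.ofReal_le_ofReal (thinnedRate_le h0 hC i t)
    · rw [indicator_of_notMem ht, thinnedRate, indicator_of_notMem ht]; simp
  refine ne_top_of_le_ne_top ?_ (lintegral_mono hle)
  rw [lintegral_indicator_const measurableSet_Icc]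
  exact ENNReal.mul_ne_top ENNReal.ofReal_ne_top (by simp)

/-- The compensator formula in terms of the inspection times: until it takes place, inspection
`k + 1` has the hazard rate `thinnedRate`, whatever the waiting times before. -/
lemma IsMarkedPoisson.lintegral_inspectionTime_succ (hτ : 0 < τ)
    (h : IsMarkedPoisson P (arrivalIntensity rate τ) τ ν A W)
    (hr : Measurable rate) (hC : ∀ t, rate t ≤ C)
    (hα : ∀ b, Measurable (α b)) (hsc : Measurable sc) {k : ℕ}
    (hk : k < n) {B : Set (Fin k → ℝ)} (hB : MeasurableSet B)
    {M : Ω → ℕ} (hM : M = fun ω => numInspections n α τ (A ω) (fun i => sc (W ω i)))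
    {γ : ℕ → Ω → ℝ} (hγ : γ = fun j ω => inspectionTime n α τ (A ω) (fun i => sc (W ω i)) j)
    {T : ℕ → Ω → ℝ} (hT : T = fun j ω => waitingTime n α τ (A ω) (fun i => sc (W ω i)) j)
    {u : ℝ → ℝ → ENNReal} (hu : Measurable (Function.uncurry u)) :
    ∫⁻ ω in {ω | k + 1 ≤ M ω ∧ (fun l : Fin k => T (l + 1) ω) ∈ B}, u (γ k ω) (γ (k + 1) ω) ∂P =
      ∫⁻ ω in {ω | k ≤ M ω ∧ (fun l : Fin k => T (l + 1) ω) ∈ B},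
        (∫⁻ t in Ico (γ k ω) (if k + 1 ≤ M ω then γ (k + 1) ω else τ),
          u (γ k ω) t * ENNReal.ofReal (thinnedRate (ν.map sc) rate τ n α (k + 1) t)) ∂P := by
  classical
  have := isFiniteMeasure_arrivalIntensity hC τ
  have : IsProbabilityMeasure (ν.map sc) := Measure.isProbabilityMeasure_map hsc.aemeasurable
  have hW : Measurable fun ω => fun i => sc (W ω i) :=
    measurable_pi_lambda _ fun i => hsc.comp ((measurable_pi_apply i).comp h.measurable_marks)
  have hAm := h.arrivals.measurable
  have hMm : Measurable M := hM ▸ measurable_numInspections hα hAm hW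
  have hγm : ∀ j, Measurable (γ j) := fun j => hγ ▸ measurable_inspectionTime hα hAm hW j
  have hTm : ∀ j, Measurable (T j) := fun j => hT ▸ measurable_waitingTime hα hAm hW j
  have hBm : MeasurableSet {ω | (fun l : Fin k => T (l + 1) ω) ∈ B} :=
    (measurable_pi_lambda _ fun l : Fin k => hTm (l + 1)) hB
  have hE : ∀ j, MeasurableSet {ω | j ≤ M ω ∧ (fun l : Fin k => T (l + 1) ω) ∈ B} := fun j =>
    (measurableSet_le measurable_const hMm).inter hBm
  have key := h.lintegral_tsum_selected hτ (arrivalIntensity_compl rate τ) hα hsc hk hB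
    (u := fun x t _ => u x t) (hu.comp (f := fun x : ℝ × ℝ × E => (x.1, x.2.1)) (by fun_prop))
  have hL : ∀ ω, ∑' i, (if Selected n α τ (A ω) (fun i => sc (W ω i)) i ∧
        selCount n α τ (A ω) (fun i => sc (W ω i)) i = k ∧
        (fun l : Fin k => waitingTime n α τ (A ω) (fun i => sc (W ω i)) (l + 1)) ∈ B then
        u (inspectionTime n α τ (A ω) (fun i => sc (W ω i)) k) (A ω i) else 0) =
      {ω | k + 1 ≤ M ω ∧ (fun l : Fin k => T (l + 1) ω) ∈ B}.indicator
        (fun ω => u (γ k ω) (γ (k + 1) ω)) ω := by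
    intro ω
    rw [tsum_ite_selected ((h.arrivals.isArrivalSeq ω).finite le_rfl), hM, hγ, hT,
      indicator_setOf_eq_ite]
  simp_rw [hL] at key
  rw [lintegral_indicator (hE (k + 1))] at key
  rw [key]
  -- the event that exactly `k` inspections have been made by time `t`
  set S : ℝ → Ω → Prop := fun t ω =>
    selCount n α τ (A ω) (fun i => sc (W ω i)) (numArrivals (A ω) t) = k ∧
      (fun l : Fin k => waitingTime n α τ (A ω) (fun i => sc (W ω i)) (l + 1)) ∈ B with hS
  have hSm : MeasurableSet {x : ℝ × Ω | S x.1 x.2} := by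
    have h1 : Measurable fun x : ℕ × Ω => selCount n α τ (A x.2) (fun i => sc (W x.2 i)) x.1 :=
      measurable_from_prod_countable_right fun i => measurable_selCount hα hAm hW i
    have h2 : Measurable fun x : ℝ × Ω => (numArrivals (A x.2) x.1, x.2) :=
      (measurable_numArrivals (hAm.comp measurable_snd) measurable_fst).prodMk measurable_snd
    have h3 : MeasurableSet {ω | (fun l : Fin k => waitingTime n α τ (A ω)
      (fun i => sc (W ω i)) (l + 1)) ∈ B} := by rw [hT] at hBm; exact hBm
    exact ((h1.comp h2) (measurableSet_singleton k)).inter (measurable_snd h3)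
  have hSu : Measurable fun x : ℝ × Ω => if S x.1 x.2 then u (γ k x.2) x.1 else 0 :=
    Measurable.ite hSm (hu.comp (((hγm k).comp measurable_snd).prodMk measurable_fst))
      measurable_const
  set tail : ℝ → ENNReal := fun t => ENNReal.ofReal (1 - cdf (ν.map sc) (α (n - k) t)) with htail
  have htailm : Measurable tail :=
    (measurable_const.sub ((monotone_cdf _).measurable.comp (hα _))).ennreal_ofReal
  have hstep : ∀ t, ∫⁻ z, ∫⁻ ω, (if selCount n α τ (A ω) (fun i => sc (W ω i))
        (numArrivals (A ω) t) = k ∧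
        (fun l : Fin k => waitingTime n α τ (A ω) (fun i => sc (W ω i)) (l + 1)) ∈ B ∧
        α (n - k) t < sc z then
        u (inspectionTime n α τ (A ω) (fun i => sc (W ω i)) k) t else 0) ∂P ∂ν =
      tail t * ∫⁻ ω, (if S t ω then u (γ k ω) t else 0) ∂P := by
    intro t
    have hset : MeasurableSet {z | α (n - k) t < sc z} := measurableSet_lt measurable_const hsc
    have htt : tail t = ν {z | α (n - k) t < sc z} := by
      rw [htail]
      dsimp only
      rw [← measure_Ioi_eq_cdf, Measure.map_apply hsc measurableSet_Ioi]
      rfl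
    rw [htt, mul_comm, ← lintegral_indicator_const hset]
    refine lintegral_congr fun z => ?_
    by_cases hz : α (n - k) t < sc z
    · rw [indicator_of_mem (show z ∈ {z | α (n - k) t < sc z} from hz)]
      simp only [hz, and_true, hS, hγ]
    · rw [indicator_of_notMem (show z ∉ {z | α (n - k) t < sc z} from hz)]
      simp [hz]
  simp_rw [hstep]
  have hSt : Measurable fun t => ∫⁻ ω, (if S t ω then u (γ k ω) t else 0) ∂P :=
    hSu.lintegral_prod_right'
  refine (lintegral_withDensity_eq_lintegral_mul _ hr.ennreal_ofReal (htailm.mul hSt)).trans ?_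
  have hmt : ∀ t ∈ Ioc 0 τ, ENNReal.ofReal (thinnedRate (ν.map sc) rate τ n α (k + 1) t) =
      ENNReal.ofReal (rate t) * tail t := by
    intro t ht
    rw [thinnedRate, indicator_of_mem (Ioc_subset_Icc_self ht),
      show n - (k + 1) + 1 = n - k by omega,
      ENNReal.ofReal_mul (sub_nonneg.mpr (cdf_le_one _ _)), mul_comm]
  have hmm :=
    (measurable_thinnedRate (μ := ν.map sc) (τ := τ) (n := n) hr hα (k + 1)).ennreal_ofReal
  calc _ = ∫⁻ t in Ioc 0 τ, ∫⁻ ω, (if S t ω then u (γ k ω) t else 0) *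
        ENNReal.ofReal (thinnedRate (ν.map sc) rate τ n α (k + 1) t) ∂P := by
        refine setLIntegral_congr_fun measurableSet_Ioc fun t ht => ?_
        have hSut : Measurable fun ω => if S t ω then u (γ k ω) t else 0 :=
          hSu.comp measurable_prodMk_left
        rw [lintegral_mul_const _ hSut, hmt t ht]
        simp only [Pi.mul_apply]
        ring
    _ = ∫⁻ ω, (∫⁻ t in Ioc 0 τ, (if S t ω then u (γ k ω) t else 0) *
        ENNReal.ofReal (thinnedRate (ν.map sc) rate τ n α (k + 1) t)) ∂P :=
        lintegral_lintegral_swap (hSu.mul (hmm.comp measurable_fst)).aemeasurable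
    _ = _ := by
        rw [← lintegral_indicator (hE k)]
        refine lintegral_congr fun ω => ?_
        have hs := h.arrivals.isArrivalSeq ω
        have hf := hs.finite le_rfl
        have hne : ∀ᵐ t : ℝ, t ≠ τ := by rw [ae_iff]; simp
        have hne0 : ∀ᵐ t : ℝ, t ≠ 0 := by rw [ae_iff]; simp
        have hle : k + 1 ≤ M ω → γ (k + 1) ω ≤ τ := by
          intro hk1
          rw [hM] at hk1
          obtain ⟨i, hi, rfl⟩ := (lt_numInspections_iff hf k).mp hk1
          rw [hγ]
          dsimp only
          rw [inspectionTime_of_selected hi]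
          exact hi.1
        have hγ0 : k ≤ M ω → 0 ≤ γ k ω := by
          intro hk1
          rw [hγ]
          rcases k with _ | k
          · exact le_rfl
          · rw [hM] at hk1
            obtain ⟨i, hi, rfl⟩ := (lt_numInspections_iff hf k).mp hk1
            dsimp only
            rw [inspectionTime_of_selected hi]
            exact (hs.pos i).le
        by_cases hω : ω ∈ {ω | k ≤ M ω ∧ (fun l : Fin k => T (l + 1) ω) ∈ B}
        · rw [indicator_of_mem hω, ← lintegral_indicator measurableSet_Ioc,
            ← lintegral_indicator measurableSet_Ico]
          refine lintegral_congr_ae ?_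
          filter_upwards [hne, hne0] with t ht ht0
          have hiff : (t ∈ Ioc 0 τ ∧ S t ω) ↔
              t ∈ Ico (γ k ω) (if k + 1 ≤ M ω then γ (k + 1) ω else τ) := by
            have hcount : t ∈ Ioc 0 τ → (S t ω ↔ (γ k ω ≤ t) ∧
                (k + 1 ≤ M ω → t < γ (k + 1) ω)) := by
              intro htI
              have := selCount_numArrivals_eq_iff (n := n) (α := α) (s := fun i => sc (W ω i))
                hs htI.1.le htI.2 k
              rw [hM, hT] at hω
              rw [hS, hM, hγ]
              dsimp only
              rw [this]
              exact ⟨fun x => ⟨x.1.1.2, x.1.2⟩, fun x => ⟨⟨⟨hω.1, x.1⟩, x.2⟩, hω.2⟩⟩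
            constructor
            · rintro ⟨h1, h2⟩
              obtain ⟨h3, h4⟩ := (hcount h1).mp h2
              refine ⟨h3, ?_⟩
              split_ifs with hk1
              · exact h4 hk1
              · exact lt_of_le_of_ne h1.2 ht
            · rintro ⟨h1, h2⟩
              have htI : t ∈ Ioc 0 τ := by
                refine ⟨lt_of_le_of_ne ((hγ0 hω.1).trans h1) (Ne.symm ht0), ?_⟩
                split_ifs at h2 with hk1
                · exact h2.le.trans (hle hk1)
                · exact h2.le
              refine ⟨htI, (hcount htI).mpr ⟨h1, fun hk1 => ?_⟩⟩
              rwa [if_pos hk1] at h2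
          by_cases htI : t ∈ Ico (γ k ω) (if k + 1 ≤ M ω then γ (k + 1) ω else τ)
          · obtain ⟨h1, h2⟩ := hiff.mpr htI
            rw [indicator_of_mem h1, indicator_of_mem htI, if_pos h2]
          · rw [indicator_of_notMem htI]
            by_cases h1 : t ∈ Ioc 0 τ
            · rw [indicator_of_mem h1, if_neg fun h2 => htI (hiff.mp ⟨h1, h2⟩), zero_mul]
            · rw [indicator_of_notMem h1]
        · rw [indicator_of_notMem hω]
          rw [setLIntegral_congr_fun (g := fun _ => 0) measurableSet_Ioc fun t ht => ?_]
          · simp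
          · rw [if_neg, zero_mul]
            intro hSt
            refine hω ⟨?_, by rw [hT]; exact hSt.2⟩
            have := (selCount_numArrivals_eq_iff (n := n) (α := α) (s := fun i => sc (W ω i))
                hs ht.1.le ht.2 k).mp hSt.1
            rw [hM]
            exact this.1.1

/-- Given the waiting times before, the time of inspection `k + 1` has the density
`m t * exp (-∫ u in γ..t, m u)` on `t > γ`, where `γ` is the time of inspection `k` and `m` is the
thinned rate. -/
theorem IsMarkedPoisson.lintegral_inspectionTime_eq_hazardExp (hτ : 0 < τ)
    (h : IsMarkedPoisson P (arrivalIntensity rate τ) τ ν A W)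
    (hr : Measurable rate) (h0 : ∀ t, 0 ≤ rate t) (hC : ∀ t, rate t ≤ C)
    (hα : ∀ b, Measurable (α b)) (hsc : Measurable sc) {k : ℕ}
    (hk : k < n) {B : Set (Fin k → ℝ)} (hB : MeasurableSet B)
    {M : Ω → ℕ} (hM : M = fun ω => numInspections n α τ (A ω) (fun i => sc (W ω i)))
    {γ : ℕ → Ω → ℝ} (hγ : γ = fun j ω => inspectionTime n α τ (A ω) (fun i => sc (W ω i)) j)
    {T : ℕ → Ω → ℝ} (hT : T = fun j ω => waitingTime n α τ (A ω) (fun i => sc (W ω i)) j)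
    {g : ℝ → ℝ → ENNReal} (hg : Measurable (Function.uncurry g)) {b : NNReal}
    (hgb : ∀ x t, g x t ≤ b) :
    ∫⁻ ω in {ω | k + 1 ≤ M ω ∧ (fun l : Fin k => T (l + 1) ω) ∈ B}, g (γ k ω) (γ (k + 1) ω) ∂P =
      ∫⁻ ω in {ω | k ≤ M ω ∧ (fun l : Fin k => T (l + 1) ω) ∈ B},
        hazardExp (thinnedRate (ν.map sc) rate τ n α (k + 1)) g (γ k ω) (γ k ω) ∂P := by
  classical
  have hfinI := isFiniteMeasure_arrivalIntensity hC τ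
  have hW : Measurable fun ω => fun i => sc (W ω i) :=
    measurable_pi_lambda _ fun i => hsc.comp ((measurable_pi_apply i).comp h.measurable_marks)
  have hAm := h.arrivals.measurable
  have hMm : Measurable M := hM ▸ measurable_numInspections hα hAm hW
  have hγm : ∀ j, Measurable (γ j) := fun j => hγ ▸ measurable_inspectionTime hα hAm hW j
  have hTm : ∀ j, Measurable (T j) := fun j => hT ▸ measurable_waitingTime hα hAm hW j
  have hE : ∀ j, MeasurableSet {ω | j ≤ M ω ∧ (fun l : Fin k => T (l + 1) ω) ∈ B} := fun j =>
    (measurableSet_le measurable_const hMm).inter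
      ((measurable_pi_lambda _ fun l : Fin k => hTm (l + 1)) hB)
  have hD : ∀ j, MeasurableSet {ω | j ≤ M ω} := fun j => measurableSet_le measurable_const hMm
  set σ : Ω → ℝ := fun ω => if k + 1 ≤ M ω then γ (k + 1) ω else τ with hσ
  set m := thinnedRate (ν.map sc) rate τ n α (k + 1) with hm
  have hmm : Measurable m := measurable_thinnedRate hr hα _
  have hmn : ∀ t, 0 ≤ m t := thinnedRate_nonneg h0 _
  have hmC : ∀ t, m t ≤ C := thinnedRate_le h0 hC _
  have hrestrict : (P.restrict {ω | k ≤ M ω ∧ (fun l : Fin k => T (l + 1) ω) ∈ B}).restrict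
      {ω | k + 1 ≤ M ω} =
      P.restrict {ω | k + 1 ≤ M ω ∧ (fun l : Fin k => T (l + 1) ω) ∈ B} := by
    rw [Measure.restrict_restrict (hD _)]
    congr 1
    ext ω
    simp only [mem_inter_iff, mem_ofPred_eq]
    constructor
    · rintro ⟨h1, -, h2⟩; exact ⟨h1, h2⟩
    · rintro ⟨h1, h2⟩; exact ⟨h1, by omega, h2⟩
  have hγσ : ∀ᵐ ω ∂(P.restrict {ω | k ≤ M ω ∧ (fun l : Fin k => T (l + 1) ω) ∈ B}),
      γ k ω ≤ σ ω := by
    rw [ae_restrict_iff' (hE k)]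
    refine Filter.Eventually.of_forall fun ω hω => ?_
    have hs := h.arrivals.isArrivalSeq ω
    have hf := hs.finite le_rfl
    rw [hσ]
    have hk1 := hω.1
    rw [hM] at hk1
    by_cases hM1 : k + 1 ≤ M ω
    · simp only [if_pos hM1]
      rw [hM] at hM1
      obtain ⟨i, hi, hik⟩ := (lt_numInspections_iff hf k).mp hM1
      have h1 := (le_selCount_numArrivals_iff (n := n) (α := α) (s := fun i => sc (W ω i)) hs
        (hs.pos i).le hi.1 k).mp (by
          rw [← hik]
          exact selCount_mono (((hs.le_iff hi.1 i).mp le_rfl).le))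
      rw [hγ]
      dsimp only
      rw [← hik, inspectionTime_of_selected hi, hik]
      exact h1.2
    · simp only [if_neg hM1]
      rw [hγ]
      rcases k with _ | k
      · exact hτ.le
      · obtain ⟨i, hi, hik⟩ := (lt_numInspections_iff hf k).mp hk1
        dsimp only
        rw [← hik, inspectionTime_of_selected hi]
        exact hi.1
  have hint : ∫⁻ t, ENNReal.ofReal (m t) ≠ ⊤ := lintegral_thinnedRate_ne_top h0 hC _
  have := lintegral_eq_hazardExp (Q := P.restrict {ω | k ≤ M ω ∧
      (fun l : Fin k => T (l + 1) ω) ∈ B}) (D := {ω | k + 1 ≤ M ω}) (hD _) (γ := γ k) (σ := σ)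
    (hγm k) (Measurable.ite (hD _) (hγm _) measurable_const) hγσ (τ := τ)
    (Filter.Eventually.of_forall fun ω hω => if_neg hω) hmm hmn hmC
    (fun t ht => indicator_of_notMem (fun hc => absurd hc.2 (not_le.mpr ht)) _) hint ?_ hg hgb
  · rw [hrestrict] at this
    rw [← this]
    refine setLIntegral_congr_fun (hE _) fun ω hω => ?_
    simp only [hσ]
    rw [if_pos hω.1]
  · intro u hu
    rw [hrestrict, ← h.lintegral_inspectionTime_succ hτ hr hC hα hsc hk hB hM hγ hT hu]
    refine setLIntegral_congr_fun (hE _) fun ω hω => ?_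
    simp only [hσ]
    rw [if_pos hω.1]

end nextInspection

/-! ### The densities of the waiting times and the iterated expectations -/

section waitingTimes

lemma waitDensity_nonneg {m : ℝ → ℝ} (h0 : ∀ t, 0 ≤ m t) (γ t : ℝ) : 0 ≤ waitDensity m γ t :=
  mul_nonneg (h0 _) (Real.exp_pos _).le

lemma waitDensity_eq {m : ℝ → ℝ} {C : ℝ} (hm : Measurable m) (h0 : ∀ t, 0 ≤ m t)
    (hC : ∀ t, m t ≤ C) (γ t : ℝ) :
    waitDensity m γ t = m (γ + t) * Real.exp (cumRate m γ - cumRate m (γ + t)) := by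
  rw [waitDensity, intervalIntegral.integral_comp_add_left (fun u => m u), add_zero,
    ← cumRate_sub hm h0 hC, neg_sub]

lemma hazardExp_eq_lintegral_waitDensity {m : ℝ → ℝ} {C : ℝ} (hm : Measurable m)
    (h0 : ∀ t, 0 ≤ m t) (hC : ∀ t, m t ≤ C) (g : ℝ → ℝ → ENNReal) (γ : ℝ) :
    hazardExp m g γ γ =
      ∫⁻ t in Ioi 0, ENNReal.ofReal (waitDensity m γ t) * g γ (γ + t) := by
  rw [hazardExp, ← lintegral_indicator measurableSet_Ioi, ← lintegral_indicator measurableSet_Ioi,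
    ← lintegral_add_left_eq_self _ γ]
  refine lintegral_congr fun t => ?_
  simp only [indicator, mem_Ioi, lt_add_iff_pos_right, waitDensity_eq hm h0 hC]

variable {Ω E : Type*} [MeasurableSpace Ω] [MeasurableSpace E] {P : Measure Ω}
  [IsProbabilityMeasure P] {τ : ℝ} {rate : ℝ → ℝ} {C : ℝ}
  {A : Ω → ℕ → ℝ} {ν : Measure E} [IsProbabilityMeasure ν] {W : Ω → ℕ → E}
  {n : ℕ} {α : ℕ → ℝ → ℝ} {sc : E → ℝ}

/-- The conditional density of the waiting time for inspection `k + 1`, given the previous ones. -/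
theorem IsMarkedPoisson.measure_waitingTime (hτ : 0 < τ)
    (h : IsMarkedPoisson P (arrivalIntensity rate τ) τ ν A W)
    (hr : Measurable rate) (h0 : ∀ t, 0 ≤ rate t) (hC : ∀ t, rate t ≤ C)
    (hα : ∀ b, Measurable (α b)) (hsc : Measurable sc) {k : ℕ}
    (hk : k < n) {B : Set (Fin k → ℝ)} (hB : MeasurableSet B) {D : Set ℝ} (hD : MeasurableSet D)
    {M : Ω → ℕ} (hM : M = fun ω => numInspections n α τ (A ω) (fun i => sc (W ω i)))
    {T : ℕ → Ω → ℝ} (hT : T = fun j ω => waitingTime n α τ (A ω) (fun i => sc (W ω i)) j) :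
    P {ω | k + 1 ≤ M ω ∧ (fun l : Fin k => T (l + 1) ω) ∈ B ∧ T (k + 1) ω ∈ D} =
      ∫⁻ ω in {ω | k ≤ M ω ∧ (fun l : Fin k => T (l + 1) ω) ∈ B},
        (∫⁻ t in D ∩ Ioi 0, ENNReal.ofReal
          (waitDensity (thinnedRate (ν.map sc) rate τ n α (k + 1))
            (∑ l ∈ Finset.Icc 1 k, T l ω) t)) ∂P := by
  have hW : Measurable fun ω => fun i => sc (W ω i) :=
    measurable_pi_lambda _ fun i => hsc.comp ((measurable_pi_apply i).comp h.measurable_marks)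
  have hAm := h.arrivals.measurable
  have hMm : Measurable M := hM ▸ measurable_numInspections hα hAm hW
  have hTm : ∀ j, Measurable (T j) := fun j => hT ▸ measurable_waitingTime hα hAm hW j
  have hE : MeasurableSet {ω | k + 1 ≤ M ω ∧ (fun l : Fin k => T (l + 1) ω) ∈ B} :=
    (measurableSet_le measurable_const hMm).inter
      ((measurable_pi_lambda _ fun l : Fin k => hTm (l + 1)) hB)
  set γ : ℕ → Ω → ℝ := fun j ω => inspectionTime n α τ (A ω) (fun i => sc (W ω i)) j with hγ
  set g : ℝ → ℝ → ENNReal := fun x t => D.indicator (fun _ => 1) (t - x) with hg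
  have hgm : Measurable (Function.uncurry g) :=
    (measurable_const.indicator hD).comp (measurable_snd.sub measurable_fst)
  have hgb : ∀ x t, g x t ≤ (1 : NNReal) := fun x t => by
    simp only [hg, ENNReal.coe_one]
    exact indicator_le_self _ _ _
  have hm := measurable_thinnedRate (μ := ν.map sc) (τ := τ) (n := n) hr hα (k + 1)
  have key := h.lintegral_inspectionTime_eq_hazardExp hτ hr h0 hC hα hsc hk hB hM hγ hT hgm hgb
  have hTγ : ∀ ω, T (k + 1) ω = γ (k + 1) ω - γ k ω := fun ω => by rw [hT, hγ]; rfl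
  calc _ = ∫⁻ ω in {ω | k + 1 ≤ M ω ∧ (fun l : Fin k => T (l + 1) ω) ∈ B},
        g (γ k ω) (γ (k + 1) ω) ∂P := by
        simp only [hg, ← hTγ]
        have : (fun ω => D.indicator (fun _ => (1 : ENNReal)) (T (k + 1) ω)) =
            (T (k + 1) ⁻¹' D).indicator fun _ => 1 := rfl
        rw [this, lintegral_indicator_const (hTm _ hD), one_mul,
          Measure.restrict_apply (hTm _ hD)]
        congr 1
        ext ω
        simp only [mem_ofPred_eq, mem_inter_iff, mem_preimage]
        tauto
    _ = _ := by
        rw [key]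
        refine lintegral_congr fun ω => ?_
        have hsum : ∑ l ∈ Finset.Icc 1 k, T l ω = γ k ω := by
          rw [hT, hγ]; exact sum_waitingTime k
        rw [hazardExp_eq_lintegral_waitDensity hm (thinnedRate_nonneg h0 _)
          (thinnedRate_le h0 hC _), hsum, ← Measure.restrict_restrict hD, ← lintegral_indicator hD]
        refine lintegral_congr fun t => ?_
        simp only [hg, add_sub_cancel_left]
        by_cases ht : t ∈ D <;> simp [ht]

variable {m : ℕ → ℝ → ℝ} {f : ℝ → ℝ}

lemma ofReal_iteratedExp_succ (hm : ∀ i, Measurable (m i)) (h0 : ∀ i t, 0 ≤ m i t)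
    (hC : ∀ i t, m i t ≤ C) (hfin : ∀ i, ∫⁻ t, ENNReal.ofReal (m i t) ≠ ⊤) {r i : ℕ}
    (hf : Measurable (iteratedExp m f r (i + 1))) (hf0 : ∀ t, 0 ≤ iteratedExp m f r (i + 1) t)
    {b : NNReal} (hb : ∀ t, iteratedExp m f r (i + 1) t ≤ b) (γ : ℝ) :
    ENNReal.ofReal (iteratedExp m f (r + 1) i γ) =
      hazardExp (m i) (fun _ t => ENNReal.ofReal (iteratedExp m f r (i + 1) t)) γ γ := by
  have hle := hazardExp_le (hm i) (h0 i) (hC i) (b := b)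
    (g := fun _ t => ENNReal.ofReal (iteratedExp m f r (i + 1) t))
    (fun _ t => by
      rw [← ENNReal.ofReal_coe_nnreal]; exact ENNReal.ofReal_le_ofReal (hb t)) γ γ
  have hlt := ne_top_of_le_ne_top (ENNReal.mul_ne_top ENNReal.coe_ne_top (hfin i)) hle
  rw [hazardExp_eq_lintegral_waitDensity (hm i) (h0 i) (hC i)] at hlt ⊢
  have hwn := waitDensity_nonneg (h0 i) γ
  have hwm : Measurable (waitDensity (m i) γ) := by
    have := (continuous_cumRate (hm i) (h0 i) (hC i)).measurable
    have hmi := hm i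
    rw [show waitDensity (m i) γ = _ from funext (waitDensity_eq (hm i) (h0 i) (hC i) γ)]
    fun_prop
  simp_rw [← ENNReal.ofReal_mul (hwn _)] at hlt ⊢
  rw [iteratedExp]
  have hpos : ∀ t, 0 ≤ waitDensity (m i) γ t * iteratedExp m f r (i + 1) (γ + t) :=
    fun t => mul_nonneg (hwn t) (hf0 _)
  refine ofReal_integral_eq_lintegral_ofReal ?_ (Filter.Eventually.of_forall hpos)
  exact (lintegral_ofReal_ne_top_iff_integrable
    (hwm.mul (hf.comp (measurable_const_add γ))).aestronglyMeasurable
    (Filter.Eventually.of_forall hpos)).mp hlt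

/-- `iteratedExp` is nonnegative, measurable and bounded, so that it is also given by iterated
Lebesgue integrals. -/
lemma iteratedExp_properties (hm : ∀ i, Measurable (m i)) (h0 : ∀ i t, 0 ≤ m i t)
    (hC : ∀ i t, m i t ≤ C) (hfin : ∀ i, ∫⁻ t, ENNReal.ofReal (m i t) ≠ ⊤)
    (hf : Measurable f) (hf0 : ∀ t, 0 ≤ f t) {b : NNReal} (hb : ∀ t, f t ≤ b) (r i : ℕ) :
    Measurable (iteratedExp m f r i) ∧ (∀ γ, 0 ≤ iteratedExp m f r i γ) ∧
      ∃ c : NNReal, ∀ γ, iteratedExp m f r i γ ≤ c := by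
  induction r generalizing i with
  | zero => exact ⟨hf, hf0, b, hb⟩
  | succ r ih =>
    obtain ⟨h1, h2, c, h3⟩ := ih (i + 1)
    have hpos : ∀ γ, 0 ≤ iteratedExp m f (r + 1) i γ := fun γ => integral_nonneg fun t =>
      mul_nonneg (waitDensity_nonneg (h0 i) γ t) (h2 _)
    have heq := ofReal_iteratedExp_succ hm h0 hC hfin h1 h2 h3
    refine ⟨?_, hpos, (c * ∫⁻ t, ENNReal.ofReal (m i t)).toNNReal, fun γ => ?_⟩
    · have hmeas := measurable_hazardExp (hm i) (h0 i) (hC i)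
        (g := fun _ t => ENNReal.ofReal (iteratedExp m f r (i + 1) t))
        (h1.ennreal_ofReal.comp measurable_snd)
      have : iteratedExp m f (r + 1) i = fun γ => (hazardExp (m i)
          (fun _ t => ENNReal.ofReal (iteratedExp m f r (i + 1) t)) γ γ).toReal :=
        funext fun γ => by rw [← heq, ENNReal.toReal_ofReal (hpos γ)]
      rw [this]
      exact (hmeas.comp (measurable_id.prodMk measurable_id)).ennreal_toReal
    · have hle := hazardExp_le (hm i) (h0 i) (hC i) (b := c)
        (g := fun _ t => ENNReal.ofReal (iteratedExp m f r (i + 1) t))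
        (fun _ t => by
          rw [← ENNReal.ofReal_coe_nnreal]; exact ENNReal.ofReal_le_ofReal (h3 t)) γ γ
      rw [← heq] at hle
      have hne := ENNReal.mul_ne_top (ENNReal.coe_ne_top (r := c)) (hfin i)
      exact (ENNReal.toReal_ofReal (hpos γ)).symm.trans_le (ENNReal.toReal_mono hne hle)

/-- The expectation over the inspection times `k + 1, …, k + r`, given the first `k`, is the
iterated one. -/
lemma IsMarkedPoisson.lintegral_iteratedExp (hτ : 0 < τ)
    (h : IsMarkedPoisson P (arrivalIntensity rate τ) τ ν A W)
    (hr : Measurable rate) (h0 : ∀ t, 0 ≤ rate t) (hC : ∀ t, rate t ≤ C)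
    (hα : ∀ b, Measurable (α b)) (hsc : Measurable sc)
    {M : Ω → ℕ} (hM : M = fun ω => numInspections n α τ (A ω) (fun i => sc (W ω i)))
    {γ : ℕ → Ω → ℝ} (hγ : γ = fun j ω => inspectionTime n α τ (A ω) (fun i => sc (W ω i)) j)
    (hf : Measurable f) (hf0 : ∀ t, 0 ≤ f t) {b : NNReal} (hb : ∀ t, f t ≤ b) (r k : ℕ)
    (hrk : k + r ≤ n) :
    ∫⁻ ω in {ω | k ≤ M ω}, ENNReal.ofReal
        (iteratedExp (thinnedRate (ν.map sc) rate τ n α) f r (k + 1) (γ k ω)) ∂P =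
      ∫⁻ ω in {ω | k + r ≤ M ω}, ENNReal.ofReal (f (γ (k + r) ω)) ∂P := by
  induction r generalizing k with
  | zero => rfl
  | succ r ih =>
    have hm := measurable_thinnedRate (μ := ν.map sc) (τ := τ) (n := n) hr hα
    have hm0 := thinnedRate_nonneg (μ := ν.map sc) (τ := τ) (n := n) (α := α) h0
    have hmC := thinnedRate_le (μ := ν.map sc) (τ := τ) (n := n) (α := α) h0 hC
    have hfin := lintegral_thinnedRate_ne_top (μ := ν.map sc) (τ := τ) (n := n) (α := α) h0 hC
    obtain ⟨h1, h2, c, h3⟩ := iteratedExp_properties hm hm0 hmC hfin hf hf0 hb r (k + 1 + 1)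
    simp_rw [ofReal_iteratedExp_succ hm hm0 hmC hfin h1 h2 h3]
    have key := h.lintegral_inspectionTime_eq_hazardExp hτ hr h0 hC hα hsc (k := k) (by omega)
      (B := univ) .univ hM hγ rfl (g := fun _ t => ENNReal.ofReal (iteratedExp
        (thinnedRate (ν.map sc) rate τ n α) f r (k + 1 + 1) t))
      (h1.ennreal_ofReal.comp measurable_snd) (b := c) (fun _ t => by
        rw [← ENNReal.ofReal_coe_nnreal]; exact ENNReal.ofReal_le_ofReal (h3 t))
    simp only [mem_univ, and_true] at key
    rw [← key, ih (k + 1) (by omega), show k + 1 + r = k + (r + 1) by omega]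

/-- The expectation over the first `j` inspection times is the iterated one. -/
theorem IsMarkedPoisson.integral_eq_iteratedExp (hτ : 0 < τ)
    (h : IsMarkedPoisson P (arrivalIntensity rate τ) τ ν A W)
    (hr : Measurable rate) (h0 : ∀ t, 0 ≤ rate t) (hC : ∀ t, rate t ≤ C)
    (hα : ∀ b, Measurable (α b)) (hsc : Measurable sc)
    {M : Ω → ℕ} (hM : M = fun ω => numInspections n α τ (A ω) (fun i => sc (W ω i)))
    {γ : ℕ → Ω → ℝ} (hγ : γ = fun j ω => inspectionTime n α τ (A ω) (fun i => sc (W ω i)) j)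
    (hf : Measurable f) (hf0 : ∀ t, 0 ≤ f t) {b : NNReal} (hb : ∀ t, f t ≤ b) {j : ℕ}
    (hj : j ≤ n) :
    ∫ ω in {ω | j ≤ M ω}, f (γ j ω) ∂P =
      iteratedExp (thinnedRate (ν.map sc) rate τ n α) f j 1 0 := by
  have hW : Measurable fun ω => fun i => sc (W ω i) :=
    measurable_pi_lambda _ fun i => hsc.comp ((measurable_pi_apply i).comp h.measurable_marks)
  have hγm : Measurable (γ j) := hγ ▸ measurable_inspectionTime hα h.arrivals.measurable hW j
  have hm := measurable_thinnedRate (μ := ν.map sc) (τ := τ) (n := n) hr hα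
  have hm0 := thinnedRate_nonneg (μ := ν.map sc) (τ := τ) (n := n) (α := α) h0
  have hmC := thinnedRate_le (μ := ν.map sc) (τ := τ) (n := n) (α := α) h0 hC
  have hfin := lintegral_thinnedRate_ne_top (μ := ν.map sc) (τ := τ) (n := n) (α := α) h0 hC
  obtain ⟨-, h2, -⟩ := iteratedExp_properties hm hm0 hmC hfin hf hf0 hb j 1
  have key := h.lintegral_iteratedExp hτ hr h0 hC hα hsc hM hγ hf hf0 hb j 0 (by omega)
  have hγ0 : ∀ ω, γ 0 ω = 0 := fun ω => by rw [hγ]; rfl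
  simp only [zero_le, ofPred_true, Measure.restrict_univ, zero_add, hγ0, lintegral_const,
    measure_univ, mul_one] at key
  rw [integral_eq_lintegral_of_nonneg_ae (Filter.Eventually.of_forall fun ω => hf0 _)
    (hf.comp hγm).aestronglyMeasurable, ← key, ENNReal.toReal_ofReal (h2 0)]

end waitingTimes

/-! ### Frauds and detected frauds -/

lemma _root_.Measurable.comp_seq {𝓧 E F : Type*} [MeasurableSpace 𝓧] [MeasurableSpace E]
    [MeasurableSpace F] {f : E → F} (hf : Measurable f) {w : 𝓧 → ℕ → E} (hw : Measurable w) :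
    Measurable fun x i => f (w x i) :=
  measurable_pi_lambda _ fun i => hf.comp ((measurable_pi_apply i).comp hw)

section frauds

section counting

variable {n : ℕ} {α : ℕ → ℝ → ℝ} {τ : ℝ} {a s : ℕ → ℝ} {y : ℕ → Bool}

open Classical in
lemma natCast_numFrauds (hf : {i | a i ≤ τ}.Finite) :
    (numFrauds τ a y : ENNReal) = ∑' i, if a i ≤ τ ∧ y i = true then 1 else 0 :=
  natCast_ncard_eq_tsum (hf.subset fun _ h => h.1)

open Classical in
lemma natCast_numDetected (hf : {i | a i ≤ τ}.Finite) :
    (numDetected n α τ a s y : ENNReal) =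
      ∑' i, if Selected n α τ a s i ∧ y i = true then 1 else 0 :=
  natCast_ncard_eq_tsum (hf.subset fun _ h => h.1.1)

lemma numDetected_le_numFrauds (hf : {i | a i ≤ τ}.Finite) :
    numDetected n α τ a s y ≤ numFrauds τ a y :=
  ncard_le_ncard (fun _ h => ⟨h.1.1, h.2⟩) (hf.subset fun _ h => h.1)

lemma numDetected_le (hf : {i | a i ≤ τ}.Finite) : numDetected n α τ a s y ≤ n :=
  (ncard_le_ncard (fun _ h => h.1) (finite_selected hf)).trans (numInspections_le hf)

lemma numFrauds_insAt (h : IsArrivalSeq τ a) {t : ℝ} (h0 : 0 < t) (ht : t ≤ τ)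
    {v : Bool} (hv : v = true) :
    numFrauds τ (insAt (numArrivals a t) t a) (insAt (numArrivals a t) v y) =
      numFrauds τ a y + 1 := by
  classical
  have key : (numFrauds τ (insAt (numArrivals a t) t a) (insAt (numArrivals a t) v y) : ENNReal) =
      (numFrauds τ a y + 1 : ℕ) := by
    rw [natCast_numFrauds ((h.insAt h0 ht).finite le_rfl), tsum_skipAt (numArrivals a t)]
    push_cast
    rw [natCast_numFrauds (h.finite le_rfl), add_comm]
    simp only [insAt_self, insAt_skipAt, ht, hv, and_self, if_true]
  exact_mod_cast key

open Classical in
/-- The number of pairs of distinct frauds the second of which is detected. -/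
lemma tsum_tsum_detected (hf : {i | a i ≤ τ}.Finite) {m : ℕ} (hm : numFrauds τ a y = m + 1) :
    ∑' i, (if a i ≤ τ ∧ y i = true then
      ∑' j, (if Selected n α τ a s (skipAt i j) ∧ y (skipAt i j) = true then 1 else 0 : ENNReal)
      else 0) = m * (numDetected n α τ a s y : ENNReal) := by
  have hD := natCast_numDetected (n := n) (α := α) (s := s) (y := y) hf
  have hF := natCast_numFrauds (y := y) hf
  set D : ENNReal := (numDetected n α τ a s y : ENNReal) with hDdef
  have hDtop : D ≠ ⊤ := ENNReal.natCast_ne_top _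
  refine (ENNReal.add_right_inj hDtop).mp ?_
  have hpt : ∀ i, (if Selected n α τ a s i ∧ y i = true then 1 else 0 : ENNReal) +
      (if a i ≤ τ ∧ y i = true then
        ∑' j, (if Selected n α τ a s (skipAt i j) ∧ y (skipAt i j) = true then 1 else 0 : ENNReal)
        else 0) = (if a i ≤ τ ∧ y i = true then 1 else 0) * D := by
    intro i
    by_cases hi : a i ≤ τ ∧ y i = true
    · rw [if_pos hi, if_pos hi, one_mul, hD, ← tsum_skipAt i
        (fun i => if Selected n α τ a s i ∧ y i = true then (1 : ENNReal) else 0)]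
    · rw [if_neg hi, if_neg hi, if_neg fun h => hi ⟨h.1.1, h.2⟩, zero_mul, add_zero]
  calc D + _ = ∑' i, (if a i ≤ τ ∧ y i = true then 1 else 0) * D := by
        nth_rw 1 [hD]
        rw [← ENNReal.tsum_add]
        exact tsum_congr hpt
    _ = D + m * D := by
        rw [ENNReal.tsum_mul_right, ← hF, hm]
        push_cast
        ring

variable {𝓧 : Type*} [MeasurableSpace 𝓧] {a s : 𝓧 → ℕ → ℝ} {y : 𝓧 → ℕ → Bool}

lemma measurable_numFrauds (ha : Measurable a) (hy : Measurable y) :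
    Measurable fun x => numFrauds τ (a x) (y x) :=
  measurable_ncard fun i => (measurableSet_le ((measurable_pi_apply i).comp ha)
    measurable_const).inter (((measurable_pi_apply i).comp hy) (measurableSet_singleton true))

lemma measurable_numDetected (hα : ∀ b, Measurable (α b)) (ha : Measurable a) (hs : Measurable s)
    (hy : Measurable y) : Measurable fun x => numDetected n α τ (a x) (s x) (y x) :=
  measurable_ncard fun i => (measurableSet_selected hα ha hs i).inter
    (((measurable_pi_apply i).comp hy) (measurableSet_singleton true))

end counting

section chebyshev

variable {p d : ℕ → NNReal} {c : NNReal}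

lemma mul_le_mul_of_poisson_recursion (h1 : ∀ m : ℕ, (m + 1) * p (m + 1) = c * p m)
    (h2 : ∀ m : ℕ, m * d (m + 1) ≤ c * d m) {m l : ℕ} (hm : 1 ≤ m) (hml : m ≤ l) :
    p m * d l * m ≤ p l * d m * l := by
  induction l, hml using Nat.le_induction with
  | base => rfl
  | succ l hml ih =>
    have hl : (0 : NNReal) < l := by exact_mod_cast (by omega : 0 < l)
    refine le_of_mul_le_mul_left ?_ hl
    calc (l : NNReal) * (p m * d (l + 1) * m) = p m * m * (l * d (l + 1)) := by ring
      _ ≤ p m * m * (c * d l) := mul_le_mul_right (h2 l) _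
      _ = c * (p m * d l * m) := by ring
      _ ≤ c * (p l * d m * l) := by gcongr
      _ = l * (d m * (c * p l)) := by ring
      _ = l * (p (l + 1) * d m * (l + 1 : ℕ)) := by rw [← h1 l]; push_cast; ring

lemma add_le_add_of_poisson_recursion (h1 : ∀ m : ℕ, (m + 1) * p (m + 1) = c * p m)
    (h2 : ∀ m : ℕ, m * d (m + 1) ≤ c * d m) {m l : ℕ} (hm : 1 ≤ m) (hl : 1 ≤ l) :
    p l * d m + p m * d l ≤ l * p l * (d m / m) + m * p m * (d l / l) := by
  wlog hml : m ≤ l generalizing m l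
  · rw [add_comm, add_comm (_ * (d m / m))]
    exact this hl hm (not_le.mp hml).le
  have key : ((p m * d l * m : NNReal) : ℝ) ≤ (p l * d m * l : NNReal) :=
    mul_le_mul_of_poisson_recursion h1 h2 hm hml
  have hm0 : (0 : ℝ) < m := by exact_mod_cast hm
  have hl0 : (0 : ℝ) < l := by exact_mod_cast hl
  have hml' : (m : ℝ) ≤ l := by exact_mod_cast hml
  rw [← NNReal.coe_le_coe]
  push_cast at key ⊢
  have hdiff : (l : ℝ) * p l * (d m / m) + m * p m * (d l / l) - (p l * d m + p m * d l) =
      (l - m) * (p l * d m * l - p m * d l * m) / (l * m) := by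
    field_simp
    ring
  have : (0 : ℝ) ≤ (l - m) * (p l * d m * l - p m * d l * m) / (l * m) := by
    have h3 := sub_nonneg.mpr hml'
    have h4 := sub_nonneg.mpr key
    positivity
  linarith

/-- Chebyshev's sum inequality in the form used for the detection rate. With `p m = P(N = m)` and
`d m = E[D; N = m]`, the hypotheses make `d m / (m * p m)`, the expected fraction given `N = m`,
antitone in `m`; the conclusion compares `E[D] / E[N]` with the expected fraction. -/
lemma tsum_mul_tsum_le_of_poisson_recursion (h1 : ∀ m : ℕ, (m + 1) * p (m + 1) = c * p m)
    (h2 : ∀ m : ℕ, m * d (m + 1) ≤ c * d m) :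
    (∑' l : ℕ, (p (l + 1) : ENNReal)) * ∑' m : ℕ, (d (m + 1) : ENNReal) ≤
      (∑' l : ℕ, ((l + 1 : ℕ) * p (l + 1) : ENNReal)) *
        ∑' m : ℕ, (d (m + 1) : ENNReal) / (m + 1 : ℕ) := by
  have hx : (∑' l : ℕ, (p (l + 1) : ENNReal)) * ∑' m : ℕ, (d (m + 1) : ENNReal) =
      ∑' l : ℕ, ∑' m : ℕ, (p (l + 1) * d (m + 1) : ENNReal) := by
    simp_rw [ENNReal.tsum_mul_left, ENNReal.tsum_mul_right]
  have hy : (∑' l : ℕ, ((l + 1 : ℕ) * p (l + 1) : ENNReal)) *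
        ∑' m : ℕ, (d (m + 1) : ENNReal) / (m + 1 : ℕ) =
      ∑' l : ℕ, ∑' m : ℕ, ((l + 1 : ℕ) * p (l + 1) * (d (m + 1) / (m + 1 : ℕ)) : ENNReal) := by
    simp_rw [ENNReal.tsum_mul_left, ENNReal.tsum_mul_right]
  rw [hx, hy]
  by_contra hlt
  rw [not_le] at hlt
  refine absurd (ENNReal.add_lt_add hlt hlt) (not_lt.mpr ?_)
  nth_rw 2 [ENNReal.tsum_comm]
  nth_rw 4 [ENNReal.tsum_comm]
  rw [← ENNReal.tsum_add, ← ENNReal.tsum_add]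
  refine ENNReal.tsum_le_tsum fun l => ?_
  rw [← ENNReal.tsum_add, ← ENNReal.tsum_add]
  refine ENNReal.tsum_le_tsum fun m => ?_
  have hpair := add_le_add_of_poisson_recursion h1 h2 (m := m + 1) (l := l + 1) (by omega)
    (by omega)
  have hdiv : ∀ (x : NNReal) (k : ℕ), (x : ENNReal) / (k + 1 : ℕ) =
      ((x / (k + 1 : ℕ) : NNReal) : ENNReal) := fun x k => by
    rw [ENNReal.coe_div (by exact_mod_cast Nat.succ_ne_zero k), ENNReal.coe_natCast]
  rw [hdiv, hdiv]
  exact_mod_cast hpair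

end chebyshev

lemma setLIntegral_eq_tsum_succ {Ω : Type*} [MeasurableSpace Ω] {P : Measure Ω}
    {N : Ω → ℕ} (hN : Measurable N) (f : Ω → ENNReal) :
    ∫⁻ ω in {ω | 1 ≤ N ω}, f ω ∂P = ∑' m : ℕ, ∫⁻ ω in {ω | N ω = m + 1}, f ω ∂P := by
  have : {ω | 1 ≤ N ω} = ⋃ m : ℕ, {ω | N ω = m + 1} := by
    ext ω
    simp only [mem_ofPred_eq, mem_iUnion]
    exact ⟨fun h => ⟨N ω - 1, by omega⟩, fun ⟨m, h⟩ => by omega⟩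
  rw [this, lintegral_iUnion (s := fun m => {ω | N ω = m + 1})
    (fun m => hN (measurableSet_singleton (m + 1)))]
  intro i j hij
  refine disjoint_left.mpr fun ω h1 h2 => hij ?_
  simp only [mem_ofPred_eq] at h1 h2
  omega

variable {Ω E : Type*} [MeasurableSpace Ω] [MeasurableSpace E] {P : Measure Ω}
  [IsProbabilityMeasure P] {I : Measure ℝ} [IsFiniteMeasure I] [NullSingletonClass I] {τ : ℝ}
  {A : Ω → ℕ → ℝ} {ν : Measure E} [IsProbabilityMeasure ν] {W : Ω → ℕ → E}
  {n : ℕ} {α : ℕ → ℝ → ℝ} {sc : E → ℝ} {lab : E → Bool}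

/-- The number of frauds is Poisson distributed; this is the recursion for its probabilities. -/
lemma IsMarkedPoisson.mul_measure_numFrauds (hτ : 0 < τ) (h : IsMarkedPoisson P I τ ν A W)
    (hI : I (Ioc 0 τ)ᶜ = 0) (hlab : Measurable lab) (m : ℕ) :
    ((m + 1 : ℕ) : ENNReal) * P {ω | numFrauds τ (A ω) (fun i => lab (W ω i)) = m + 1} =
      ν {z | lab z = true} * I univ *
        P {ω | numFrauds τ (A ω) (fun i => lab (W ω i)) = m} := by
  classical
  have hNm := measurable_numFrauds (τ := τ) h.arrivals.measurable (hlab.comp_seq h.measurable_marks)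
  have hset : ∀ k, MeasurableSet {ω | numFrauds τ (A ω) (fun i => lab (W ω i)) = k} :=
    fun k => hNm (measurableSet_singleton k)
  have hlset : MeasurableSet {z | lab z = true} := hlab (measurableSet_singleton true)
  have key := h.mecke hτ hI (g := fun i a w =>
      if lab (w i) = true ∧ numFrauds τ a (fun i => lab (w i)) = m + 1 then 1 else 0) (fun i => by
    refine Measurable.ite (MeasurableSet.inter ?_ ?_) measurable_const measurable_const
    · exact (hlab.comp ((measurable_pi_apply i).comp measurable_snd)) (measurableSet_singleton true)
    · exact (measurable_numFrauds measurable_fst (hlab.comp_seq measurable_snd))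
        (measurableSet_singleton (m + 1)))
  calc _ = ∫⁻ ω, ∑' i, (if A ω i ≤ τ then (if lab (W ω i) = true ∧
        numFrauds τ (A ω) (fun i => lab (W ω i)) = m + 1 then 1 else 0) else 0) ∂P := by
        rw [← lintegral_indicator_const (hset (m + 1))]
        refine lintegral_congr fun ω => ?_
        rw [indicator_setOf_eq_ite]
        have hf := (h.arrivals.isArrivalSeq ω).finite le_rfl
        split_ifs with hω
        · rw [← hω, natCast_numFrauds hf]
          refine tsum_congr fun i => ?_
          simp only [hω, and_true, ite_and]
        · simp [hω]
    _ = _ := by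
        rw [key]
        have hinner : ∀ t ∈ Ioc 0 τ, ∫⁻ z, ∫⁻ ω, (if lab (insAt (numArrivals (A ω) t) z (W ω)
              (numArrivals (A ω) t)) = true ∧ numFrauds τ (insAt (numArrivals (A ω) t) t (A ω))
              (fun i => lab (insAt (numArrivals (A ω) t) z (W ω) i)) = m + 1 then 1 else 0) ∂P ∂ν =
            ν {z | lab z = true} * P {ω | numFrauds τ (A ω) (fun i => lab (W ω i)) = m} := by
          intro t ht
          rw [mul_comm, ← lintegral_indicator_const hlset]
          refine lintegral_congr fun z => ?_
          rw [indicator_setOf_eq_ite]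
          split_ifs with hz
          · rw [← lintegral_indicator_one (hset m)]
            refine lintegral_congr fun ω => ?_
            rw [indicator_setOf_eq_ite, insAt_comp lab, insAt_self,
              numFrauds_insAt (h.arrivals.isArrivalSeq ω) ht.1 ht.2 hz]
            simp only [hz, true_and, add_left_inj, Pi.one_apply]
          · simp [insAt_self, hz]
        rw [lintegral_congr_ae (g := fun _ => ν {z | lab z = true} *
          P {ω | numFrauds τ (A ω) (fun i => lab (W ω i)) = m}), lintegral_const]
        · ring
        · have : ∀ᵐ t ∂I, t ∈ Ioc 0 τ := by rw [ae_iff]; exact hI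
          filter_upwards [this] with t ht using hinner t ht

/-- An additional fraud uses up inspections and so cannot help to detect the others. -/
lemma IsMarkedPoisson.mul_lintegral_numDetected_le (hτ : 0 < τ) (h : IsMarkedPoisson P I τ ν A W)
    (hI : I (Ioc 0 τ)ᶜ = 0) (hα : ∀ b, Measurable (α b)) (hsc : Measurable sc)
    (hlab : Measurable lab)
    (hanti : ∀ b b', 1 ≤ b' → b' ≤ b → b ≤ n → ∀ t ∈ Icc 0 τ, α b t ≤ α b' t) (m : ℕ) :
    (m : ENNReal) * ∫⁻ ω in {ω | numFrauds τ (A ω) (fun i => lab (W ω i)) = m + 1},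
        (numDetected n α τ (A ω) (fun i => sc (W ω i)) (fun i => lab (W ω i)) : ENNReal) ∂P ≤
      ν {z | lab z = true} * I univ *
        ∫⁻ ω in {ω | numFrauds τ (A ω) (fun i => lab (W ω i)) = m},
          (numDetected n α τ (A ω) (fun i => sc (W ω i)) (fun i => lab (W ω i)) : ENNReal) ∂P := by
  classical
  have hAm := h.arrivals.measurable
  have hWm := h.measurable_marks
  have hNm := measurable_numFrauds (τ := τ) hAm (hlab.comp_seq hWm)
  have hDm : Measurable fun ω => (numDetected n α τ (A ω) (fun i => sc (W ω i))
      (fun i => lab (W ω i)) : ENNReal) :=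
    (measurable_of_countable (fun k : ℕ => (k : ENNReal))).comp
      (measurable_numDetected (n := n) (τ := τ) hα hAm (hsc.comp_seq hWm) (hlab.comp_seq hWm))
  have hset : ∀ k, MeasurableSet {ω | numFrauds τ (A ω) (fun i => lab (W ω i)) = k} :=
    fun k => hNm (measurableSet_singleton k)
  have hlset : MeasurableSet {z | lab z = true} := hlab (measurableSet_singleton true)
  have key := h.mecke hτ hI (g := fun i a w =>
      if lab (w i) = true ∧ numFrauds τ a (fun i => lab (w i)) = m + 1 then
        ∑' j, (if Selected n α τ a (fun i => sc (w i)) (skipAt i j) ∧ lab (w (skipAt i j)) = true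
          then 1 else 0 : ENNReal) else 0) (fun i => by
    refine Measurable.ite (MeasurableSet.inter ?_ ?_) ?_ measurable_const
    · exact (hlab.comp ((measurable_pi_apply i).comp measurable_snd)) (measurableSet_singleton true)
    · exact (measurable_numFrauds measurable_fst (hlab.comp_seq measurable_snd))
        (measurableSet_singleton (m + 1))
    · refine Measurable.tsum fun j => Measurable.ite (MeasurableSet.inter ?_ ?_) measurable_const
        measurable_const
      · exact measurableSet_selected hα measurable_fst (hsc.comp_seq measurable_snd) _
      · exact (hlab.comp ((measurable_pi_apply _).comp measurable_snd))
          (measurableSet_singleton true))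
  calc _ = ∫⁻ ω, ∑' i, (if A ω i ≤ τ then (if lab (W ω i) = true ∧
        numFrauds τ (A ω) (fun i => lab (W ω i)) = m + 1 then
          ∑' j, (if Selected n α τ (A ω) (fun i => sc (W ω i)) (skipAt i j) ∧
            lab (W ω (skipAt i j)) = true then 1 else 0 : ENNReal) else 0) else 0) ∂P := by
        rw [← lintegral_const_mul _ hDm, ← lintegral_indicator (hset (m + 1))]
        refine lintegral_congr fun ω => ?_
        rw [indicator_setOf_eq_ite]
        have hf := (h.arrivals.isArrivalSeq ω).finite le_rfl
        split_ifs with hω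
        · rw [← tsum_tsum_detected hf hω]
          refine tsum_congr fun i => ?_
          simp only [hω, and_true, ite_and]
        · simp [hω]
    _ ≤ ∫⁻ t, ∫⁻ z, {z | lab z = true}.indicator (fun _ =>
          ∫⁻ ω in {ω | numFrauds τ (A ω) (fun i => lab (W ω i)) = m},
          (numDetected n α τ (A ω) (fun i => sc (W ω i)) (fun i => lab (W ω i)) : ENNReal) ∂P) z
          ∂ν ∂I := by
        rw [key]
        have hae : ∀ᵐ t ∂I, t ∈ Ioc 0 τ := by rw [ae_iff]; exact hI
        refine lintegral_mono_ae ?_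
        filter_upwards [hae] with t ht
        refine lintegral_mono fun z => ?_
        rw [indicator_setOf_eq_ite]
        split_ifs with hz
        · rw [← lintegral_indicator (hset m)]
          refine lintegral_mono fun ω => ?_
          have hs := h.arrivals.isArrivalSeq ω
          rw [indicator_setOf_eq_ite, insAt_comp lab, insAt_comp sc, insAt_self,
            numFrauds_insAt hs ht.1 ht.2 hz]
          simp only [hz, true_and, add_left_inj]
          split_ifs with hω
          · rw [natCast_numDetected (hs.finite le_rfl)]
            refine ENNReal.tsum_le_tsum fun j => ?_
            rw [insAt_skipAt]
            split_ifs with h1 h2 h2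
            · exact le_rfl
            · exact absurd ⟨selected_of_selected_insAt hanti hs.pos _ _ _ _ h1.1, h1.2⟩ h2
            · exact zero_le
            · exact le_rfl
          · exact le_rfl
        · simp [insAt_self, hz]
    _ = _ := by
        simp_rw [lintegral_indicator_const hlset]
        rw [lintegral_const]
        ring

/-- Comparison of the expected fraction of detected frauds with `E[D] / E[N]`, where `N` is the
number of frauds and `D` the number of detected frauds. -/
theorem IsMarkedPoisson.measure_mul_lintegral_numDetected_le (hτ : 0 < τ)
    (h : IsMarkedPoisson P I τ ν A W)
    (hI : I (Ioc 0 τ)ᶜ = 0) (hα : ∀ b, Measurable (α b)) (hsc : Measurable sc)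
    (hlab : Measurable lab)
    (hanti : ∀ b b', 1 ≤ b' → b' ≤ b → b ≤ n → ∀ t ∈ Icc 0 τ, α b t ≤ α b' t)
    {N D : Ω → ℕ} (hN : N = fun ω => numFrauds τ (A ω) (fun i => lab (W ω i)))
    (hD : D = fun ω => numDetected n α τ (A ω) (fun i => sc (W ω i)) (fun i => lab (W ω i))) :
    P {ω | 1 ≤ N ω} * ∫⁻ ω, (D ω : ENNReal) ∂P ≤
      ν {z | lab z = true} * I univ * ∫⁻ ω in {ω | 1 ≤ N ω}, (D ω / N ω : ENNReal) ∂P := by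
  have hlm := hlab.comp_seq h.measurable_marks
  have hsm := hsc.comp_seq h.measurable_marks
  have hNm : Measurable N := hN ▸ measurable_numFrauds h.arrivals.measurable hlm
  have hDm : Measurable fun ω => (D ω : ENNReal) :=
    (measurable_of_countable (fun k : ℕ => (k : ENNReal))).comp
      (hD ▸ measurable_numDetected hα h.arrivals.measurable hsm hlm)
  have hf := fun ω => (h.arrivals.isArrivalSeq ω).finite le_rfl
  have h1 := fun m => h.mul_measure_numFrauds hτ hI hlab m
  have h2 := fun m => h.mul_lintegral_numDetected_le hτ hI hα hsc hlab hanti m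
  have hDN : ∀ ω, D ω ≤ N ω := fun ω => by rw [hN, hD]; exact numDetected_le_numFrauds (hf ω)
  have hDn : ∀ ω, D ω ≤ n := fun ω => by rw [hD]; exact numDetected_le (hf ω)
  have e1 : ∀ k, {ω | numFrauds τ (A ω) (fun i => lab (W ω i)) = k} = {ω | N ω = k} :=
    fun k => by rw [hN]
  have e2 : ∀ ω, (numDetected n α τ (A ω) (fun i => sc (W ω i)) (fun i => lab (W ω i)) : ENNReal) =
    D ω := fun ω => by rw [hD]
  simp only [e1, e2] at h1 h2
  have hset : ∀ k, MeasurableSet {ω | N ω = k} := fun k => hNm (measurableSet_singleton k)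
  set c : ENNReal := ν {z | lab z = true} * I univ with hc
  have hctop : c ≠ ⊤ := ENNReal.mul_ne_top (measure_ne_top _ _) (measure_ne_top _ _)
  set p : ℕ → ENNReal := fun m => P {ω | N ω = m} with hp
  set d : ℕ → ENNReal := fun m => ∫⁻ ω in {ω | N ω = m}, (D ω : ENNReal) ∂P with hd
  have hptop : ∀ m, p m ≠ ⊤ := fun m => measure_ne_top _ _
  have hdtop : ∀ m, d m ≠ ⊤ := fun m => by
    refine ne_top_of_le_ne_top ?_ (lintegral_mono (g := fun _ => (n : ENNReal)) fun ω => ?_)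
    · rw [lintegral_const]
      exact ENNReal.mul_ne_top (ENNReal.natCast_ne_top n) (measure_ne_top _ _)
    · exact Nat.cast_le.mpr (hDn ω)
  have key := tsum_mul_tsum_le_of_poisson_recursion (p := fun m => (p m).toNNReal)
    (d := fun m => (d m).toNNReal) (c := c.toNNReal)
    (fun m => by
      rw [← ENNReal.coe_inj]
      push_cast
      rw [ENNReal.coe_toNNReal (hptop _), ENNReal.coe_toNNReal (hptop _),
        ENNReal.coe_toNNReal hctop]
      exact_mod_cast h1 m)
    (fun m => by
      rw [← ENNReal.coe_le_coe]
      push_cast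
      rw [ENNReal.coe_toNNReal (hdtop _), ENNReal.coe_toNNReal (hdtop _),
        ENNReal.coe_toNNReal hctop]
      exact_mod_cast h2 m)
  simp only [ENNReal.coe_toNNReal (hptop _), ENNReal.coe_toNNReal (hdtop _)] at key
  have hP : P {ω | 1 ≤ N ω} = ∑' l : ℕ, p (l + 1) := by
    have := setLIntegral_eq_tsum_succ (P := P) hNm (fun _ => 1)
    simpa only [lintegral_one, Measure.restrict_apply_univ] using this
  have hED : ∫⁻ ω, (D ω : ENNReal) ∂P = ∑' m : ℕ, d (m + 1) := by
    rw [← setLIntegral_eq_tsum_succ hNm, ← lintegral_indicator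
      (measurableSet_le measurable_const hNm)]
    refine lintegral_congr fun ω => ?_
    by_cases h0 : 1 ≤ N ω
    · rw [indicator_of_mem (show ω ∈ {ω | 1 ≤ N ω} from h0)]
    · rw [indicator_of_notMem (show ω ∉ {ω | 1 ≤ N ω} from h0)]
      have := hDN ω
      rw [show D ω = 0 by omega, Nat.cast_zero]
  have hratio : ∫⁻ ω in {ω | 1 ≤ N ω}, (D ω / N ω : ENNReal) ∂P =
      ∑' m : ℕ, d (m + 1) / (m + 1 : ℕ) := by
    rw [setLIntegral_eq_tsum_succ hNm]
    refine tsum_congr fun m => ?_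
    rw [hd]
    dsimp only
    rw [div_eq_mul_inv, ← lintegral_mul_const _ hDm]
    refine setLIntegral_congr_fun (hset _) fun ω hω => ?_
    simp only [mem_ofPred_eq] at hω
    simp only [hω, div_eq_mul_inv]
  have hmean : ∑' l : ℕ, ((l + 1 : ℕ) * p (l + 1) : ENNReal) = c := by
    simp_rw [hp, h1, ENNReal.tsum_mul_left]
    have : ∑' m : ℕ, P {ω | N ω = m} = 1 := by
      rw [← measure_iUnion
        (fun i j hij => disjoint_left.mpr fun ω a b => hij (a.symm.trans b)) hset,
        ← measure_univ (μ := P)]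
      congr 1
      ext ω
      simp
    rw [this, mul_one]
  rwa [hmean, ← hP, ← hED, ← hratio] at key

/-- The expected number of detected frauds, through the tail ratio `q` at the inspection times. -/
lemma IsMarkedPoisson.lintegral_numDetected (hτ : 0 < τ) (h : IsMarkedPoisson P I τ ν A W)
    (hI : I (Ioc 0 τ)ᶜ = 0) (hα : ∀ b, Measurable (α b)) (hsc : Measurable sc)
    (hlab : Measurable lab) {q : ℕ → ℝ → ENNReal} (hq : ∀ b, Measurable (q b))
    (hqν : ∀ b t, ν {z | α b t < sc z ∧ lab z = true} =
      ν {z | lab z = true} * (q b t * ν {z | α b t < sc z}))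
    {M : Ω → ℕ} (hM : M = fun ω => numInspections n α τ (A ω) (fun i => sc (W ω i)))
    {γ : ℕ → Ω → ℝ} (hγ : γ = fun j ω => inspectionTime n α τ (A ω) (fun i => sc (W ω i)) j)
    {D : Ω → ℕ}
    (hD : D = fun ω => numDetected n α τ (A ω) (fun i => sc (W ω i)) (fun i => lab (W ω i))) :
    ∫⁻ ω, (D ω : ENNReal) ∂P = ν {z | lab z = true} *
      ∑ j ∈ Finset.range n, ∫⁻ ω in {ω | j + 1 ≤ M ω}, q (n - j) (γ (j + 1) ω) ∂P := by
  classical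
  have hWs : Measurable fun ω => fun i => sc (W ω i) :=
    measurable_pi_lambda _ fun i => hsc.comp ((measurable_pi_apply i).comp h.measurable_marks)
  have hAm := h.arrivals.measurable
  have hMm : Measurable M := hM ▸ measurable_numInspections hα hAm hWs
  have hcm : ∀ i, Measurable fun ω => selCount n α τ (A ω) (fun i => sc (W ω i)) i :=
    measurable_selCount hα hAm hWs
  have hsel : ∀ i, MeasurableSet {ω | Selected n α τ (A ω) (fun i => sc (W ω i)) i} :=
    measurableSet_selected hα hAm hWs
  have hlset : MeasurableSet {z | lab z = true} := hlab (measurableSet_singleton true)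
  have hf := fun ω => (h.arrivals.isArrivalSeq ω).finite le_rfl
  have hstep : ∀ j ∈ Finset.range n, ∫⁻ ω, ∑' i, (if Selected n α τ (A ω) (fun i => sc (W ω i)) i ∧
        selCount n α τ (A ω) (fun i => sc (W ω i)) i = j then
          {z | lab z = true}.indicator 1 (W ω i) else 0) ∂P = ν {z | lab z = true} *
        ∫⁻ ω in {ω | j + 1 ≤ M ω}, q (n - j) (γ (j + 1) ω) ∂P := by
    intro j hj
    have hj := Finset.mem_range.mp hj
    have k1 := h.lintegral_selected_mark hτ hI hα hsc hj
      (v := fun _ z => {z | lab z = true}.indicator 1 z)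
      ((measurable_one.indicator hlset).comp measurable_snd)
    have k2 := h.lintegral_selected_mark hτ hI hα hsc hj (v := fun t _ => q (n - j) t)
      ((hq _).comp measurable_fst)
    have hL : ∀ ω, ∑' i, (if Selected n α τ (A ω) (fun i => sc (W ω i)) i ∧
        selCount n α τ (A ω) (fun i => sc (W ω i)) i = j then q (n - j) (A ω i) else 0) =
        {ω | j + 1 ≤ M ω}.indicator (fun ω => q (n - j) (γ (j + 1) ω)) ω := by
      intro ω
      have := tsum_ite_selected (n := n) (α := α) (s := fun i => sc (W ω i)) (hf ω) j True
        (q (n - j))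
      simp only [and_true] at this
      rw [this, hM, hγ, indicator_setOf_eq_ite]
    simp_rw [hL] at k2
    rw [lintegral_indicator (measurableSet_le measurable_const hMm)] at k2
    rw [k1, k2, ← lintegral_const_mul' _ _ (measure_ne_top _ _)]
    refine lintegral_congr fun t => ?_
    rw [← mul_assoc]
    congr 1
    rw [lintegral_indicator_one hlset, Measure.restrict_apply hlset, setLIntegral_const,
      ← hqν, inter_comm]
    rfl
  rw [Finset.mul_sum, ← Finset.sum_congr rfl hstep, ← lintegral_finsetSum]
  · refine lintegral_congr fun ω => ?_
    rw [hD, natCast_numDetected (hf ω), ← Summable.tsum_finsetSum fun _ _ => ENNReal.summable]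
    refine tsum_congr fun i => ?_
    by_cases hi : Selected n α τ (A ω) (fun i => sc (W ω i)) i
    · have hlt : selCount n α τ (A ω) (fun i => sc (W ω i)) i ∈ Finset.range n := by
        have h1 := budget_add_selCount (n := n) (α := α) (τ := τ) (a := A ω)
          (s := fun i => sc (W ω i)) i
        have h2 := hi.2.1
        rw [Finset.mem_range]
        omega
      simp only [hi, true_and]
      rw [Finset.sum_ite_eq, if_pos hlt, indicator_setOf_eq_ite]
      rfl
    · simp [hi]
  · intro j _
    refine Measurable.tsum fun i => Measurable.ite ((hsel i).inter
      (hcm i (measurableSet_singleton j))) ?_ measurable_const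
    exact (measurable_one.indicator hlset).comp
      ((measurable_pi_apply i).comp h.measurable_marks)

/-- Lower bound for the expected fraction of detected frauds through the tail ratio `q` at the
inspection times. -/
theorem IsMarkedPoisson.measure_mul_sum_le (hτ : 0 < τ) (h : IsMarkedPoisson P I τ ν A W)
    (hI : I (Ioc 0 τ)ᶜ = 0) (hα : ∀ b, Measurable (α b)) (hsc : Measurable sc)
    (hlab : Measurable lab) (hν : ν {z | lab z = true} ≠ 0)
    (hanti : ∀ b b', 1 ≤ b' → b' ≤ b → b ≤ n → ∀ t ∈ Icc 0 τ, α b t ≤ α b' t)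
    {q : ℕ → ℝ → ENNReal} (hq : ∀ b, Measurable (q b))
    (hqν : ∀ b t, ν {z | α b t < sc z ∧ lab z = true} =
      ν {z | lab z = true} * (q b t * ν {z | α b t < sc z}))
    {M : Ω → ℕ} (hM : M = fun ω => numInspections n α τ (A ω) (fun i => sc (W ω i)))
    {γ : ℕ → Ω → ℝ} (hγ : γ = fun j ω => inspectionTime n α τ (A ω) (fun i => sc (W ω i)) j)
    {N D : Ω → ℕ} (hN : N = fun ω => numFrauds τ (A ω) (fun i => lab (W ω i)))
    (hD : D = fun ω => numDetected n α τ (A ω) (fun i => sc (W ω i)) (fun i => lab (W ω i))) :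
    P {ω | 1 ≤ N ω} *
        ∑ j ∈ Finset.range n, ∫⁻ ω in {ω | j + 1 ≤ M ω}, q (n - j) (γ (j + 1) ω) ∂P ≤
      I univ * ∫⁻ ω in {ω | 1 ≤ N ω}, (D ω / N ω : ENNReal) ∂P := by
  have key := h.measure_mul_lintegral_numDetected_le hτ hI hα hsc hlab hanti hN hD
  rw [h.lintegral_numDetected hτ hI hα hsc hlab hq hqν hM hγ hD, mul_left_comm, mul_assoc] at key
  exact (ENNReal.mul_le_mul_iff_right hν (measure_ne_top _ _)).mp key

lemma IsMarkedPoisson.measure_one_le_numFrauds_ne_zero (hτ : 0 < τ)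
    (h : IsMarkedPoisson P I τ ν A W) (hI : I (Ioc 0 τ)ᶜ = 0) (hI0 : I univ ≠ 0)
    (hlab : Measurable lab) (hν : ν {z | lab z = true} ≠ 0) :
    P {ω | 1 ≤ numFrauds τ (A ω) (fun i => lab (W ω i))} ≠ 0 := by
  intro h0
  have h1 : P {ω | numFrauds τ (A ω) (fun i => lab (W ω i)) = 0 + 1} = 0 :=
    measure_mono_null (fun ω hω => by simp only [mem_ofPred_eq] at hω ⊢; omega) h0
  have h2 := h.mul_measure_numFrauds hτ hI hlab 0
  rw [h1, mul_zero] at h2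
  have h3 : P {ω | numFrauds τ (A ω) (fun i => lab (W ω i)) = 0} = 0 :=
    (mul_eq_zero.mp h2.symm).resolve_left (mul_ne_zero hν hI0)
  have h4 : P univ ≤ 0 := by
    rw [← add_zero (0 : ENNReal), ← h0]
    nth_rw 1 [h0]
    rw [← h3]
    refine (measure_mono fun ω _ => ?_).trans (measure_union_le _ _)
    simp only [mem_union, mem_ofPred_eq]
    omega
  simp at h4

end frauds

/-! ### Monotonicity of the critical curves -/

section curves

lemma excess_nonneg (μ : Measure ℝ) (a : ℝ) : 0 ≤ excess μ a :=
  setIntegral_nonneg measurableSet_Ioi fun _ hs => sub_nonneg.mpr (le_of_lt hs)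

lemma antitone_excess {μ : Measure ℝ} [IsFiniteMeasure μ] (hμ : Integrable (fun s => s) μ) :
    Antitone (excess μ) := by
  intro a b hab
  have hint : ∀ c, IntegrableOn (fun s => s - c) (Ioi c) μ := fun c =>
    (hμ.sub (integrable_const c)).integrableOn
  unfold excess
  rw [← integral_indicator measurableSet_Ioi, ← integral_indicator measurableSet_Ioi]
  refine integral_mono ((hint b).integrable_indicator measurableSet_Ioi)
    ((hint a).integrable_indicator measurableSet_Ioi) fun s => ?_
  by_cases hb : b < s
  · rw [indicator_of_mem (mem_Ioi.mpr hb), indicator_of_mem (mem_Ioi.mpr (hab.trans_lt hb))]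
    linarith
  · rw [indicator_of_notMem (by simpa using hb)]
    exact indicator_nonneg (fun x hx => sub_nonneg.mpr (le_of_lt hx)) s

/-- A function that vanishes at `τ`, and that does not decrease while it is positive, is never
positive before `τ`. -/
lemma nonpos_of_deriv_nonneg_of_pos {w w' : ℝ → ℝ} {τ : ℝ}
    (hw : ∀ t ∈ Icc 0 τ, HasDerivWithinAt w (w' t) (Icc 0 τ) t)
    (hw' : ∀ t ∈ Icc 0 τ, 0 < w t → 0 ≤ w' t) (hτ : w τ = 0) {t : ℝ} (ht : t ∈ Icc 0 τ) :
    w t ≤ 0 := by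
  by_contra hpos
  rw [not_le] at hpos
  have hcont : ContinuousOn w (Icc 0 τ) := fun x hx => (hw x hx).continuousWithinAt
  have hsub : Icc t τ ⊆ Icc 0 τ := Icc_subset_Icc_left ht.1
  -- the first time after `t` at which `w` is not positive
  obtain ⟨s, ⟨hs, hs0⟩, hmin⟩ : ∃ s, IsLeast (Icc t τ ∩ w ⁻¹' Iic 0) s := by
    refine IsCompact.exists_isLeast (isCompact_Icc.of_isClosed_subset
      ((hcont.mono hsub).preimage_isClosed_of_isClosed isClosed_Icc isClosed_Iic)
      inter_subset_left) ⟨τ, ⟨ht.2, le_rfl⟩, ?_⟩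
    simp [hτ]
  have hsub' : Icc t s ⊆ Icc 0 τ := (Icc_subset_Icc_right hs.2).trans hsub
  have hmono : MonotoneOn w (Icc t s) := by
    refine monotoneOn_of_deriv_nonneg (convex_Icc t s) (hcont.mono hsub') ?_ ?_
    all_goals
      rw [interior_Icc]
      intro x hx
      have hx0 : x ∈ Icc 0 τ := hsub' (Ioo_subset_Icc_self hx)
      have hd : HasDerivAt w (w' x) x := (hw x hx0).hasDerivAt
        (Icc_mem_nhds (ht.1.trans_lt hx.1) (hx.2.trans_le hs.2))
    · exact hd.differentiableAt.differentiableWithinAt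
    · rw [hd.deriv]
      refine hw' x hx0 ?_
      by_contra hx1
      exact absurd (hmin ⟨⟨hx.1.le, hx.2.le.trans hs.2⟩, not_lt.mp hx1⟩) (not_le.mpr hx.2)
  have := hmono ⟨le_rfl, hs.1⟩ ⟨hs.1, le_rfl⟩ hs.1
  exact absurd (this.trans hs0) (not_le.mpr hpos)

variable {μ : Measure ℝ} [IsFiniteMeasure μ] {rate : ℝ → ℝ} {τ : ℝ} {n : ℕ} {α : ℕ → ℝ → ℝ}

lemma IsCriticalCurves.succ_le (hα : IsCriticalCurves μ rate τ n α)
    (hμ : Integrable (fun s => s) μ) (h0 : ∀ t ∈ Icc 0 τ, 0 ≤ rate t) {j : ℕ} (hj : 1 ≤ j)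
    (hjn : j + 1 ≤ n) : ∀ t ∈ Icc 0 τ, α (j + 1) t ≤ α j t := by
  induction j, hj using Nat.le_induction with
  | base =>
    intro t ht
    obtain ⟨e1, d1⟩ := hα 1 le_rfl (by omega)
    obtain ⟨e2, d2⟩ := hα 2 (by omega) hjn
    refine sub_nonpos.mp (nonpos_of_deriv_nonneg_of_pos (w := fun t => α 2 t - α 1 t)
      (fun t ht => (d2 t ht).sub (d1 t ht)) (fun t ht hw => ?_) (by simp [e1, e2]) ht)
    have h1 := antitone_excess hμ (sub_pos.mp hw).le
    have h2 := excess_nonneg μ (α 1 t)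
    have h3 := h0 t ht
    norm_num
    nlinarith [mul_nonneg h3 h2, mul_nonneg h3 (sub_nonneg.mpr h1)]
  | succ j hj ih =>
    intro t ht
    obtain ⟨e1, d1⟩ := hα (j + 1) (by omega) (by omega)
    obtain ⟨e2, d2⟩ := hα (j + 1 + 1) (by omega) hjn
    refine sub_nonpos.mp (nonpos_of_deriv_nonneg_of_pos
      (w := fun t => α (j + 1 + 1) t - α (j + 1) t)
      (fun t ht => (d2 t ht).sub (d1 t ht)) (fun t ht hw => ?_) (by simp [e1, e2]) ht)
    have h1 := antitone_excess hμ (sub_pos.mp hw).le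
    have h2 := antitone_excess hμ (ih (by omega) t ht)
    have h3 := h0 t ht
    rw [if_neg (by omega), if_neg (by omega)]
    simp only [Nat.add_sub_cancel]
    nlinarith [mul_nonneg h3 (sub_nonneg.mpr h2), mul_nonneg h3 (sub_nonneg.mpr h1)]

/-- With more inspections left, the threshold is lower. -/
theorem IsCriticalCurves.anti (hα : IsCriticalCurves μ rate τ n α)
    (hμ : Integrable (fun s => s) μ) (h0 : ∀ t ∈ Icc 0 τ, 0 ≤ rate t) (b b' : ℕ) (hb' : 1 ≤ b')
    (hbb : b' ≤ b) (hbn : b ≤ n) : ∀ t ∈ Icc 0 τ, α b t ≤ α b' t := by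
  induction b, hbb using Nat.le_induction with
  | base => exact fun _ _ => le_rfl
  | succ b hb ih =>
    exact fun t ht => (hα.succ_le hμ h0 (hb'.trans hb) hbn t ht).trans (ih (by omega) t ht)

end curves

/-! ### Truncation of the arrival times and of the threshold curves -/

section truncation

/-- The sequence `a`, with the entries beyond `τ` replaced by `τ + 1`. A sequence that does not
consist of increasing positive times with finitely many of them in `[0, τ]` becomes constant. -/
noncomputable def truncSeq (τ : ℝ) (a : ℕ → ℝ) (i : ℕ) : ℝ :=
  open Classical in
  if ((∀ j, 0 < a j) ∧ (∀ j, a j ≤ a (j + 1)) ∧ ∃ j, τ < a j) ∧ a i ≤ τ then a i else τ + 1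

variable {τ : ℝ} {a : ℕ → ℝ}

lemma isArrivalSeq_truncSeq (hτ : 0 < τ) (a : ℕ → ℝ) : IsArrivalSeq τ (truncSeq τ a) := by
  by_cases h : (∀ j, 0 < a j) ∧ (∀ j, a j ≤ a (j + 1)) ∧ ∃ j, τ < a j
  · have hmono : Monotone a := monotone_nat_of_le_succ h.2.1
    have e : ∀ i, truncSeq τ a i = if a i ≤ τ then a i else τ + 1 := fun i => by
      simp only [truncSeq, h, true_and, and_true, implies_true]
    refine ⟨fun i => ?_, fun i j hij => ?_, ?_, fun i => ?_⟩
    · rw [e]; split_ifs; exacts [h.1 i, by linarith]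
    · rw [e, e]
      have := hmono hij
      split_ifs <;> linarith
    · obtain ⟨j, hj⟩ := h.2.2
      exact ⟨j, by rw [e, if_neg (not_le.mpr hj)]; linarith⟩
    · rw [e]; split_ifs with h1; exacts [Or.inl h1, Or.inr rfl]
  · have e : ∀ i, truncSeq τ a i = τ + 1 := fun i => by
      rw [truncSeq, if_neg fun hc => h hc.1]
    refine ⟨fun i => ?_, fun i j _ => ?_, ⟨0, ?_⟩, fun i => Or.inr (e i)⟩
    · rw [e]; linarith
    · rw [e, e]
    · rw [e]; linarith

lemma truncSeq_eq (h0 : ∀ i, 0 < a i) (hm : Monotone a) (hf : {i | a i ≤ τ}.Finite) (i : ℕ) :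
    truncSeq τ a i = if a i ≤ τ then a i else τ + 1 := by
  have hex : ∃ j, τ < a j := by
    by_contra hcon
    push Not at hcon
    exact infinite_univ (hf.subset fun i _ => hcon i)
  have h : (∀ j, 0 < a j) ∧ (∀ j, a j ≤ a (j + 1)) ∧ ∃ j, τ < a j :=
    ⟨h0, fun j => hm j.le_succ, hex⟩
  rw [truncSeq]
  congr 1
  exact propext ⟨fun x => x.2, fun x => ⟨h, x⟩⟩

lemma measurable_truncSeq (τ : ℝ) : Measurable (truncSeq τ) := by
  have hm : ∀ i, Measurable fun a : ℕ → ℝ => a i := measurable_pi_apply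
  have hset : MeasurableSet {a : ℕ → ℝ |
      (∀ j, 0 < a j) ∧ (∀ j, a j ≤ a (j + 1)) ∧ ∃ j, τ < a j} := by
    simp only [ofPred_and, ofPred_forall, ofPred_exists]
    exact (MeasurableSet.iInter fun j => measurableSet_lt measurable_const (hm j)).inter
      ((MeasurableSet.iInter fun j => measurableSet_le (hm j) (hm (j + 1))).inter
        (MeasurableSet.iUnion fun j => measurableSet_lt measurable_const (hm j)))
  exact measurable_pi_lambda _ fun i => Measurable.ite
    (hset.inter (measurableSet_le (hm i) measurable_const)) (hm i) measurable_const

variable {a' s : ℕ → ℝ} {y : ℕ → Bool} {n : ℕ} {α α' : ℕ → ℝ → ℝ}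

lemma le_iff_of_trunc (h : ∀ i, a' i = if a i ≤ τ then a i else τ + 1) (i : ℕ) {t : ℝ}
    (ht : t ≤ τ) : a' i ≤ t ↔ a i ≤ t := by
  rw [h]
  split_ifs with h1
  · rfl
  · constructor <;> intro h2 <;> linarith

lemma numArrivals_of_trunc (h : ∀ i, a' i = if a i ≤ τ then a i else τ + 1) {t : ℝ}
    (ht : t ≤ τ) : numArrivals a' t = numArrivals a t := by
  simp only [numArrivals, le_iff_of_trunc h _ ht]

lemma numFrauds_of_trunc (h : ∀ i, a' i = if a i ≤ τ then a i else τ + 1) :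
    numFrauds τ a' y = numFrauds τ a y := by
  simp only [numFrauds, le_iff_of_trunc h _ le_rfl]

/-- The selection rule depends only on the arrival times in `[0, τ]` and on the values there of the
threshold curves `1, …, n`. -/
lemma selected_of_trunc (h : ∀ i, a' i = if a i ≤ τ then a i else τ + 1) (h0 : ∀ i, 0 < a i)
    (hα : ∀ b, 1 ≤ b → b ≤ n → ∀ t ∈ Icc 0 τ, α' b t = α b t) :
    Selected n α' τ a' s = Selected n α τ a s := by
  have step : ∀ i, budget n α' τ a' s i = budget n α τ a s i →
      (Selected n α' τ a' s i ↔ Selected n α τ a s i) := by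
    intro i hi
    unfold Selected
    rw [hi, le_iff_of_trunc h i le_rfl]
    refine and_congr_right fun h1 => and_congr_right fun h2 => ?_
    rw [h i, if_pos h1, hα _ h2 (budget_le i) _ ⟨(h0 i).le, h1⟩]
  have hb : ∀ i, budget n α' τ a' s i = budget n α τ a s i := by
    intro i
    induction i with
    | zero => rfl
    | succ i ih =>
      classical
      have h1 := step i ih
      unfold Selected at h1
      rw [budget, budget]
      simp only [h1]
      rw [ih]
  exact funext fun i => propext (step i (hb i))

lemma inspectionTime_of_trunc (h : ∀ i, a' i = if a i ≤ τ then a i else τ + 1)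
    (h0 : ∀ i, 0 < a i) (hf : {i | a i ≤ τ}.Finite)
    (hα : ∀ b, 1 ≤ b → b ≤ n → ∀ t ∈ Icc 0 τ, α' b t = α b t) {j : ℕ}
    (hj : j ≤ numInspections n α τ a s) :
    inspectionTime n α' τ a' s j = inspectionTime n α τ a s j := by
  rcases j with _ | j
  · rfl
  · obtain ⟨i, hi, rfl⟩ := (lt_numInspections_iff hf j).mp hj
    simp only [inspectionTime]
    rw [selected_of_trunc h h0 hα, nth_selected hi, h, if_pos hi.1]

lemma inspectionTime_mem_Icc (h0 : ∀ i, 0 < a i) (hτ : 0 < τ) (hf : {i | a i ≤ τ}.Finite) {j : ℕ}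
    (hj : j ≤ numInspections n α τ a s) : inspectionTime n α τ a s j ∈ Icc 0 τ := by
  rcases j with _ | j
  · exact ⟨le_rfl, hτ.le⟩
  · obtain ⟨i, hi, rfl⟩ := (lt_numInspections_iff hf j).mp hj
    rw [inspectionTime_of_selected hi]
    exact ⟨(h0 i).le, hi.1⟩

lemma waitDensity_eq_zero {m : ℝ → ℝ} {γ t : ℝ} (h : m (γ + t) = 0) : waitDensity m γ t = 0 := by
  rw [waitDensity, h, zero_mul]

lemma iteratedExp_congr {m m' : ℕ → ℝ → ℝ} {f f' : ℝ → ℝ} {n : ℕ}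
    (hm : ∀ i, 1 ≤ i → i ≤ n → m' i = m i) (h0 : ∀ i, ∀ t ∉ Icc 0 τ, m i t = 0)
    (hf : ∀ t ∈ Icc 0 τ, f' t = f t) (r i : ℕ) (hi : 1 ≤ i) (hir : i + r ≤ n + 1) {γ : ℝ}
    (hγ : γ ∈ Icc 0 τ) : iteratedExp m' f' r i γ = iteratedExp m f r i γ := by
  induction r generalizing i γ with
  | zero => exact hf γ hγ
  | succ r ih =>
    simp only [iteratedExp]
    congr 1
    ext t
    rw [hm i hi (by omega)]
    by_cases ht : γ + t ∈ Icc 0 τ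
    · rw [ih (i + 1) (by omega) (by omega) ht]
    · rw [waitDensity_eq_zero (h0 i _ ht), zero_mul, zero_mul]

end truncation

/-- The conditional expectation in `detectionRate` as a Lebesgue integral. -/
lemma integral_cond_natCast_div {Ω : Type*} [MeasurableSpace Ω] {P : Measure Ω} {N D : Ω → ℕ}
    (hN : Measurable N) (hD : Measurable D) :
    ∫ ω, (D ω : ℝ) / (N ω : ℝ) ∂(ProbabilityTheory.cond P {ω | 1 ≤ N ω}) =
      (P {ω | 1 ≤ N ω}).toReal⁻¹ * (∫⁻ ω in {ω | 1 ≤ N ω}, (D ω / N ω : ENNReal) ∂P).toReal := by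
  have hDN : Measurable fun ω => (D ω : ℝ) / (N ω : ℝ) :=
    ((measurable_of_countable fun k : ℕ => (k : ℝ)).comp hD).div
      ((measurable_of_countable fun k : ℕ => (k : ℝ)).comp hN)
  rw [ProbabilityTheory.cond, integral_smul_measure, ENNReal.toReal_inv, smul_eq_mul,
    integral_eq_lintegral_of_nonneg_ae (Filter.Eventually.of_forall fun ω => by positivity)
      hDN.aestronglyMeasurable]
  congr 2
  refine setLIntegral_congr_fun (measurableSet_le measurable_const hN) fun ω hω => ?_
  have hpos : (0 : ℝ) < N ω := by exact_mod_cast (show 0 < N ω from hω)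
  simp only [ENNReal.ofReal_div_of_pos hpos, ENNReal.ofReal_natCast]

/-! ### The given model as a marked Poisson process -/

section model

lemma measurable_indicator_of_continuousOn {f : ℝ → ℝ} {S : Set ℝ} (hS : MeasurableSet S)
    (hf : ContinuousOn f S) : Measurable (S.indicator f) := by
  classical
  rw [← piecewise_eq_indicator]
  exact hf.measurable_piecewise continuousOn_const hS

variable {rate : ℝ → ℝ} {τ : ℝ}

lemma arrivalIntensity_Ioc (hrate : ContinuousOn rate (Icc 0 τ))
    (h0 : ∀ t ∈ Icc 0 τ, 0 ≤ rate t) {s t : ℝ} (hs : 0 ≤ s) (hst : s ≤ t) (ht : t ≤ τ) :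
    arrivalIntensity ((Icc 0 τ).indicator rate) τ (Ioc s t) =
      ENNReal.ofReal (cumRate rate t - cumRate rate s) := by
  have hsub : Ioc s t ⊆ Ioc 0 τ := Ioc_subset_Ioc hs ht
  have hsub' : Icc s t ⊆ Icc 0 τ := Icc_subset_Icc hs ht
  have hint : ∀ x y : ℝ, 0 ≤ x → x ≤ y → y ≤ τ → IntervalIntegrable rate volume x y :=
    fun x y hx hxy hy => (hrate.mono (Icc_subset_Icc hx hy)).intervalIntegrable_of_Icc hxy
  rw [arrivalIntensity, withDensity_apply _ measurableSet_Ioc,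
    Measure.restrict_restrict measurableSet_Ioc, inter_eq_left.mpr hsub, cumRate, cumRate,
    intervalIntegral.integral_interval_sub_left (hint 0 t le_rfl (hs.trans hst) ht)
      (hint 0 s le_rfl hs (hst.trans ht)), intervalIntegral.integral_of_le hst,
    ofReal_integral_eq_lintegral_ofReal
      ((intervalIntegrable_iff_integrableOn_Ioc_of_le hst).mp (hint s t hs hst ht))]
  · refine setLIntegral_congr_fun measurableSet_Ioc fun u hu => ?_
    simp only [indicator_of_mem (hsub' (Ioc_subset_Icc_self hu))]
  · rw [Filter.EventuallyLE, ae_restrict_iff' measurableSet_Ioc]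
    exact Filter.Eventually.of_forall fun u hu => h0 u (hsub' (Ioc_subset_Icc_self hu))

lemma arrivalIntensity_univ (hτ : 0 < τ) (hrate : ContinuousOn rate (Icc 0 τ))
    (h0 : ∀ t ∈ Icc 0 τ, 0 ≤ rate t) :
    arrivalIntensity ((Icc 0 τ).indicator rate) τ univ = ENNReal.ofReal (cumRate rate τ) := by
  rw [← measure_add_measure_compl (measurableSet_Ioc (a := (0 : ℝ)) (b := τ)),
    arrivalIntensity_compl, add_zero, arrivalIntensity_Ioc hrate h0 le_rfl hτ.le le_rfl]
  simp [cumRate]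

variable {Ω : Type*} [MeasurableSpace Ω] {P : Measure Ω} {d : ℕ}
  {ν : Measure ((Fin d → ℝ) × Bool)}
  {A : ℕ → Ω → ℝ} {X : ℕ → Ω → (Fin d → ℝ)} {Y : ℕ → Ω → Bool}

lemma IsNHPP.ae_truncSeq_eq (hA : IsNHPP P rate τ A) :
    ∀ᵐ ω ∂P, (∀ i, 0 < A i ω) ∧ {i | A i ω ≤ τ}.Finite ∧
      ∀ i, truncSeq τ (fun i => A i ω) i = if A i ω ≤ τ then A i ω else τ + 1 := by
  filter_upwards [hA.pos, hA.monotone, hA.finite] with ω h1 h2 h3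
  exact ⟨h1, h3, truncSeq_eq h1 h2 h3⟩

lemma IsNHPP.isPoissonArrivals (hA : IsNHPP P rate τ A) (hτ : 0 < τ)
    (hrate : ContinuousOn rate (Icc 0 τ)) (h0 : ∀ t ∈ Icc 0 τ, 0 ≤ rate t) :
    IsPoissonArrivals P (arrivalIntensity ((Icc 0 τ).indicator rate) τ) τ
      (fun ω => truncSeq τ fun i => A i ω) where
  measurable := (measurable_truncSeq τ).comp (measurable_pi_lambda _ hA.measurable)
  isArrivalSeq ω := isArrivalSeq_truncSeq hτ _
  hasLaw_increment s t hs hst ht := by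
    rw [arrivalIntensity_Ioc hrate h0 hs hst ht]
    refine (hA.hasLaw_increment s t hs hst ht).congr ?_
    filter_upwards [hA.ae_truncSeq_eq] with ω hω
    rw [numArrivals_of_trunc hω.2.2 ht, numArrivals_of_trunc hω.2.2 (hst.trans ht)]
  indep_increments := by
    intro k t ht
    refine (hA.indep_increments k t ht).congr fun i => ?_
    filter_upwards [hA.ae_truncSeq_eq] with ω hω
    rw [numArrivals_of_trunc hω.2.2 (t _).2.2, numArrivals_of_trunc hω.2.2 (t _).2.2]

lemma IsIIDMarking.isMarkedPoisson [IsProbabilityMeasure ν] (hXY : IsIIDMarking P ν A X Y)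
    (hA : IsNHPP P rate τ A)
    (hτ : 0 < τ) (hrate : ContinuousOn rate (Icc 0 τ)) (h0 : ∀ t ∈ Icc 0 τ, 0 ≤ rate t) :
    IsMarkedPoisson P (arrivalIntensity ((Icc 0 τ).indicator rate) τ) τ ν
      (fun ω => truncSeq τ fun i => A i ω) (fun ω i => (X i ω, Y i ω)) := by
  have hm : Measurable fun ω i => (X i ω, Y i ω) := measurable_pi_lambda _ fun i =>
    (hXY.measurable_features i).prodMk (hXY.measurable_label i)
  exact ⟨hA.isPoissonArrivals hτ hrate h0, hm,
    hXY.iIndep.hasLaw_infinitePi hXY.hasLaw hm.aemeasurable,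
    hXY.indep_arrivals.comp (measurable_truncSeq τ) measurable_id⟩

variable {G : (Fin d → ℝ) → ℝ}

lemma isProbabilityMeasure_scoreLaw [IsProbabilityMeasure ν] (hG : Measurable G) :
    IsProbabilityMeasure (scoreLaw ν G) :=
  Measure.isProbabilityMeasure_map (hG.comp measurable_fst).aemeasurable

lemma integrable_id_scoreLaw [IsProbabilityMeasure ν] (hG : Measurable G)
    (hG01 : ∀ x, G x ∈ Icc (0 : ℝ) 1) :
    Integrable (fun s => s) (scoreLaw ν G) := by
  have := isProbabilityMeasure_scoreLaw (ν := ν) hG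
  refine Integrable.of_bound measurable_id.aestronglyMeasurable 1 ?_
  have hm : Measurable fun z : (Fin d → ℝ) × Bool => G z.1 := hG.comp measurable_fst
  rw [scoreLaw, ae_map_iff hm.aemeasurable
    (measurableSet_le (by fun_prop) measurable_const)]
  refine Filter.Eventually.of_forall fun z => ?_
  rw [Real.norm_of_nonneg (hG01 z.1).1]
  exact (hG01 z.1).2

lemma measurableSet_fraud : MeasurableSet {z : (Fin d → ℝ) × Bool | z.2 = true} :=
  measurable_snd (measurableSet_singleton true)

lemma measure_fraud_ne_zero (hβ : 0 < fraudProb ν) : ν {z | z.2 = true} ≠ 0 := fun h => by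
  simp [fraudProb, Measure.real, h] at hβ

lemma isProbabilityMeasure_fraudScoreLaw [IsProbabilityMeasure ν] (hG : Measurable G)
    (hβ : 0 < fraudProb ν) :
    IsProbabilityMeasure (fraudScoreLaw ν G) := by
  have := cond_isProbabilityMeasure (measure_fraud_ne_zero hβ)
  exact Measure.isProbabilityMeasure_map (hG.comp measurable_fst).aemeasurable

lemma fraudScoreLaw_Ioi (hG : Measurable G) (x : ℝ) :
    fraudScoreLaw ν G (Ioi x) =
      (ν {z | z.2 = true})⁻¹ * ν {z | x < G z.1 ∧ z.2 = true} := by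
  have hm : Measurable fun z : (Fin d → ℝ) × Bool => G z.1 := hG.comp measurable_fst
  rw [fraudScoreLaw, Measure.map_apply hm measurableSet_Ioi,
    cond_apply measurableSet_fraud, inter_comm]
  rfl

lemma scoreLaw_Ioi (hG : Measurable G) (x : ℝ) :
    scoreLaw ν G (Ioi x) = ν {z | x < G z.1} :=
  Measure.map_apply (hG.comp measurable_fst) measurableSet_Ioi

lemma tailRatio_nonneg (μ₁ μ : Measure ℝ) (f : ℝ → ℝ) (t : ℝ) : 0 ≤ tailRatio μ₁ μ f t :=
  div_nonneg (sub_nonneg.mpr (cdf_le_one _ _)) (sub_nonneg.mpr (cdf_le_one _ _))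

lemma measurable_tailRatio (μ₁ μ : Measure ℝ) {f : ℝ → ℝ} (hf : Measurable f) :
    Measurable (tailRatio μ₁ μ f) :=
  (measurable_const.sub ((monotone_cdf μ₁).measurable.comp hf)).div
    (measurable_const.sub ((monotone_cdf μ).measurable.comp hf))

/-- The probability that a transaction is fraudulent and its score exceeds the threshold. Where no
score does, `tailRatio` is a division by zero, but both sides vanish. -/
lemma measure_fraud_tail [IsProbabilityMeasure ν] (hG : Measurable G)
    (hβ : 0 < fraudProb ν) (f : ℝ → ℝ) (t : ℝ) :
    ν {z | f t < G z.1 ∧ z.2 = true} = ν {z | z.2 = true} *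
      (ENNReal.ofReal (tailRatio (fraudScoreLaw ν G) (scoreLaw ν G) f t) *
        ν {z | f t < G z.1}) := by
  have hp := isProbabilityMeasure_scoreLaw (ν := ν) hG
  have hp1 := isProbabilityMeasure_fraudScoreLaw hG hβ
  have hL := measure_fraud_ne_zero hβ
  have e1 := fraudScoreLaw_Ioi (ν := ν) hG (f t)
  have e2 := scoreLaw_Ioi (ν := ν) hG (f t)
  rw [measure_Ioi_eq_cdf] at e1 e2
  rcases (sub_nonneg.mpr (cdf_le_one (scoreLaw ν G) (f t))).eq_or_lt with h | h
  · rw [← h, ENNReal.ofReal_zero] at e2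
    rw [← e2, mul_zero, mul_zero]
    exact measure_mono_null (fun z hz => hz.1) e2.symm
  · rw [tailRatio, ENNReal.ofReal_div_of_pos h, ← e2,
      ENNReal.div_mul_cancel (ENNReal.ofReal_pos.mpr h).ne' ENNReal.ofReal_ne_top, e1,
      ← mul_assoc, ENNReal.mul_inv_cancel hL (measure_ne_top _ _), one_mul]

/-- The tail ratio is at most `1 / P(Y = 1)`. -/
lemma tailRatio_le [IsProbabilityMeasure ν] (hG : Measurable G)
    (hβ : 0 < fraudProb ν) (f : ℝ → ℝ) (t : ℝ) :
    tailRatio (fraudScoreLaw ν G) (scoreLaw ν G) f t ≤ ((ν {z | z.2 = true})⁻¹).toNNReal := by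
  have hp := isProbabilityMeasure_scoreLaw (ν := ν) hG
  have hp1 := isProbabilityMeasure_fraudScoreLaw hG hβ
  have hL := measure_fraud_ne_zero hβ
  have hLtop : (ν {z | z.2 = true})⁻¹ ≠ ⊤ := ENNReal.inv_ne_top.mpr hL
  have h1 := sub_nonneg.mpr (cdf_le_one (scoreLaw ν G) (f t))
  have hle : fraudScoreLaw ν G (Ioi (f t)) ≤
      (ν {z | z.2 = true})⁻¹ * scoreLaw ν G (Ioi (f t)) := by
    rw [fraudScoreLaw_Ioi hG, scoreLaw_Ioi hG]
    exact mul_le_mul_right (measure_mono fun z hz => hz.1) _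
  rw [measure_Ioi_eq_cdf, measure_Ioi_eq_cdf, ENNReal.ofReal_le_iff_le_toReal
    (ENNReal.mul_ne_top hLtop ENNReal.ofReal_ne_top), ENNReal.toReal_mul,
    ENNReal.toReal_ofReal h1] at hle
  exact div_le_of_le_mul₀ h1 NNReal.zero_le_coe hle

end model

end FraudDetection

theorem mainTheorem3 {Ω : Type*} [MeasurableSpace Ω] (P : Measure Ω) [IsProbabilityMeasure P]
    {d : ℕ} (ν : Measure ((Fin d → ℝ) × Bool)) [IsProbabilityMeasure ν]
    (G : (Fin d → ℝ) → ℝ) (hG : Measurable G) (hG01 : ∀ x, G x ∈ Icc (0 : ℝ) 1)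
    (hβ : 0 < fraudProb ν)
    (rate : ℝ → ℝ) (τ : ℝ) (hτ : 0 < τ)
    (hrate : ContinuousOn rate (Icc 0 τ)) (hrate0 : ∀ t ∈ Icc 0 τ, 0 ≤ rate t)
    (hΛ : 0 < cumRate rate τ)
    (A : ℕ → Ω → ℝ) (X : ℕ → Ω → (Fin d → ℝ)) (Y : ℕ → Ω → Bool)
    (hA : IsNHPP P rate τ A) (hXY : IsIIDMarking P ν A X Y)
    (k : ℝ) (hk : k ∈ Icc (0 : ℝ) 1) (n : ℕ) (hn : n = ⌊k * cumRate rate τ⌋₊)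
    (α : ℕ → ℝ → ℝ) (hα : IsCriticalCurves (scoreLaw ν G) rate τ n α)
    -- `M` is the number of inspections, `T j` the `j`-th waiting time between inspections
    (M : Ω → ℕ)
    (hM : M = fun ω => numInspections n α τ (fun i => A i ω) (fun i => G (X i ω)))
    (T : ℕ → Ω → ℝ)
    (hT : T = fun j ω => waitingTime n α τ (fun i => A i ω) (fun i => G (X i ω)) j) :
    -- conditional density of `T i` given `T 1, …, T (i - 1)`
    (∀ i ∈ Finset.Icc 1 n, ∀ B : Set (Fin (i - 1) → ℝ), MeasurableSet B →
      ∀ C : Set ℝ, MeasurableSet C →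
        P {ω | i ≤ M ω ∧ (fun l : Fin (i - 1) => T (l + 1) ω) ∈ B ∧ T i ω ∈ C} =
          ∫⁻ ω in {ω | i - 1 ≤ M ω ∧ (fun l : Fin (i - 1) => T (l + 1) ω) ∈ B},
            (∫⁻ t in C ∩ Ioi (0 : ℝ), ENNReal.ofReal
              (waitDensity (thinnedRate (scoreLaw ν G) rate τ n α i)
                (∑ l ∈ Finset.Icc 1 (i - 1), T l ω) t)) ∂P) ∧
    -- the expectation over `T 1, …, T j` as an iterated integral
    (∀ j ∈ Finset.Icc 1 n,
      ∫ ω in {ω | j ≤ M ω},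
          tailRatio (fraudScoreLaw ν G) (scoreLaw ν G) (α (n - j + 1))
            (∑ l ∈ Finset.Icc 1 j, T l ω) ∂P =
        iteratedExp (thinnedRate (scoreLaw ν G) rate τ n α)
          (tailRatio (fraudScoreLaw ν G) (scoreLaw ν G) (α (n - j + 1))) j 1 0) ∧
    -- the lower bound for the detection rate
    (1 / cumRate rate τ) * ∑ j ∈ Finset.Icc 1 n,
        ∫ ω in {ω | j ≤ M ω},
          tailRatio (fraudScoreLaw ν G) (scoreLaw ν G) (α (n - j + 1))
            (∑ l ∈ Finset.Icc 1 j, T l ω) ∂P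
      ≤ detectionRate P n α τ A (fun i ω => G (X i ω)) Y := by
  classical
  -- model with bounded measurable data: everything is cut off outside `[0, τ]`
  obtain ⟨C, hC⟩ : ∃ C, ∀ t, (Icc 0 τ).indicator rate t ≤ C := by
    obtain ⟨C, hC⟩ := isCompact_Icc.bddAbove_image hrate
    refine ⟨max C 0, fun t => ?_⟩
    by_cases ht : t ∈ Icc 0 τ
    · rw [indicator_of_mem ht]
      exact (hC ⟨t, ht, rfl⟩).trans (le_max_left _ _)
    · rw [indicator_of_notMem ht]
      exact le_max_right _ _
  have hr0 : ∀ t, 0 ≤ (Icc 0 τ).indicator rate t := fun t => indicator_nonneg hrate0 t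
  have hrm := measurable_indicator_of_continuousOn measurableSet_Icc hrate
  set α' : ℕ → ℝ → ℝ := fun b => if 1 ≤ b ∧ b ≤ n then (Icc 0 τ).indicator (α b) else 0 with hα'
  have hαα : ∀ b, 1 ≤ b → b ≤ n → ∀ t ∈ Icc 0 τ, α' b t = α b t := fun b h1 h2 t ht => by
    simp only [hα', if_pos (And.intro h1 h2), indicator_of_mem ht]
  have hαm : ∀ b, Measurable (α' b) := by
    intro b
    by_cases hb : 1 ≤ b ∧ b ≤ n
    · simp only [hα', if_pos hb]
      exact measurable_indicator_of_continuousOn measurableSet_Icc fun t ht =>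
        ((hα b hb.1 hb.2).2 t ht).continuousWithinAt
    · simp only [hα', if_neg hb]
      exact measurable_zero
  have hprob := isProbabilityMeasure_scoreLaw (ν := ν) hG
  have hanti : ∀ b b', 1 ≤ b' → b' ≤ b → b ≤ n → ∀ t ∈ Icc 0 τ, α' b t ≤ α' b' t := by
    intro b b' h1 h2 h3 t ht
    rw [hαα b (h1.trans h2) h3 t ht, hαα b' h1 (h2.trans h3) t ht]
    exact hα.anti (integrable_id_scoreLaw hG hG01) hrate0 b b' h1 h2 h3 t ht
  have hsc : Measurable fun z : (Fin d → ℝ) × Bool => G z.1 := hG.comp measurable_fst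
  have h := hXY.isMarkedPoisson hA hτ hrate hrate0
  set A' : Ω → ℕ → ℝ := fun ω => truncSeq τ fun i => A i ω with hA'
  set M' : Ω → ℕ := fun ω => numInspections n α' τ (A' ω) (fun i => G (X i ω)) with hM'
  set T' : ℕ → Ω → ℝ := fun j ω => waitingTime n α' τ (A' ω) (fun i => G (X i ω)) j with hT'
  set γ' : ℕ → Ω → ℝ := fun j ω => inspectionTime n α' τ (A' ω) (fun i => G (X i ω)) j with hγ'
  have hM'm : Measurable M' := measurable_numInspections hαm h.arrivals.measurable
    (hsc.comp_seq h.measurable_marks)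
  -- almost surely it gives the same inspections
  have hae : ∀ᵐ ω ∂P, M ω = M' ω ∧ (∀ j, j ≤ M' ω → T j ω = T' j ω ∧
      ∑ l ∈ Finset.Icc 1 j, T l ω = γ' j ω) := by
    filter_upwards [hA.ae_truncSeq_eq] with ω hω
    obtain ⟨h1, h2, h3⟩ := hω
    have hsel := selected_of_trunc (s := fun i => G (X i ω)) h3 h1 hαα
    have hMM : M ω = M' ω := by rw [hM, hM']; simp only [numInspections, hA', hsel]
    have hins : ∀ j, j ≤ M ω → inspectionTime n α τ (fun i => A i ω) (fun i => G (X i ω)) j =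
        γ' j ω := fun j hj => by
      rw [hM] at hj
      exact (inspectionTime_of_trunc h3 h1 h2 hαα hj).symm
    refine ⟨hMM, fun j hj => ⟨?_, ?_⟩⟩
    · rw [hT, hT']
      dsimp only
      rw [waitingTime, waitingTime, hins j (by omega), hins (j - 1) (by omega)]
    · rw [hT, sum_waitingTime, hins j (by omega)]
  have hγIcc : ∀ j ω, j ≤ M' ω → γ' j ω ∈ Icc 0 τ := fun j ω hj =>
    have hs := h.arrivals.isArrivalSeq ω
    inspectionTime_mem_Icc hs.pos hτ (hs.finite le_rfl) hj
  have hthin : ∀ i, 1 ≤ i → i ≤ n →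
      thinnedRate (scoreLaw ν G) ((Icc 0 τ).indicator rate) τ n α' i =
        thinnedRate (scoreLaw ν G) rate τ n α i := by
    intro i h1 h2
    refine indicator_congr fun t ht => ?_
    rw [hαα _ (by omega) (by omega) t ht, indicator_of_mem ht]
  -- the expectations in the second and third claims
  have hmean : ∀ j ∈ Finset.Icc 1 n, ∫ ω in {ω | j ≤ M ω},
        tailRatio (fraudScoreLaw ν G) (scoreLaw ν G) (α (n - j + 1))
          (∑ l ∈ Finset.Icc 1 j, T l ω) ∂P =
      ∫ ω in {ω | j ≤ M' ω}, tailRatio (fraudScoreLaw ν G) (scoreLaw ν G) (α' (n - j + 1))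
        (γ' j ω) ∂P := by
    intro j hj
    obtain ⟨hj1, hj2⟩ := Finset.mem_Icc.mp hj
    rw [Measure.restrict_congr_set (t := {ω | j ≤ M' ω})]
    · refine setIntegral_congr_ae (measurableSet_le measurable_const hM'm) ?_
      filter_upwards [hae] with ω hω hjω
      rw [(hω.2 j hjω).2, tailRatio, tailRatio,
        hαα _ (by omega) (by omega) _ (hγIcc j ω hjω)]
    · filter_upwards [hae] with ω hω
      exact congrArg (j ≤ ·) hω.1
  refine ⟨?_, ?_, ?_⟩
  · intro i hi B hB D hD
    obtain ⟨hi1, hi2⟩ := Finset.mem_Icc.mp hi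
    obtain ⟨k, rfl⟩ : ∃ k, i = k + 1 := ⟨i - 1, by omega⟩
    have key := h.measure_waitingTime hτ hrm hr0 hC hαm hsc (k := k) (by omega) hB hD
      hM' hT'
    change P {ω | k + 1 ≤ M ω ∧ (fun l : Fin k => T (l + 1) ω) ∈ B ∧ T (k + 1) ω ∈ D} =
      ∫⁻ ω in {ω | k ≤ M ω ∧ (fun l : Fin k => T (l + 1) ω) ∈ B},
        (∫⁻ t in D ∩ Ioi 0, ENNReal.ofReal
          (waitDensity (thinnedRate (scoreLaw ν G) rate τ n α (k + 1))
            (∑ l ∈ Finset.Icc 1 k, T l ω) t)) ∂P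
    have hT : ∀ᵐ ω ∂P, k ≤ M' ω →
        (fun l : Fin k => T (l + 1) ω) = fun l : Fin k => T' (l + 1) ω := by
      filter_upwards [hae] with ω hω hkω
      exact funext fun l => (hω.2 (l + 1) (by omega)).1
    calc _ = P {ω | k + 1 ≤ M' ω ∧ (fun l : Fin k => T' (l + 1) ω) ∈ B ∧ T' (k + 1) ω ∈ D} := by
          refine measure_congr (Filter.eventuallyEq_set.mpr ?_)
          filter_upwards [hae, hT] with ω hω hTω
          simp only [hω.1]
          refine and_congr_right fun hk1 => ?_
          rw [hTω (by omega), (hω.2 (k + 1) hk1).1]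
      _ = _ := key
      _ = ∫⁻ ω in {ω | k ≤ M' ω ∧ (fun l : Fin k => T' (l + 1) ω) ∈ B},
          (∫⁻ t in D ∩ Ioi 0, ENNReal.ofReal
            (waitDensity (thinnedRate (scoreLaw ν G) rate τ n α (k + 1))
              (∑ l ∈ Finset.Icc 1 k, T l ω) t)) ∂P := by
          have hTm : ∀ j, Measurable (T' j) := measurable_waitingTime hαm h.arrivals.measurable
            (hsc.comp_seq h.measurable_marks)
          refine setLIntegral_congr_fun_ae ((measurableSet_le measurable_const hM'm).inter
            ((measurable_pi_lambda _ fun l : Fin k => hTm (l + 1)) hB)) ?_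
          filter_upwards [hae] with ω hω hkω
          rw [← hthin (k + 1) hi1 hi2, (hω.2 k hkω.1).2, hT']
          dsimp only
          rw [sum_waitingTime]
          rfl
      _ = _ := by
          rw [Measure.restrict_congr_set (Filter.eventuallyEq_set.mpr _)]
          filter_upwards [hae, hT] with ω hω hTω
          simp only [hω.1]
          refine and_congr_right fun hk1 => ?_
          rw [hTω hk1]
  · intro j hj
    rw [hmean j hj]
    obtain ⟨hj1, hj2⟩ := Finset.mem_Icc.mp hj
    rw [h.integral_eq_iteratedExp hτ hrm hr0 hC hαm hsc hM' hγ'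
      (measurable_tailRatio _ _ (hαm _)) (tailRatio_nonneg _ _ _) (tailRatio_le hG hβ _) hj2]
    refine iteratedExp_congr (n := n) hthin (fun i t ht => indicator_of_notMem ht _)
      (fun t ht => ?_) j 1 le_rfl (by omega) ⟨le_rfl, hτ.le⟩
    rw [tailRatio, tailRatio, hαα _ (by omega) (by omega) t ht]
  · rw [Finset.sum_congr rfl hmean]
    set N : Ω → ℕ := fun ω => numFrauds τ (A' ω) (fun i => Y i ω) with hN
    set D : Ω → ℕ := fun ω => numDetected n α' τ (A' ω) (fun i => G (X i ω)) (fun i => Y i ω)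
      with hD
    have hlabm : Measurable fun ω i => Y i ω := measurable_snd.comp_seq h.measurable_marks
    have hNm : Measurable N := measurable_numFrauds h.arrivals.measurable hlabm
    have hDm : Measurable D := measurable_numDetected hαm h.arrivals.measurable
      (hsc.comp_seq h.measurable_marks) hlabm
    have hI := arrivalIntensity_compl ((Icc 0 τ).indicator rate) τ
    have hIu := arrivalIntensity_univ hτ hrate hrate0
    have := isFiniteMeasure_arrivalIntensity hC τ
    have hβ0 := measure_fraud_ne_zero hβ
    have hlab : Measurable fun z : (Fin d → ℝ) × Bool => z.2 := measurable_snd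
    set Q : ℕ → ℝ → ℝ := fun b => tailRatio (fraudScoreLaw ν G) (scoreLaw ν G) (α' b) with hQ
    have hQm : ∀ b, Measurable (Q b) := fun b => measurable_tailRatio _ _ (hαm b)
    have key := h.measure_mul_sum_le hτ hI hαm hsc hlab hβ0 hanti
      (q := fun b t => ENNReal.ofReal (Q b t)) (fun b => (hQm b).ennreal_ofReal)
      (fun b t => measure_fraud_tail hG hβ (α' b) t) hM' hγ' hN hD
    have hpos : P {ω | 1 ≤ N ω} ≠ 0 := h.measure_one_le_numFrauds_ne_zero hτ hI
      (by rw [hIu]; exact (ENNReal.ofReal_pos.mpr hΛ).ne') hlab hβ0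
    set S : Set Ω := {ω | 1 ≤ N ω} with hS
    have hdet : detectionRate P n α τ A (fun i ω => G (X i ω)) Y =
        (P S).toReal⁻¹ * (∫⁻ ω in S, (D ω / N ω : ENNReal) ∂P).toReal := by
      rw [← integral_cond_natCast_div hNm hDm, detectionRate]
      have hND : ∀ᵐ ω ∂P, numFrauds τ (fun i => A i ω) (fun i => Y i ω) = N ω ∧
          numDetected n α τ (fun i => A i ω) (fun i => G (X i ω)) (fun i => Y i ω) = D ω := by
        filter_upwards [hA.ae_truncSeq_eq] with ω hω
        refine ⟨(numFrauds_of_trunc hω.2.2).symm, ?_⟩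
        simp only [hD, hA', numDetected, selected_of_trunc hω.2.2 hω.1 hαα]
      have hSS : {ω | 1 ≤ numFrauds τ (fun i => A i ω) (fun i => Y i ω)} =ᵐ[P] S := by
        refine Filter.eventuallyEq_set.mpr ?_
        filter_upwards [hND] with ω hω
        simp only [hS, mem_ofPred_eq, hω.1]
      rw [ProbabilityTheory.cond, ProbabilityTheory.cond, measure_congr hSS,
        Measure.restrict_congr_set hSS]
      refine integral_congr_ae (Measure.smul_absolutelyContinuous (ae_restrict_of_ae ?_))
      filter_upwards [hND] with ω hω
      rw [hω.1, hω.2]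
    have hsum : ∑ j ∈ Finset.range n, ∫⁻ ω in {ω | j + 1 ≤ M' ω},
        ENNReal.ofReal (Q (n - j) (γ' (j + 1) ω)) ∂P = ENNReal.ofReal (∑ j ∈ Finset.Icc 1 n,
          ∫ ω in {ω | j ≤ M' ω}, Q (n - j + 1) (γ' j ω) ∂P) := by
      rw [ENNReal.ofReal_sum_of_nonneg fun j _ => integral_nonneg fun ω => tailRatio_nonneg _ _ _ _,
        Finset.range_eq_Ico, show Finset.Icc 1 n = Finset.Ico (0 + 1) (n + 1) by ext; simp,
        ← Finset.sum_Ico_add' (fun j => ENNReal.ofReal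
          (∫ ω in {ω | j ≤ M' ω}, Q (n - j + 1) (γ' j ω) ∂P)) 0 n 1]
      refine Finset.sum_congr rfl fun j hj => ?_
      have hjn := (Finset.mem_Ico.mp hj).2
      rw [show n - (j + 1) + 1 = n - j by omega]
      have hγm : Measurable (γ' (j + 1)) := measurable_inspectionTime hαm h.arrivals.measurable
        (hsc.comp_seq h.measurable_marks) (j + 1)
      refine (ofReal_integral_eq_lintegral_ofReal ?_
        (Filter.Eventually.of_forall fun ω => tailRatio_nonneg _ _ _ _)).symm
      refine Integrable.of_bound ((hQm _).comp hγm).aestronglyMeasurable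
        ((ν {z | z.2 = true})⁻¹).toNNReal
        (Filter.Eventually.of_forall fun ω => ?_)
      rw [Real.norm_of_nonneg (tailRatio_nonneg _ _ _ _)]
      exact tailRatio_le hG hβ _ _
    rw [hsum, hIu] at key
    have hfin : ∫⁻ ω in S, (D ω / N ω : ENNReal) ∂P ≠ ⊤ := by
      refine ne_top_of_le_ne_top (measure_ne_top P S) ?_
      rw [← setLIntegral_one]
      refine lintegral_mono fun ω => ENNReal.div_le_of_le_mul ?_
      rw [one_mul]
      exact_mod_cast numDetected_le_numFrauds ((h.arrivals.isArrivalSeq ω).finite le_rfl)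
    have hreal := ENNReal.toReal_mono (ENNReal.mul_ne_top ENNReal.ofReal_ne_top hfin) key
    rw [ENNReal.toReal_mul, ENNReal.toReal_mul, ENNReal.toReal_ofReal hΛ.le,
      ENNReal.toReal_ofReal (Finset.sum_nonneg fun j _ => integral_nonneg fun ω =>
        tailRatio_nonneg _ _ _ _)] at hreal
    have hP0 : 0 < (P S).toReal := ENNReal.toReal_pos hpos (measure_ne_top _ _)
    rw [hdet, one_div, inv_mul_le_iff₀ hΛ, mul_left_comm, le_inv_mul_iff₀ hP0]
    exact hreal
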